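/- Let $k$ be a field, $Q$ a finite quiver with vertex set $Q_0$ and arrow set $Q_1$, and $I\subseteq kQ$ an ideal generated by paths of length two, such that $A=kQ/I$ is a gentle algebra: $A$ is finite-dimensional; every vertex has at most two incoming and at most two outgoing arrows; and for every arrow $\alpha$ there is at most one arrow $\beta$ with $\alpha\beta$ a path not in $I$, at most one arrow $\gamma$ with $\gamma\alpha$ a path not in $I$, at most one arrow $\beta$ with $\alpha\beta$ a path in $I$, and at most one arrow $\gamma$ with $\gamma\alpha$ a path in $I$. Assume that $A$ is a brick algebra, i.e. every indecomposable finitely generated $A$-module has a division ring as its endomorphism ring. Let $\overline Q$ be obtained from $Q$ by adding an arrow $\gamma^*$ opposite to each arrow $\gamma$, and let $\Pi(A)=k\overline Q/\langle \beta\alpha,\ \alpha^*\beta^* : \beta\alpha \text{ a generator of } I\rangle$. All modules are finitely generated left modules, and subcategories are full and closed under isomorphism. *Strings.* A string of a bound quiver with quadratic monomial relations is a lazy path $e_x$ or a walk $w=\gamma_d^{\epsilon_d}\cdots\gamma_1^{\epsilon_1}$ in which no letter is followed by its inverse and such that neither $w$ nor $w^{-1}$ contains a relation; $w$ and $w^{-1}$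 are identified. $\mathrm{Str}(A)$ is the set of strings of $A$, and $M(w)$ is the string module of $w$. Let $\widetilde{\mathrm{Str}}(A)$ be the set of strings of $\Pi(A)$ that become strings of $A$ when $\gamma^*$ is replaced by $\gamma^{-1}$ and $(\gamma^*)^{-1}$ by $\gamma$, and let $\mathcal M=\mathrm{add}\{M(\widetilde w):\widetilde w\in\widetilde{\mathrm{Str}}(A)\}\subseteq \mathrm{mod}(\Pi(A))$. *Shadows.* Let $\mathrm{torshad}(\Pi(A))$ be the set of all $\mathcal T\cap\mathcal M$ with $\mathcal T$ a torsion class of $\mathrm{mod}(\Pi(A))$ (a subcategory containing $0$ and closed under quotients and extensions), and let $\mathrm{widshad}(\Pi(A))$ be the set of all $\mathcal W\cap\mathcal M$ with $\mathcal W$ a wide subcategory (containing $0$ and closed under kernels, cokernels and extensions). Both are ordered by inclusion. *Biclosed sets and labels.* A set $B\subseteq\mathrm{Str}(A)$ is closed if $u,v\in B$ and $v\gamma^{\pm1}u\in\mathrm{Str}(A)$ with $\gamma\in Q_1$ imply $v\gamma^{\pm1}u\in B$; it is biclosed if $B$ and its complement are closed. $\mathrm{Bic}(A)$ is the poset of biclosed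 sets ordered by inclusion. If $w=w_1\gamma_j^{\pm1}w_2$, then $\{w_1,w_2\}$ is called a break of $w$, and $w_1,w_2$ are splits of $w$. A label $w_{\mathcal D}$ is a string $w\in\mathrm{Str}(A)$ together with a set $\mathcal D$ of splits of $w$ containing exactly one member of each break of $w$. It defines $\mathrm{str}(w_{\mathcal D})\in\widetilde{\mathrm{Str}}(A)$, the string specializing to $w$ in which the $i$-th letter is direct if the part of $w$ before that letter lies in $\mathcal D$, and inverse if the part of $w$ after it lies in $\mathcal D$. A covering relation $B'\lessdot B=B'\sqcup\{w\}$ in $\mathrm{Bic}(A)$ is labelled by $\lambda(B',B)=w_{\mathcal D}$, where $\mathcal D$ is the set of splits of $w$ lying in $B'$. For $B\in\mathrm{Bic}(A)$ let $\psi(B)=\{\lambda(C,C') : m\le C\lessdot C'\le B\}$, where $m$ is the meet of all elements covered by $B$, and let $\Psi(\mathrm{Bic}(A))=\{\psi(B): B\in\mathrm{Bic}(A)\}$, ordered by inclusion (the shard intersection order). **Theorem.** There is a bijection $\Phi:\mathrm{torshad}(\Pi(A))\to\mathrm{widshad}(\Pi(A))$. More precisely, $\Phi=\vartheta\circ\psi\circ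 B(-)$, where 1. $B(-):\mathrm{torshad}(\Pi(A))\to\mathrm{Bic}(A)$, $B(\widetilde{\mathfrak T})=\{w\in\mathrm{Str}(A) : M(\mathrm{str}(w_{\mathcal D}))\in\widetilde{\mathfrak T}\text{ for some label } w_{\mathcal D}\}$, is an isomorphism of posets; its inverse sends $B$ to $\mathcal T^*\cap\mathcal M$, where $\mathcal T^*$ is the smallest torsion class of $\mathrm{mod}(\Pi(A))$ containing $M(\mathrm{str}(w_{\mathcal D}))$ for all labels $w_{\mathcal D}=\lambda(B',B)$ with $B'\lessdot B$; 2. $\psi:\mathrm{Bic}(A)\to\Psi(\mathrm{Bic}(A))$, $B\mapsto\psi(B)$, is a bijection; 3. $\vartheta:\Psi(\mathrm{Bic}(A))\to\mathrm{widshad}(\Pi(A))$, $P\mapsto\mathrm{add}\{M(\mathrm{str}(w_{\mathcal D})) : w_{\mathcal D}\in P\}$, is an isomorphism of posets. -/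

import Mathlib

open CategoryTheory CategoryTheory.Limits

universe u v w

/-! ### Bound quivers with quadratic monomial relations, and their algebras -/

/-- A quiver with vertex set `V` and arrow set `E`, together with a set of paths of length two.
`rel b a` says that the path `b a` (first `a`, then `b`) is one of the chosen paths. -/
structure BoundQuiver (V : Type v) (E : Type w) where
  src : E → V
  tgt : E → V
  rel : E → E → Prop
  src_eq_tgt_of_rel : ∀ b a, rel b a → src b = tgt a

namespace BoundQuiver

variable {V : Type v} {E : Type w}

/-- Defining relations of the algebra `kQ/I` on the generators `e_x` (`x` a vertex) and `a`
(`a` an arrow): the `e_x` are orthogonal idempotents with sum `1`, arrows are composed like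
functions (`a = e_{t(a)} a e_{s(a)}`), and the chosen paths of length two vanish. -/
inductive AlgRel (k : Type u) [Field k] [Fintype V] (Q : BoundQuiver V E) :
    FreeAlgebra k (V ⊕ E) → FreeAlgebra k (V ⊕ E) → Prop
  | idem (x : V) : AlgRel k Q
      (FreeAlgebra.ι k (Sum.inl x) * FreeAlgebra.ι k (Sum.inl x)) (FreeAlgebra.ι k (Sum.inl x))
  | orth (x y : V) (h : x ≠ y) : AlgRel k Q
      (FreeAlgebra.ι k (Sum.inl x) * FreeAlgebra.ι k (Sum.inl y)) 0
  | unit : AlgRel k Q (∑ x : V, FreeAlgebra.ι k (Sum.inl x)) 1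
  | tgt_mul (a : E) : AlgRel k Q
      (FreeAlgebra.ι k (Sum.inl (Q.tgt a)) * FreeAlgebra.ι k (Sum.inr a))
      (FreeAlgebra.ι k (Sum.inr a))
  | mul_src (a : E) : AlgRel k Q
      (FreeAlgebra.ι k (Sum.inr a) * FreeAlgebra.ι k (Sum.inl (Q.src a)))
      (FreeAlgebra.ι k (Sum.inr a))
  | zero (b a : E) (h : Q.rel b a) : AlgRel k Q
      (FreeAlgebra.ι k (Sum.inr b) * FreeAlgebra.ι k (Sum.inr a)) 0

/-- The algebra `kQ/I`, where `I` is the ideal of the path algebra `kQ` generated by the chosen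
paths of length two (the path algebra being presented by generators and relations). -/
abbrev Alg (k : Type u) [Field k] [Fintype V] (Q : BoundQuiver V E) : Type (max u v w) :=
  RingQuot (AlgRel k Q)

/-- The conditions for `kQ/I` to be a gentle algebra. Since `I` is generated by paths of length
two, finite-dimensionality of `kQ/I` amounts to admissibility of `I`, and a path `b a` of length
two lies in `I` if and only if `rel b a`. -/
structure IsGentle (k : Type u) [Field k] [Fintype V] (Q : BoundQuiver V E) : Prop where
  finite_dimensional : Module.Finite k (Q.Alg k)
  incoming : ∀ x : V, {a : E | Q.tgt a = x}.encard ≤ 2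
  outgoing : ∀ x : V, {a : E | Q.src a = x}.encard ≤ 2
  nonrel_right : ∀ a : E, {b : E | Q.src a = Q.tgt b ∧ ¬ Q.rel a b}.Subsingleton
  nonrel_left : ∀ a : E, {c : E | Q.src c = Q.tgt a ∧ ¬ Q.rel c a}.Subsingleton
  rel_right : ∀ a : E, {b : E | Q.rel a b}.Subsingleton
  rel_left : ∀ a : E, {c : E | Q.rel c a}.Subsingleton

/-- Every indecomposable finitely generated `kQ/I`-module has a division ring of endomorphisms. -/
def IsBrickAlgebra (k : Type u) [Field k] [Fintype V] (Q : BoundQuiver V E) : Prop :=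
  ∀ X : ModuleCat.{u} (Q.Alg k), Module.Finite (Q.Alg k) X → Indecomposable X →
    ∀ f : X ⟶ X, f ≠ 0 → IsIso f

/-- Relations of the doubled quiver: `β α` and `α* β*` for every relation `β α`. -/
inductive DoubleRel (Q : BoundQuiver V E) : E ⊕ E → E ⊕ E → Prop
  | base (b a : E) (h : Q.rel b a) : DoubleRel Q (Sum.inl b) (Sum.inl a)
  | star (b a : E) (h : Q.rel b a) : DoubleRel Q (Sum.inr a) (Sum.inr b)

/-- The doubled bound quiver; `inl a` is the arrow `a` and `inr a` is the reversed arrow `a*`.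
The algebra `Π(A)` attached to `A = kQ/I` is `Q.double.Alg k`. -/
def double (Q : BoundQuiver V E) : BoundQuiver V (E ⊕ E) where
  src := Sum.elim Q.src Q.tgt
  tgt := Sum.elim Q.tgt Q.src
  rel := Q.DoubleRel
  src_eq_tgt_of_rel := by
    rintro _ _ (⟨b, a, h⟩ | ⟨b, a, h⟩)
    · exact Q.src_eq_tgt_of_rel b a h
    · exact (Q.src_eq_tgt_of_rel b a h).symm

/-! ### Strings -/

/-- Source of a letter; `(a, true)` is the arrow `a`, `(a, false)` its formal inverse. -/
def lsrc (Q : BoundQuiver V E) (l : E × Bool) : V := if l.2 then Q.src l.1 else Q.tgt l.1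

/-- Target of a letter. -/
def ltgt (Q : BoundQuiver V E) (l : E × Bool) : V := if l.2 then Q.tgt l.1 else Q.src l.1

/-- The formal inverse of a letter. -/
def flip (l : E × Bool) : E × Bool := (l.1, !l.2)

/-- `l` may be followed by `m` in a string: `m l` is a walk, `m` is not the inverse of `l`, and
neither `m l` nor its inverse is one of the relations. -/
def Step (Q : BoundQuiver V E) (l m : E × Bool) : Prop :=
  Q.lsrc m = Q.ltgt l ∧ m ≠ flip l ∧
    (l.2 = true → m.2 = true → ¬ Q.rel m.1 l.1) ∧
    (l.2 = false → m.2 = false → ¬ Q.rel l.1 m.1)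

end BoundQuiver

/-- A word: a starting vertex and letters `γ₁, γ₂, …, γ_d` in the order in which they are
traversed (so this is the word usually written `γ_d ⋯ γ₂ γ₁`). The words without letters are the
lazy paths. -/
@[ext]
structure QWord (V : Type v) (E : Type w) where
  start : V
  letters : List (E × Bool)

namespace BoundQuiver

variable {V : Type v} {E : Type w}

/-- A word is a string if it is a walk satisfying `Step` at every pair of consecutive letters. -/
def IsString (Q : BoundQuiver V E) (c : QWord V E) : Prop :=
  (∀ l ∈ c.letters.head?, Q.lsrc l = c.start) ∧ c.letters.IsChain Q.Step

/-- The vertex reached after the first `i` letters of a word. -/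
def vertex (Q : BoundQuiver V E) (c : QWord V E) (i : ℕ) : V :=
  (c.letters.take i).foldl (fun _ l => Q.ltgt l) c.start

/-- The inverse word. -/
def inv (Q : BoundQuiver V E) (c : QWord V E) : QWord V E :=
  ⟨Q.vertex c c.letters.length, (c.letters.map flip).reverse⟩

/-- The words that are strings. -/
def StringWord (Q : BoundQuiver V E) : Type (max v w) := {c : QWord V E // Q.IsString c}

theorem foldl_last {α : Type*} {β : Type*} (f : α → β) (s : β) (L : List α) :
    L.foldl (fun _ l => f l) s = (L.getLast?.map f).getD s := by
  induction L using List.reverseRecOn with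
  | nil => rfl
  | append_singleton L a _ => simp

theorem inv_inv (Q : BoundQuiver V E) (c : QWord V E) (hc : Q.IsString c) :
    Q.inv (Q.inv c) = c := by
  have hflip : (flip ∘ flip : E × Bool → E × Bool) = id := by
    funext l; simp [flip]
  obtain ⟨s, L⟩ := c
  cases L with
  | nil => simp [inv, vertex]
  | cons a L =>
    have h1 : Q.lsrc a = s := hc.1 a (by simp)
    ext1
    · simp only [inv, vertex, List.take_length, foldl_last]
      rcases a with ⟨a, _ | _⟩ <;> simp [← h1, lsrc, ltgt, flip]
    · simp [inv, hflip, flip]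

/-- Two string words are identified if they are equal or inverse to each other. -/
def strSetoid (Q : BoundQuiver V E) : Setoid Q.StringWord where
  r c d := c.1 = d.1 ∨ c.1 = Q.inv d.1
  iseqv := by
    refine ⟨fun _ => Or.inl rfl, ?_, ?_⟩
    · rintro c d (h | h)
      · exact Or.inl h.symm
      · right; rw [h, inv_inv Q _ d.2]
    · rintro c d e (h | h) (h' | h')
      · exact Or.inl (h.trans h')
      · exact Or.inr (h.trans h')
      · exact Or.inr (by rw [h, h'])
      · exact Or.inl (by rw [h, h', inv_inv Q _ e.2])

/-- The set `Str` of strings, where a string is identified with its inverse. -/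
def Str (Q : BoundQuiver V E) : Type (max v w) := Quotient Q.strSetoid

/-- The string represented by a string word. -/
def StringWord.toStr {Q : BoundQuiver V E} (c : Q.StringWord) : Q.Str :=
  Quotient.mk Q.strSetoid c

/-- `IsConcat u v w`: the string `w` is a concatenation `v γ^{±1} u` of `u` and `v`
(for suitable representatives). -/
def IsConcat {Q : BoundQuiver V E} (u v w : Q.Str) : Prop :=
  ∃ (c d e : Q.StringWord) (l : E × Bool), c.toStr = u ∧ d.toStr = v ∧ e.toStr = w ∧
    d.1.start = Q.ltgt l ∧ e.1 = ⟨c.1.start, c.1.letters ++ l :: d.1.letters⟩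

/-- `u` is a split of `w`: one of the two members of a break of `w`. -/
def IsSplit {Q : BoundQuiver V E} (u w : Q.Str) : Prop :=
  ∃ v : Q.Str, IsConcat u v w ∨ IsConcat v u w

/-! ### Biclosed sets of strings, the edge labelling, and the shard intersection order -/

/-- A set of strings closed under concatenation. -/
def IsClosedStr {Q : BoundQuiver V E} (B : Set Q.Str) : Prop :=
  ∀ u v w : Q.Str, IsConcat u v w → u ∈ B → v ∈ B → w ∈ B

/-- The poset of biclosed sets of strings, ordered by inclusion. -/
def Bic (Q : BoundQuiver V E) : Type (max v w) :=
  {B : Set Q.Str // IsClosedStr B ∧ IsClosedStr Bᶜ}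

instance (Q : BoundQuiver V E) : PartialOrder Q.Bic :=
  inferInstanceAs (PartialOrder {B : Set Q.Str // IsClosedStr B ∧ IsClosedStr Bᶜ})

/-- The set of labels: pairs `(w, D)` where `D` is a set of splits of the string `w` containing
exactly one string from each break of `w`. -/
def Label (Q : BoundQuiver V E) : Type (max v w) :=
  {p : Q.Str × Set Q.Str //
    (∀ u ∈ p.2, IsSplit u p.1) ∧ ∀ u v, IsConcat u v p.1 → (u ∈ p.2 ↔ v ∉ p.2)}

/-- `B'` is covered by `B`, `B = B' ⊔ {w}`, and the edge `(B', B)` has label `(w, D)` with `D` the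
set of the splits of `w` that lie in `B'`. -/
def HasLabel {Q : BoundQuiver V E} (B' B : Q.Bic) (p : Q.Label) : Prop :=
  B' ⋖ B ∧ p.1.1 ∉ B'.1 ∧ B.1 = insert p.1.1 B'.1 ∧ p.1.2 = {u | IsSplit u p.1.1 ∧ u ∈ B'.1}

/-- The labels of the edges from `B` down to the elements it covers. -/
def labelsDown {Q : BoundQuiver V E} (B : Q.Bic) : Set Q.Label := {p | ∃ B', HasLabel B' B p}

/-- The set `ψ(B)` of the labels of all edges in the interval `[m, B]`, where `m` is the meet of
the elements covered by `B`. -/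
def shardSet {Q : BoundQuiver V E} (B : Q.Bic) : Set Q.Label :=
  {p | ∃ m C C' : Q.Bic, IsGLB {B' : Q.Bic | B' ⋖ B} m ∧ m ≤ C ∧ C' ≤ B ∧ HasLabel C C' p}

/-- The shard intersection order of the lattice of biclosed sets: all sets `ψ(B)`, ordered by
inclusion. -/
def ShardOrder (Q : BoundQuiver V E) : Type (max v w) :=
  {P : Set Q.Label // ∃ B : Q.Bic, P = shardSet B}

instance (Q : BoundQuiver V E) : PartialOrder Q.ShardOrder :=
  inferInstanceAs (PartialOrder {P : Set Q.Label // ∃ B : Q.Bic, P = shardSet B})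

/-! ### String modules -/

/-- The underlying space of a string module: one basis vector for each visited vertex. -/
def StringSpace (k : Type u) (c : QWord V E) : Type u := Fin (c.letters.length + 1) → k

noncomputable instance (k : Type u) [Field k] (c : QWord V E) : AddCommGroup (StringSpace k c) :=
  inferInstanceAs (AddCommGroup (Fin (c.letters.length + 1) → k))

noncomputable instance (k : Type u) [Field k] (c : QWord V E) : Module k (StringSpace k c) :=
  inferInstanceAs (Module k (Fin (c.letters.length + 1) → k))

open Classical in
/-- Matrices of the generators on the string module: `e_x` projects to the basis vectors at the
vertex `x`, and `a` sends the `i`-th basis vector to the `j`-th one if these are joined by a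
letter `a` traversed from `i` to `j`, or by a letter `a⁻¹` traversed from `j` to `i`. -/
noncomputable def genMatrix (k : Type u) [Field k] (Q : BoundQuiver V E) (c : QWord V E) :
    V ⊕ E → Matrix (Fin (c.letters.length + 1)) (Fin (c.letters.length + 1)) k
  | Sum.inl x => Matrix.diagonal fun i => if Q.vertex c i = x then 1 else 0
  | Sum.inr a => Matrix.of fun j i =>
      if (j.val = i.val + 1 ∧ c.letters[i.val]? = some (a, true)) ∨
          (i.val = j.val + 1 ∧ c.letters[j.val]? = some (a, false)) then 1 else 0

theorem vertex_succ (Q : BoundQuiver V E) (c : QWord V E) (i : ℕ) (l : E × Bool)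
    (h : c.letters[i]? = some l) : Q.vertex c (i + 1) = Q.ltgt l := by
  simp [vertex, List.take_add_one, h]

theorem vertex_of_letter (Q : BoundQuiver V E) (c : QWord V E) (hc : Q.IsString c) (i : ℕ)
    (l : E × Bool) (h : c.letters[i]? = some l) : Q.vertex c i = Q.lsrc l := by
  cases i with
  | zero =>
    rw [hc.1 l (by simpa [List.head?_eq_getElem?] using h)]
    simp [vertex]
  | succ i =>
    obtain ⟨hi, rfl⟩ := List.getElem?_eq_some_iff.1 h
    have h2 := List.isChain_iff_getElem.1 hc.2 i hi
    rw [vertex_succ Q c i _ (List.getElem?_eq_getElem (by omega)), h2.1]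

theorem step_of_letters (Q : BoundQuiver V E) (c : QWord V E) (hc : Q.IsString c) (i : ℕ)
    (l m : E × Bool) (h : c.letters[i]? = some l) (h' : c.letters[i + 1]? = some m) :
    Q.Step l m := by
  obtain ⟨hi, rfl⟩ := List.getElem?_eq_some_iff.1 h
  obtain ⟨hj, rfl⟩ := List.getElem?_eq_some_iff.1 h'
  exact List.isChain_iff_getElem.1 hc.2 i hj

theorem genMatrix_rel (k : Type u) [Field k] [Fintype V] (Q : BoundQuiver V E) (c : QWord V E)
    (hc : Q.IsString c) ⦃x y : FreeAlgebra k (V ⊕ E)⦄ (h : AlgRel k Q x y) :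
    FreeAlgebra.lift k (genMatrix k Q c) x = FreeAlgebra.lift k (genMatrix k Q c) y := by
  classical
  cases h with
  | idem x =>
    simp [genMatrix]
  | orth x y h =>
    simp only [map_mul, FreeAlgebra.lift_ι_apply, genMatrix, map_zero,
      Matrix.diagonal_mul_diagonal]
    ext i j
    by_cases hij : i = j
    · subst hij
      by_cases hx : Q.vertex c i = x
      · simp [hx, h]
      · simp [hx]
    · simp [hij]
  | unit =>
    simp only [map_sum, FreeAlgebra.lift_ι_apply, genMatrix, map_one]
    ext i j
    by_cases hij : i = j
    · subst hij
      simp [Matrix.sum_apply]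
    · simp [hij, Matrix.sum_apply]
  | tgt_mul a =>
    simp only [map_mul, FreeAlgebra.lift_ι_apply, genMatrix]
    ext j i
    simp only [Matrix.diagonal_mul, Matrix.of_apply]
    split_ifs with h1 h2 h2 <;> simp
    apply h1
    rcases h2 with ⟨h2, h3⟩ | ⟨h2, h3⟩
    · rw [h2, vertex_succ Q c _ _ h3]; simp [ltgt]
    · rw [vertex_of_letter Q c hc _ _ h3]; simp [lsrc]
  | mul_src a =>
    simp only [map_mul, FreeAlgebra.lift_ι_apply, genMatrix]
    ext j i
    simp only [Matrix.mul_diagonal, Matrix.of_apply]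
    split_ifs with h2 h1 h1 <;> simp
    apply h1
    rcases h2 with ⟨h2, h3⟩ | ⟨h2, h3⟩
    · rw [vertex_of_letter Q c hc _ _ h3]; simp [lsrc]
    · rw [h2, vertex_succ Q c _ _ h3]; simp [ltgt]
  | zero b a h =>
    simp only [map_mul, FreeAlgebra.lift_ι_apply, genMatrix, map_zero]
    ext j i
    rw [Matrix.mul_apply]
    apply Finset.sum_eq_zero
    intro m _
    simp only [Matrix.of_apply]
    split_ifs with h1 h2 h2 <;> simp
    rcases h1 with ⟨h1, h3⟩ | ⟨h1, h3⟩ <;> rcases h2 with ⟨h2, h4⟩ | ⟨h2, h4⟩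
    · rw [h2] at h3
      exact (step_of_letters Q c hc _ _ _ h4 h3).2.2.1 rfl rfl h
    · rw [h3] at h4; simp at h4
    · have : i.val = j.val := by omega
      rw [this, h3] at h4; simp at h4
    · rw [h1] at h4
      exact (step_of_letters Q c hc _ _ _ h3 h4).2.2.2 rfl rfl h

/-- The action of `kQ/I` on the string module. -/
noncomputable def stringAction (k : Type u) [Field k] [Fintype V] (Q : BoundQuiver V E)
    (c : Q.StringWord) : Q.Alg k →ₐ[k] Module.End k (StringSpace k c.1) :=
  (Matrix.toLinAlgEquiv' (R := k) (n := Fin (c.1.letters.length + 1))).toAlgHom.comp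
    (RingQuot.liftAlgHom k
      ⟨FreeAlgebra.lift k (genMatrix k Q c.1), genMatrix_rel k Q c.1 c.2⟩)

/-- The string module `M(w)`. -/
noncomputable def stringModule (k : Type u) [Field k] [Fintype V] (Q : BoundQuiver V E)
    (c : Q.StringWord) : ModuleCat.{u} (Q.Alg k) :=
  letI : Module (Q.Alg k) (StringSpace k c.1) :=
    Module.compHom (StringSpace k c.1) (stringAction k Q c).toRingHom
  ModuleCat.of (Q.Alg k) (StringSpace k c.1)

end BoundQuiver

/-! ### Subcategories of module categories -/

/- A full subcategory, closed under isomorphism, of the category `mod Λ` of finitely generated left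
modules is a property of objects of `ModuleCat Λ` all of whose members are finitely generated. -/

namespace Shadow

variable {Λ : Type w} [Ring Λ]

/-- Torsion classes in `mod Λ`. -/
structure IsTorsionClass (T : ObjectProperty (ModuleCat.{u} Λ)) : Prop where
  finite : ∀ X, T X → Module.Finite Λ X
  zero : T.ContainsZero
  quotients : T.IsClosedUnderQuotients
  extensions : T.IsClosedUnderExtensions

/-- Wide subcategories of `mod Λ`: exact abelian subcategories closed under extensions. -/
structure IsWide (T : ObjectProperty (ModuleCat.{u} Λ)) : Prop where
  finite : ∀ X, T X → Module.Finite Λ X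
  zero : T.ContainsZero
  kernels : T.IsClosedUnderKernels
  cokernels : T.IsClosedUnderCokernels
  extensions : T.IsClosedUnderExtensions

/-- `add P`: the direct summands of finite direct sums of objects in `P`. -/
def add (P : ObjectProperty (ModuleCat.{u} Λ)) : ObjectProperty (ModuleCat.{u} Λ) := fun X =>
  ∃ (n : ℕ) (F : Fin n → ModuleCat.{u} Λ) (Y : ModuleCat.{u} Λ),
    (∀ i, P (F i)) ∧ Nonempty (X ⊞ Y ≅ ⨁ F)

/-- The smallest torsion class containing `P` (for `P` consisting of finitely generated modules). -/
def torsionClosure (P : ObjectProperty (ModuleCat.{u} Λ)) : ObjectProperty (ModuleCat.{u} Λ) :=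
  fun X => ∀ T : ObjectProperty (ModuleCat.{u} Λ), IsTorsionClass T → P ≤ T → T X

/-- The `M`-torsion shadows. -/
def torshad (M : ObjectProperty (ModuleCat.{u} Λ)) : Set (ObjectProperty (ModuleCat.{u} Λ)) :=
  {S | ∃ T : ObjectProperty (ModuleCat.{u} Λ), IsTorsionClass T ∧ S = T ⊓ M}

/-- The `M`-wide shadows. -/
def widshad (M : ObjectProperty (ModuleCat.{u} Λ)) : Set (ObjectProperty (ModuleCat.{u} Λ)) :=
  {S | ∃ T : ObjectProperty (ModuleCat.{u} Λ), IsWide T ∧ S = T ⊓ M}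

end Shadow

/-! ### The subcategory `M` of `mod Π(A)` and the maps between the posets -/

namespace BoundQuiver

variable {V : Type v} {E : Type w}

/-- Specialization of words in the doubled quiver: `γ*` is replaced by `γ⁻¹`, and `(γ*)⁻¹` by
`γ`. -/
def specialize (c : QWord V (E ⊕ E)) : QWord V E :=
  ⟨c.start, c.letters.map fun l =>
    (Sum.elim (fun a => (a, l.2)) (fun a => (a, !l.2)) l.1 : E × Bool)⟩

/-- The subcategory `M` of `mod Π(A)`: the additive closure of the string modules of those strings
of `Π(A)` that specialize to strings of `A`. -/
def shadowCat (k : Type u) [Field k] [Fintype V] (Q : BoundQuiver V E) :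
    ObjectProperty (ModuleCat.{u} (Q.double.Alg k)) :=
  Shadow.add fun X => ∃ c : Q.double.StringWord, Q.IsString (specialize c.1) ∧
    X = stringModule k Q.double c

open Classical in
/-- The word `str(w_D)` in the doubled quiver: every letter `γ^{±1}` of `w` is lifted to the
letter over it that is direct if the part of `w` preceding it lies in `D`, and inverse otherwise
(when `(w, D)` is a label, the part of `w` following the letter then lies in `D`). -/
noncomputable def liftWord {Q : BoundQuiver V E} (c : Q.StringWord) (D : Set Q.Str) :
    QWord V (E ⊕ E) :=
  ⟨c.1.start, c.1.letters.mapIdx fun i l =>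
    let ε : Bool := decide (∃ p : Q.StringWord, p.1 = ⟨c.1.start, c.1.letters.take i⟩ ∧ p.toStr ∈ D)
    (if ε = l.2 then Sum.inl l.1 else Sum.inr l.1, ε)⟩

/-- `IsStr p d`: the word `d` of the doubled quiver represents `str(w_D)`, where `p = (w, D)`. -/
def IsStr {Q : BoundQuiver V E} (p : Q.Label) (d : Q.double.StringWord) : Prop :=
  ∃ c : Q.StringWord, c.toStr = p.1.1 ∧ d.1 = liftWord c p.1.2

/-- The string modules `M(str(w_D))` for the labels `w_D` in a set `P`. -/
def labelModules (k : Type u) [Field k] [Fintype V] (Q : BoundQuiver V E) (P : Set Q.Label) :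
    ObjectProperty (ModuleCat.{u} (Q.double.Alg k)) := fun X =>
  ∃ p ∈ P, ∃ d : Q.double.StringWord, IsStr p d ∧ X = stringModule k Q.double d

/-- The set `B(T)` of the strings `w` of `A` such that `M(str(w_D))` lies in `T` for some label
`w_D`. -/
def stringsOf (k : Type u) [Field k] [Fintype V] (Q : BoundQuiver V E)
    (T : ObjectProperty (ModuleCat.{u} (Q.double.Alg k))) : Set Q.Str :=
  {x | ∃ (p : Q.Label) (d : Q.double.StringWord), p.1.1 = x ∧ IsStr p d ∧
    T (stringModule k Q.double d)}

/-- The torsion shadow attached to a biclosed set `B`: the intersection with `M` of the smallest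
torsion class containing the modules `M(str(w_D))`, for `w_D` a label of an edge going down
from `B`. -/
def shadowOf (k : Type u) [Field k] [Fintype V] (Q : BoundQuiver V E) (B : Q.Bic) :
    ObjectProperty (ModuleCat.{u} (Q.double.Alg k)) :=
  Shadow.torsionClosure (labelModules k Q (labelsDown B)) ⊓ shadowCat k Q

end BoundQuiver

/-!
The proof reduces everything to the combinatorics of words in the doubled quiver.

Since `A` is a brick algebra, no string of `A` visits a vertex twice (`IsBrickAlgebra.thin`):
from a shortest string with repeated vertices one builds an indecomposable string module with an
endomorphism that is neither zero nor injective. No other consequence of the hypotheses on `A` is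
needed. The words in the doubled quiver that specialize to strings of `A` are called lifts; their
modules have only scalar endomorphisms. A substring `[i, j]` of a lift `d` can be *on top of* `d`
(`IsBd true`, giving a quotient module of `M(d)`) or *at the bottom of* `d` (`IsBd false`, giving a
submodule), and a nonzero map `M(d) → M(e)` forces a common substring that is on top of `d` and at
the bottom of `e`, up to inversion of `e` (`exists_common_of_ne_zero`).

A biclosed set `B` and a lift `d` can be compared in two ways: all tops of `d` may lie in `B`, or
all bottoms of `d` may lie outside of `B`. Every string in `B` has a lift of the first kind, every
other string has a lift of the second kind (`Lift.exists_good`), there are no nonzero maps from the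
first kind to the second kind, and two lifts of the same string always have a common substring on
top of the first and at the bottom of the second (`Lift.exists_common`). It follows that a torsion
class `T` contains `M(d)` if and only if all tops of `d` lie in `B(T)` (`mem_torsion_iff`), and
that every biclosed set is `B(T)` for the torsion class `T = torOf B`. As objects of the category
`M` are direct sums of string modules (Krull-Schmidt, `dir_of_add`), torsion shadows and biclosed
sets correspond to each other.

If `C ⊂ B` are biclosed, then some string of `B` outside of `C` can be removed from `B`
(`exists_isRem`), so the edges down from `B` are given by removable strings. The modules of their
labels form a semibrick (`isSemibrick_downModules`), hence the modules filtered by them form a wide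
subcategory by Ringel's theorem (`isWide_filt`). If `m` is the meet of the lower covers of `B`, the
labels in `ψ(B)` are exactly the lifts whose tops lie in `B` and whose bottoms lie outside of `m`
(`exists_mem_shardSet_iff`), and these are exactly the lifts filtered by the semibrick
(`filt_iff_isMid`). So `ϑ(ψ(B))` is a wide shadow. Conversely, for a wide subcategory `W`, let `B`
be the set of strings of the torsion class generated by the string modules in `W`. The labels of
the edges down from `B` lie in `W` (`IsWide.mem_of_isDown`), and every string module in `W` is
filtered by them (`IsWide.filt`). Finally, `B` is recovered from `ψ(B)` as the set of strings of
the generated torsion class, and `ψ(B)` is recovered from its additive closure, since isomorphic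
string modules have the same label.
-/

namespace BoundQuiver

variable {V : Type v} {E : Type w}

/-! ### Subwords and inverse words -/

@[simp]
theorem flip_flip (l : E × Bool) : flip (flip l) = l := by simp [flip]

theorem ltgt_flip (Q : BoundQuiver V E) (l : E × Bool) : Q.ltgt (flip l) = Q.lsrc l := by
  rcases l with ⟨a, _ | _⟩ <;> simp [ltgt, lsrc, flip]

theorem lsrc_flip (Q : BoundQuiver V E) (l : E × Bool) : Q.lsrc (flip l) = Q.ltgt l := by
  rcases l with ⟨a, _ | _⟩ <;> simp [ltgt, lsrc, flip]

theorem Step.flip {Q : BoundQuiver V E} {l m : E × Bool} (h : Q.Step l m) :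
    Q.Step (flip m) (flip l) := by
  obtain ⟨h1, h2, h3, h4⟩ := h
  refine ⟨by rw [lsrc_flip, ltgt_flip, h1], ?_, ?_, ?_⟩
  · intro h; rw [flip_flip] at h; exact h2 h.symm
  · intro ha hb; exact h4 (by simpa [BoundQuiver.flip] using hb) (by simpa [BoundQuiver.flip] using ha)
  · intro ha hb; exact h3 (by simpa [BoundQuiver.flip] using hb) (by simpa [BoundQuiver.flip] using ha)

theorem vertex_zero (Q : BoundQuiver V E) (c : QWord V E) : Q.vertex c 0 = c.start := rfl

theorem word_ext {c d : QWord V E} (h : c.start = d.start)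
    (h' : ∀ t : ℕ, c.letters[t]? = d.letters[t]?) : c = d :=
  QWord.ext h (List.ext_getElem? h')

/-- A word with given letters is a string if it is a walk with admissible consecutive letters;
the index version of `IsString`. -/
theorem isString_iff (Q : BoundQuiver V E) (c : QWord V E) :
    Q.IsString c ↔ (∀ l, c.letters[0]? = some l → Q.lsrc l = c.start) ∧
      ∀ t l m, c.letters[t]? = some l → c.letters[t + 1]? = some m → Q.Step l m := by
  constructor
  · intro h
    refine ⟨fun l hl => h.1 l (by simpa [List.head?_eq_getElem?] using hl), fun t l m hl hm => ?_⟩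
    exact step_of_letters Q c h t l m hl hm
  · rintro ⟨h1, h2⟩
    refine ⟨fun l hl => h1 l (by simpa [List.head?_eq_getElem?] using hl), ?_⟩
    rw [List.isChain_iff_getElem]
    intro i hi
    exact h2 i _ _ (List.getElem?_eq_getElem (by omega)) (List.getElem?_eq_getElem hi)

/-- The part of a word between its `i`-th and its `j`-th vertex. -/
def seg (Q : BoundQuiver V E) (c : QWord V E) (i j : ℕ) : QWord V E :=
  ⟨Q.vertex c i, (c.letters.take j).drop i⟩

theorem seg_getElem? (Q : BoundQuiver V E) (c : QWord V E) (i j t : ℕ) :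
    (Q.seg c i j).letters[t]? = if i + t < j then c.letters[i + t]? else none := by
  simp [seg, List.getElem?_take]

theorem seg_length (Q : BoundQuiver V E) (c : QWord V E) (i j : ℕ) (hj : j ≤ c.letters.length) :
    (Q.seg c i j).letters.length = j - i := by
  simp [seg, hj]

theorem vertex_seg (Q : BoundQuiver V E) (c : QWord V E) (i j t : ℕ) (h : i + t ≤ j)
    (hj : j ≤ c.letters.length) : Q.vertex (Q.seg c i j) t = Q.vertex c (i + t) := by
  cases t with
  | zero => rfl
  | succ t =>
    have h1 : c.letters[i + t]? = some c.letters[i + t] := List.getElem?_eq_getElem (by omega)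
    rw [vertex_succ Q (Q.seg c i j) t (c.letters[i + t]) (by
      rw [seg_getElem?, if_pos (by omega), h1])]
    rw [← add_assoc, vertex_succ Q c (i + t) _ h1]

theorem isString_seg (Q : BoundQuiver V E) {c : QWord V E} (hc : Q.IsString c) (i j : ℕ) :
    Q.IsString (Q.seg c i j) := by
  rw [isString_iff]
  constructor
  · intro l hl
    rw [seg_getElem?] at hl
    split_ifs at hl
    exact (vertex_of_letter Q c hc i l hl).symm
  · intro t l m hl hm
    rw [seg_getElem?] at hl hm
    split_ifs at hl hm
    exact step_of_letters Q c hc (i + t) l m hl hm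

theorem seg_seg (Q : BoundQuiver V E) (c : QWord V E) {i j a b : ℕ} (hab : a ≤ b)
    (hb : i + b ≤ j) (hj : j ≤ c.letters.length) :
    Q.seg (Q.seg c i j) a b = Q.seg c (i + a) (i + b) := by
  refine word_ext (vertex_seg Q c i j a (by omega) hj) fun t => ?_
  simp only [seg_getElem?]
  split_ifs <;> first | rfl | omega | (congr 1; omega)

theorem seg_whole (Q : BoundQuiver V E) (c : QWord V E) :
    Q.seg c 0 c.letters.length = c := by
  refine word_ext rfl fun t => ?_
  rw [seg_getElem?]
  split_ifs with h
  · simp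
  · exact (List.getElem?_eq_none (by omega)).symm

theorem inv_length (Q : BoundQuiver V E) (c : QWord V E) :
    (Q.inv c).letters.length = c.letters.length := by simp [inv]

theorem inv_getElem? (Q : BoundQuiver V E) (c : QWord V E) (t : ℕ) (ht : t < c.letters.length) :
    (Q.inv c).letters[t]? = c.letters[c.letters.length - 1 - t]?.map flip := by
  rw [inv, List.getElem?_reverse (by simpa using ht), List.getElem?_map, List.length_map]

theorem vertex_inv (Q : BoundQuiver V E) {c : QWord V E} (hc : Q.IsString c) (t : ℕ)
    (ht : t ≤ c.letters.length) :
    Q.vertex (Q.inv c) t = Q.vertex c (c.letters.length - t) := by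
  cases t with
  | zero => rfl
  | succ t =>
    have h1 : c.letters[c.letters.length - 1 - t]? = some c.letters[c.letters.length - 1 - t] :=
      List.getElem?_eq_getElem (by omega)
    rw [vertex_succ Q (Q.inv c) t (flip c.letters[c.letters.length - 1 - t]) (by
      rw [inv_getElem? Q c t (by omega), h1]; rfl), ltgt_flip,
      show c.letters.length - (t + 1) = c.letters.length - 1 - t by omega,
      vertex_of_letter Q c hc _ _ h1]

theorem isString_inv (Q : BoundQuiver V E) {c : QWord V E} (hc : Q.IsString c) :
    Q.IsString (Q.inv c) := by
  rw [isString_iff]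
  constructor
  · intro l hl
    have hlt : 0 < c.letters.length := by
      by_contra h
      rw [List.getElem?_eq_none (by rw [inv_length]; omega)] at hl
      simp at hl
    have h1 : c.letters[c.letters.length - 1]? = some c.letters[c.letters.length - 1] :=
      List.getElem?_eq_getElem (by omega)
    rw [inv_getElem? Q c 0 hlt, Nat.sub_zero, h1] at hl
    obtain rfl : flip _ = l := by simpa using hl
    rw [lsrc_flip, ← vertex_succ Q c _ _ h1, Nat.sub_add_cancel hlt]
    rfl
  · intro t l m hl hm
    have hlt : t + 1 < c.letters.length := by
      by_contra h
      rw [List.getElem?_eq_none (by rw [inv_length]; omega)] at hm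
      simp at hm
    rw [inv_getElem? Q c _ (by omega)] at hl hm
    obtain ⟨l', hl', rfl⟩ := Option.map_eq_some_iff.1 hl
    obtain ⟨m', hm', rfl⟩ := Option.map_eq_some_iff.1 hm
    refine (step_of_letters Q c hc _ m' l' hm' ?_).flip
    rw [← hl']
    congr 1
    omega

theorem seg_inv (Q : BoundQuiver V E) {c : QWord V E} (hc : Q.IsString c) {i j : ℕ} (hij : i ≤ j)
    (hj : j ≤ c.letters.length) :
    Q.seg (Q.inv c) i j = Q.inv (Q.seg c (c.letters.length - j) (c.letters.length - i)) := by
  have hlen := seg_length Q c (c.letters.length - j) (c.letters.length - i) (by omega)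
  refine word_ext ?_ fun t => ?_
  · change Q.vertex (Q.inv c) i = Q.vertex _ _
    rw [vertex_inv Q hc i (by omega), hlen, vertex_seg Q c _ _ _ (by omega) (by omega)]
    congr 1
    omega
  · rw [seg_getElem?]
    split_ifs with h
    · rw [inv_getElem? Q c _ (by omega), inv_getElem? Q _ t (by omega), seg_getElem?,
        if_pos (by omega)]
      congr 2
      omega
    · rw [List.getElem?_eq_none]
      rw [inv_length, hlen]; omega

/-! ### Strings up to inversion and their concatenations -/

namespace StringWord

variable {Q : BoundQuiver V E}

/-- Number of letters. -/
abbrev len (c : Q.StringWord) : ℕ := c.1.letters.length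

/-- The part of a string word between two of its vertices. -/
def seg (c : Q.StringWord) (i j : ℕ) : Q.StringWord := ⟨Q.seg c.1 i j, isString_seg Q c.2 i j⟩

/-- The inverse string word. -/
def inv (c : Q.StringWord) : Q.StringWord := ⟨Q.inv c.1, isString_inv Q c.2⟩

theorem toStr_eq_iff (c d : Q.StringWord) : c.toStr = d.toStr ↔ c = d ∨ c = d.inv := by
  refine (Quotient.eq (r := Q.strSetoid)).trans ?_
  exact ⟨Or.imp (fun h => Subtype.ext h) (fun h => Subtype.ext h),
    Or.imp (congrArg Subtype.val) (congrArg Subtype.val)⟩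

theorem inv_inv (c : Q.StringWord) : c.inv.inv = c := Subtype.ext (BoundQuiver.inv_inv Q _ c.2)

theorem toStr_inv (c : Q.StringWord) : c.inv.toStr = c.toStr :=
  (toStr_eq_iff _ _).2 (Or.inr rfl)

theorem len_inv (c : Q.StringWord) : c.inv.len = c.len := inv_length Q c.1

theorem len_seg (c : Q.StringWord) (i j : ℕ) (hj : j ≤ c.len) : (c.seg i j).len = j - i :=
  seg_length Q c.1 i j hj

theorem seg_seg (c : Q.StringWord) {i j a b : ℕ} (hab : a ≤ b) (hb : i + b ≤ j)
    (hj : j ≤ c.len) : (c.seg i j).seg a b = c.seg (i + a) (i + b) :=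
  Subtype.ext (BoundQuiver.seg_seg Q c.1 hab hb hj)

theorem seg_whole (c : Q.StringWord) : c.seg 0 c.len = c :=
  Subtype.ext (BoundQuiver.seg_whole Q c.1)

theorem seg_inv (c : Q.StringWord) {i j : ℕ} (hij : i ≤ j) (hj : j ≤ c.len) :
    c.inv.seg i j = (c.seg (c.len - j) (c.len - i)).inv :=
  Subtype.ext (BoundQuiver.seg_inv Q c.2 hij hj)

theorem len_eq_of_toStr_eq {c d : Q.StringWord} (h : c.toStr = d.toStr) : c.len = d.len := by
  rcases (toStr_eq_iff c d).1 h with rfl | rfl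
  · rfl
  · exact len_inv d

theorem exists_toStr (x : Q.Str) : ∃ c : Q.StringWord, c.toStr = x :=
  Quotient.exists_rep x

theorem isConcat_seg (c : Q.StringWord) {i j k : ℕ} (hij : i ≤ j) (hjk : j < k)
    (hk : k ≤ c.len) :
    IsConcat (c.seg i j).toStr (c.seg (j + 1) k).toStr (c.seg i k).toStr := by
  have hj : j < c.1.letters.length := lt_of_lt_of_le hjk hk
  have h1 : c.1.letters[j]? = some c.1.letters[j] := List.getElem?_eq_getElem hj
  refine ⟨c.seg i j, c.seg (j + 1) k, c.seg i k, c.1.letters[j], rfl, rfl, rfl,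
    vertex_succ Q c.1 j _ h1, word_ext rfl fun t => ?_⟩
  have hl : (c.seg i j).1.letters.length = j - i := len_seg c i j (by omega)
  rw [List.getElem?_append, hl]
  change (Q.seg c.1 i k).letters[t]? = if t < j - i then (Q.seg c.1 i j).letters[t]? else _
  split_ifs with h
  · rw [seg_getElem?, seg_getElem?, if_pos (by omega), if_pos (by omega)]
  · rw [List.getElem?_cons, seg_getElem?]
    split_ifs with h2 h3 h4
    · rw [← h1]; congr 1; omega
    · change _ = (Q.seg c.1 (j + 1) k).letters[_]?
      rw [seg_getElem?, if_pos (by omega)]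
      congr 1; omega
    · omega
    · change _ = (Q.seg c.1 (j + 1) k).letters[_]?
      rw [seg_getElem?, if_neg (by omega)]

theorem isConcat_seg' (c : Q.StringWord) {i j k : ℕ} (hij : i ≤ j) (hjk : j < k)
    (hk : k ≤ c.len) :
    IsConcat (c.seg (j + 1) k).toStr (c.seg i j).toStr (c.seg i k).toStr := by
  have key := isConcat_seg c.inv (i := c.len - k) (j := c.len - (j + 1)) (k := c.len - i)
    (by omega) (by omega) (by rw [len_inv]; omega)
  rwa [seg_inv c (by omega) (by omega), seg_inv c (by omega) (by omega),
    seg_inv c (by omega) (by omega), toStr_inv, toStr_inv, toStr_inv,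
    Nat.sub_sub_self (by omega), Nat.sub_sub_self (by omega), Nat.sub_sub_self (by omega),
    show c.len - (c.len - (j + 1) + 1) = j by omega] at key

end StringWord

/-- The breaks of the string represented by `c` are the pairs of parts of `c` before and after one
of its letters. -/
theorem isConcat_toStr_iff {Q : BoundQuiver V E} {u v : Q.Str} {c : Q.StringWord} :
    IsConcat u v c.toStr ↔ ∃ i < c.len,
      (u = (c.seg 0 i).toStr ∧ v = (c.seg (i + 1) c.len).toStr) ∨
      (v = (c.seg 0 i).toStr ∧ u = (c.seg (i + 1) c.len).toStr) := by
  constructor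
  · rintro ⟨c', d, e, l, rfl, rfl, h0, h1, h2⟩
    have he : e.1.letters = c'.1.letters ++ l :: d.1.letters := by rw [h2]
    have hen : e.1.letters.length = c'.1.letters.length + d.1.letters.length + 1 := by
      rw [he]; simp; omega
    have hl : e.1.letters[c'.1.letters.length]? = some l := by rw [he]; simp
    have hc : c' = e.seg 0 c'.len := by
      refine Subtype.ext (word_ext (by change _ = e.1.start; rw [h2]) fun t => ?_)
      change _ = (Q.seg e.1 0 c'.len).letters[t]?
      rw [seg_getElem?, he]
      split_ifs with h
      · rw [List.getElem?_append_left (by simpa using h), zero_add]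
      · exact List.getElem?_eq_none (by simpa using h)
    have hd : d = e.seg (c'.len + 1) e.len := by
      refine Subtype.ext (word_ext ?_ fun t => ?_)
      · exact h1.trans (vertex_succ Q e.1 _ _ hl).symm
      change _ = (Q.seg e.1 (c'.len + 1) e.len).letters[t]?
      rw [seg_getElem?]
      split_ifs with h
      · rw [he, List.getElem?_append_right (by simp [StringWord.len]; omega)]
        simp [StringWord.len, show c'.1.letters.length + 1 + t - c'.1.letters.length = t + 1 by omega]
      · exact List.getElem?_eq_none (by simp only [StringWord.len] at h; omega)
    have hlt : c'.len < e.len := by simp only [StringWord.len]; omega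
    rcases (StringWord.toStr_eq_iff e c).1 h0 with rfl | rfl
    · exact ⟨c'.len, hlt, Or.inl ⟨congrArg _ hc, congrArg _ hd⟩⟩
    · rw [StringWord.len_inv] at hlt hd
      refine ⟨c.len - (c'.len + 1), by omega, Or.inr ⟨?_, ?_⟩⟩
      · rw [hd, StringWord.seg_inv c (by omega) le_rfl, StringWord.toStr_inv, Nat.sub_self]
      · conv_lhs => rw [hc, StringWord.seg_inv c (by omega) (by omega), StringWord.toStr_inv]
        congr 2
        omega
  · rintro ⟨i, hi, ⟨rfl, rfl⟩ | ⟨rfl, rfl⟩⟩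
    · have := StringWord.isConcat_seg c (i := 0) (Nat.zero_le _) hi le_rfl
      rwa [StringWord.seg_whole] at this
    · have := StringWord.isConcat_seg' c (i := 0) (Nat.zero_le _) hi le_rfl
      rwa [StringWord.seg_whole] at this

theorem IsConcat.symm {Q : BoundQuiver V E} {u v w : Q.Str} (h : IsConcat u v w) :
    IsConcat v u w := by
  obtain ⟨c, rfl⟩ := StringWord.exists_toStr w
  rw [isConcat_toStr_iff] at h ⊢
  obtain ⟨i, hi, h⟩ := h
  exact ⟨i, hi, h.symm⟩

/-! ### String modules in coordinates -/

section StringModules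

variable (k : Type u) [Field k] [Fintype V] (Q : BoundQuiver V E)

/-- The generators of the algebra `kQ/I`: the idempotents `e_x` and the arrows. -/
noncomputable def gen (g : V ⊕ E) : Q.Alg k :=
  RingQuot.mkAlgHom k (AlgRel k Q) (FreeAlgebra.ι k g)

theorem alg_induction {C : Q.Alg k → Prop} (halg : ∀ r, C (algebraMap k _ r))
    (hgen : ∀ g, C (gen k Q g)) (hmul : ∀ a b, C a → C b → C (a * b))
    (hadd : ∀ a b, C a → C b → C (a + b)) (a : Q.Alg k) : C a := by
  obtain ⟨a, rfl⟩ := RingQuot.mkAlgHom_surjective k (AlgRel k Q) a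
  induction a using FreeAlgebra.induction with
  | grade0 r => rw [AlgHom.commutes]; exact halg r
  | grade1 g => exact hgen g
  | mul a b ha hb => rw [map_mul]; exact hmul _ _ ha hb
  | add a b ha hb => rw [map_add]; exact hadd _ _ ha hb

variable {Q}

/-- The string module as a vector space over `k`. -/
noncomputable instance (c : Q.StringWord) : Module k (stringModule k Q c) :=
  inferInstanceAs (Module k (StringSpace k c.1))

instance (c : Q.StringWord) : IsScalarTower k (Q.Alg k) (stringModule k Q c) where
  smul_assoc r a x := by
    change stringAction k Q c (r • a) x = r • stringAction k Q c a x
    rw [map_smul]; rfl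

instance (c : Q.StringWord) : Module.Finite k (stringModule k Q c) :=
  inferInstanceAs (Module.Finite k (Fin (c.1.letters.length + 1) → k))

instance (c : Q.StringWord) : Module.Finite (Q.Alg k) (stringModule k Q c) :=
  Module.Finite.of_restrictScalars_finite k _ _

instance (c : Q.StringWord) : IsNoetherian (Q.Alg k) (stringModule k Q c) :=
  isNoetherian_of_tower k inferInstance

variable {k}

/-- The coefficient of an element of a string module at the `t`-th basis vector, and `0` if there
is no such basis vector. -/
noncomputable def coord {c : Q.StringWord} (x : stringModule k Q c) (t : ℕ) : k :=
  if h : t < c.len + 1 then (show Fin (c.len + 1) → k from x) ⟨t, h⟩ else 0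

variable (k) in
/-- The element of a string module with given coefficients. -/
noncomputable def ofCoord (c : Q.StringWord) (f : ℕ → k) : stringModule k Q c :=
  show Fin (c.len + 1) → k from fun i => f i

theorem coord_ofCoord (c : Q.StringWord) (f : ℕ → k) (t : ℕ) :
    coord (ofCoord k c f) t = if t ≤ c.len then f t else 0 := by
  unfold coord ofCoord
  simp only [Nat.lt_succ_iff]
  split_ifs <;> rfl

theorem coord_of_lt {c : Q.StringWord} (x : stringModule k Q c) {t : ℕ} (h : c.len < t) :
    coord x t = 0 := dif_neg (by omega)

theorem coord_ext {c : Q.StringWord} {x y : stringModule k Q c}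
    (h : ∀ t ≤ c.len, coord x t = coord y t) : x = y := by
  refine funext (α := Fin (c.len + 1)) (β := fun _ => k) fun i => ?_
  have := h i.1 (by omega)
  unfold coord at this
  rwa [dif_pos i.2, dif_pos i.2] at this

theorem coord_add {c : Q.StringWord} (x y : stringModule k Q c) (t : ℕ) :
    coord (x + y) t = coord x t + coord y t := by
  unfold coord
  split_ifs
  · rfl
  · simp

theorem coord_zero {c : Q.StringWord} (t : ℕ) :
    coord (0 : stringModule k Q c) t = 0 := by
  unfold coord
  split_ifs <;> rfl

theorem coord_smul {c : Q.StringWord} (r : k) (x : stringModule k Q c) (t : ℕ) :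
    coord (r • x) t = r * coord x t := by
  unfold coord
  split_ifs
  · rfl
  · simp

theorem coord_sum {c : Q.StringWord} {ι : Type*} (s : Finset ι) (x : ι → stringModule k Q c)
    (t : ℕ) : coord (∑ i ∈ s, x i) t = ∑ i ∈ s, coord (x i) t := by
  classical
  induction s using Finset.induction_on with
  | empty => simp [coord_zero]
  | insert a s ha ih => rw [Finset.sum_insert ha, Finset.sum_insert ha, coord_add, ih]

theorem stringAction_gen (c : Q.StringWord) (g : V ⊕ E) :
    stringAction k Q c (gen k Q g) = Matrix.toLin' (genMatrix k Q c.1 g) := by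
  have h : RingQuot.liftAlgHom k
      ⟨FreeAlgebra.lift k (genMatrix k Q c.1), genMatrix_rel k Q c.1 c.2⟩ (gen k Q g) =
      genMatrix k Q c.1 g := by
    rw [gen, RingQuot.liftAlgHom_mkAlgHom_apply]
    exact FreeAlgebra.lift_ι_apply _ _
  exact congrArg (fun M => Matrix.toLin' M) h

theorem coord_gen {c : Q.StringWord} (g : V ⊕ E) (x : stringModule k Q c) {t : ℕ}
    (ht : t < c.len + 1) : coord (gen k Q g • x) t =
      ∑ i : Fin (c.len + 1), genMatrix k Q c.1 g ⟨t, ht⟩ i * coord x i := by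
  have h1 : coord (gen k Q g • x) t =
      (show Fin (c.len + 1) → k from stringAction k Q c (gen k Q g) x) ⟨t, ht⟩ := dif_pos ht
  have h2 : ∀ i : Fin (c.len + 1), coord x i = (show Fin (c.len + 1) → k from x) i :=
    fun i => dif_pos i.2
  rw [h1, stringAction_gen]
  simp only [h2]
  rfl

open Classical in
theorem coord_gen_inl {c : Q.StringWord} (z : V) (x : stringModule k Q c) (t : ℕ) :
    coord (gen k Q (Sum.inl z) • x) t = if Q.vertex c.1 t = z then coord x t else 0 := by
  by_cases ht : t < c.len + 1
  · rw [coord_gen _ _ ht, Finset.sum_eq_single ⟨t, ht⟩]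
    · simp [genMatrix]
    · intro i _ hi
      simp [genMatrix, Matrix.diagonal_apply_ne _ hi.symm]
    · simp
  · rw [coord_of_lt _ (by omega), coord_of_lt _ (by omega), ite_self]

open Classical in
theorem coord_gen_inr {c : Q.StringWord} (a : E) (x : stringModule k Q c) (t : ℕ) :
    coord (gen k Q (Sum.inr a) • x) t =
      (if 0 < t ∧ c.1.letters[t - 1]? = some (a, true) then coord x (t - 1) else 0) +
      (if c.1.letters[t]? = some (a, false) then coord x (t + 1) else 0) := by
  by_cases ht : t < c.len + 1
  · have key : ∀ i : Fin (c.len + 1),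
        genMatrix k Q c.1 (Sum.inr a) ⟨t, ht⟩ i * coord x i =
        (if t = i.1 + 1 ∧ c.1.letters[i.1]? = some (a, true) then coord x i else 0) +
        (if i.1 = t + 1 ∧ c.1.letters[t]? = some (a, false) then coord x i else 0) := by
      intro i
      simp only [genMatrix, Matrix.of_apply]
      by_cases h1 : t = i.1 + 1 ∧ c.1.letters[i.1]? = some (a, true)
      · have h2 : ¬ (i.1 = t + 1 ∧ c.1.letters[t]? = some (a, false)) := by omega
        rw [if_pos (Or.inl h1), if_pos h1, if_neg h2, one_mul, add_zero]
      · by_cases h2 : i.1 = t + 1 ∧ c.1.letters[t]? = some (a, false)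
        · rw [if_pos (Or.inr h2), if_neg h1, if_pos h2, one_mul, zero_add]
        · rw [if_neg (by tauto), if_neg h1, if_neg h2, zero_mul, add_zero]
    rw [coord_gen _ _ ht, Finset.sum_congr rfl fun i _ => key i, Finset.sum_add_distrib]
    congr 1
    · by_cases h0 : 0 < t ∧ c.1.letters[t - 1]? = some (a, true)
      · rw [if_pos h0, Finset.sum_eq_single ⟨t - 1, by omega⟩]
        · rw [if_pos ⟨by simp only; omega, h0.2⟩]
        · intro i _ hi
          rw [if_neg]
          rintro ⟨h, _⟩
          exact hi (Fin.ext (by simp only; omega))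
        · simp
      · rw [if_neg h0]
        refine Finset.sum_eq_zero fun i _ => if_neg ?_
        rintro ⟨h, h'⟩
        exact h0 ⟨by omega, by rwa [show t - 1 = i.1 by omega]⟩
    · by_cases h0 : c.1.letters[t]? = some (a, false)
      · have : t < c.1.letters.length := (List.getElem?_eq_some_iff.1 h0).1
        rw [if_pos h0, Finset.sum_eq_single ⟨t + 1, by simp only [StringWord.len]; omega⟩]
        · rw [if_pos ⟨rfl, h0⟩]
        · intro i _ hi
          rw [if_neg]
          rintro ⟨h, _⟩
          exact hi (Fin.ext h)
        · simp
      · rw [if_neg h0]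
        refine Finset.sum_eq_zero fun i _ => if_neg ?_
        tauto
  · have hlen : c.1.letters.length < t := by simp only [StringWord.len] at ht; omega
    have h1 : ¬ (0 < t ∧ c.1.letters[t - 1]? = some (a, true)) := by
      rw [List.getElem?_eq_none (by omega)]; simp
    have h2 : ¬ c.1.letters[t]? = some (a, false) := by
      rw [List.getElem?_eq_none (by omega)]; simp
    rw [coord_of_lt _ hlen, if_neg h1, if_neg h2, add_zero]

/-- A linear map between string modules commuting with the generators of the algebra is a
homomorphism. -/
noncomputable def homOfGen (c d : Q.StringWord)
    (φ : stringModule k Q c →ₗ[k] stringModule k Q d)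
    (h : ∀ g x, φ (gen k Q g • x) = gen k Q g • φ x) :
    stringModule k Q c →ₗ[Q.Alg k] stringModule k Q d where
  toFun := φ
  map_add' := φ.map_add
  map_smul' a x := by
    revert x
    refine alg_induction k Q (C := fun a => ∀ x, φ (a • x) = a • φ x) ?_ h ?_ ?_ a
    · intro r x
      rw [algebraMap_smul, algebraMap_smul, map_smul]
    · intro a b ha hb x
      rw [mul_smul, mul_smul, ha, hb]
    · intro a b ha hb x
      rw [add_smul, add_smul, map_add, ha, hb]

/-- The basis vectors of a string module. -/
noncomputable def bvec (k : Type u) [Field k] (c : Q.StringWord) (t : ℕ) : stringModule k Q c :=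
  ofCoord k c fun s => if s = t then 1 else 0

theorem coord_bvec (c : Q.StringWord) (s t : ℕ) (ht : t ≤ c.len) :
    coord (bvec k c t) s = if s = t then 1 else 0 := by
  rw [bvec, coord_ofCoord]
  split_ifs <;> first | rfl | omega

theorem eq_sum_bvec {c : Q.StringWord} (x : stringModule k Q c) :
    x = ∑ t ∈ Finset.range (c.len + 1), coord x t • bvec k c t := by
  refine coord_ext fun t ht => ?_
  rw [coord_sum, Finset.sum_eq_single t]
  · rw [coord_smul, coord_bvec _ _ _ ht, if_pos rfl, mul_one]
  · intro s hs hst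
    rw [coord_smul, coord_bvec _ _ _ (by simpa [Nat.lt_succ_iff] using hs), if_neg hst.symm, mul_zero]
  · intro h; exact absurd (Finset.mem_range.2 (by omega)) h

end StringModules

/-! ### Factor and submodule substrings -/

section Boundaries

variable {Q : BoundQuiver V E}

/-- The part of `c` between its `i`-th and `j`-th vertices is delimited by letters whose arrows
point away from it (`b = true`, a factor substring) or towards it (`b = false`, a submodule
substring). -/
def IsBd (b : Bool) (c : Q.StringWord) (i j : ℕ) : Prop :=
  i ≤ j ∧ j ≤ c.len ∧ (∀ l, c.1.letters[j]? = some l → l.2 = b) ∧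
    ∀ t l, t + 1 = i → c.1.letters[t]? = some l → l.2 = !b

theorem isBd_whole (b : Bool) (c : Q.StringWord) : IsBd b c 0 c.len := by
  refine ⟨Nat.zero_le _, le_rfl, fun l hl => ?_, fun t l h => by omega⟩
  rw [List.getElem?_eq_none le_rfl] at hl
  simp at hl

/-- The part of a word before a letter. -/
theorem isBd_left {c : Q.StringWord} {t : ℕ} {l : E × Bool} (h : c.1.letters[t]? = some l) :
    IsBd l.2 c 0 t := by
  refine ⟨Nat.zero_le _, (List.getElem?_eq_some_iff.1 h).1.le, fun m hm => ?_,
    fun t l h => by omega⟩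
  rw [h] at hm
  simp_all

/-- The part of a word after a letter. -/
theorem isBd_right {c : Q.StringWord} {t : ℕ} {l : E × Bool} (h : c.1.letters[t]? = some l) :
    IsBd (!l.2) c (t + 1) c.len := by
  refine ⟨(List.getElem?_eq_some_iff.1 h).1, le_rfl, fun m hm => ?_, fun s m hs hm => ?_⟩
  · rw [List.getElem?_eq_none le_rfl] at hm
    simp at hm
  · obtain rfl : s = t := by omega
    rw [h] at hm
    simp_all

theorem seg_letters_getElem? (c : Q.StringWord) (i j t : ℕ) :
    (c.seg i j).1.letters[t]? = if i + t < j then c.1.letters[i + t]? else none :=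
  seg_getElem? Q c.1 i j t

theorem inv_letters_getElem? (c : Q.StringWord) (t : ℕ) (ht : t < c.len) :
    c.inv.1.letters[t]? = c.1.letters[c.len - 1 - t]?.map flip :=
  inv_getElem? Q c.1 t ht

theorem IsBd.trans {b : Bool} {c : Q.StringWord} {i j p q : ℕ} (h : IsBd b c i j)
    (h' : IsBd b (c.seg i j) p q) : IsBd b c (i + p) (i + q) := by
  obtain ⟨h1, h2, h3, h4⟩ := h
  obtain ⟨h1', h2', h3', h4'⟩ := h'
  rw [StringWord.len_seg c i j h2] at h2'
  refine ⟨by omega, by omega, fun l hl => ?_, fun t l ht hl => ?_⟩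
  · by_cases hq : i + q = j
    · exact h3 l (by rwa [hq] at hl)
    · exact h3' l (by rw [seg_letters_getElem?, if_pos (by omega)]; exact hl)
  · by_cases hp : p = 0
    · exact h4 t l (by omega) hl
    · obtain ⟨p, rfl⟩ := Nat.exists_eq_succ_of_ne_zero hp
      refine h4' p l rfl ?_
      rw [seg_letters_getElem?, if_pos (by omega)]
      rwa [show i + p = t by omega]

theorem IsBd.inv {b : Bool} {c : Q.StringWord} {i j : ℕ} (h : IsBd b c i j) :
    IsBd b c.inv (c.len - j) (c.len - i) := by
  obtain ⟨h1, h2, h3, h4⟩ := h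
  refine ⟨by omega, by rw [StringWord.len_inv]; omega, fun l hl => ?_, fun t l ht hl => ?_⟩
  · have hi : 0 < i := by
      by_contra hi
      rw [List.getElem?_eq_none (by
        change c.inv.len ≤ _; rw [StringWord.len_inv]; omega)] at hl
      simp at hl
    rw [inv_letters_getElem? _ _ (by omega)] at hl
    obtain ⟨m, hm, rfl⟩ := Option.map_eq_some_iff.1 hl
    have := h4 (i - 1) m (by omega) (by rw [← hm]; congr 1; omega)
    simp [flip, this]
  · rw [inv_letters_getElem? _ _ (by omega)] at hl
    obtain ⟨m, hm, rfl⟩ := Option.map_eq_some_iff.1 hl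
    have := h3 m (by rw [← hm]; congr 1; omega)
    simp [flip, this]

end Boundaries

/-! ### Maps between string modules -/

section Maps

variable {k : Type u} [Field k] [Fintype V] {Q : BoundQuiver V E}

open Classical in
/-- The linear map between string modules which permutes or kills the basis vectors as prescribed:
the coefficient of the image at `t` is that of the argument at `σ t`, or `0` unless `p t`. -/
noncomputable def shiftMap (c d : Q.StringWord) (p : ℕ → Prop) (σ : ℕ → ℕ) :
    stringModule k Q c →ₗ[k] stringModule k Q d where
  toFun x := ofCoord k d fun t => if p t then coord x (σ t) else 0
  map_add' x y := by
    refine coord_ext fun t ht => ?_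
    simp only [coord_add, coord_ofCoord, if_pos ht]
    split_ifs <;> simp
  map_smul' r x := by
    refine coord_ext fun t ht => ?_
    simp only [coord_smul, coord_ofCoord, if_pos ht, RingHom.id_apply]
    split_ifs <;> simp

open Classical in
theorem coord_shiftMap {c d : Q.StringWord} (p : ℕ → Prop) (σ : ℕ → ℕ)
    (x : stringModule k Q c) (t : ℕ) : coord (shiftMap c d p σ x) t =
      if t ≤ d.len then (if p t then coord x (σ t) else 0) else 0 := by
  rw [show shiftMap c d p σ x = ofCoord k d (fun t => if p t then coord x (σ t) else 0) from rfl,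
    coord_ofCoord]

/-- The projection of a string module onto the string module of a factor substring. -/
theorem exists_proj {c : Q.StringWord} {i j : ℕ} (h : IsBd true c i j) :
    ∃ f : stringModule k Q c →ₗ[Q.Alg k] stringModule k Q (c.seg i j),
      ∀ x t, coord (f x) t = if i + t ≤ j then coord x (i + t) else 0 := by
  classical
  obtain ⟨h1, h2, h3, h4⟩ := h
  have hlen := StringWord.len_seg c i j h2
  have hco : ∀ (x : stringModule k Q c) t,
      coord (shiftMap c (c.seg i j) (fun _ => True) (fun t => i + t) x) t =
        if i + t ≤ j then coord x (i + t) else 0 := by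
    intro x t
    rw [coord_shiftMap, if_pos trivial, hlen]
    split_ifs <;> first | rfl | omega
  refine ⟨homOfGen c (c.seg i j) (shiftMap c (c.seg i j) (fun _ => True) (fun t => i + t)) ?_,
    hco⟩
  intro g x
  refine coord_ext fun t ht => ?_
  rw [hlen] at ht
  rw [hco, if_pos (by omega)]
  rcases g with z | a
  · rw [coord_gen_inl, coord_gen_inl, hco]
    change _ = if Q.vertex (Q.seg c.1 i j) t = z then _ else _
    rw [vertex_seg Q c.1 i j t (by omega) h2, if_pos (show i + t ≤ j by omega)]
  · rw [coord_gen_inr, coord_gen_inr, hco, hco, seg_letters_getElem?, seg_letters_getElem?]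
    congr 1
    · rcases Nat.eq_zero_or_pos t with rfl | h0
      · rw [if_neg, if_neg (by omega)]
        rintro ⟨hi, hl⟩
        have := h4 _ _ (by omega) hl
        simp at this
      · rw [if_pos (show i + (t - 1) < j by omega), if_pos (show i + (t - 1) ≤ j by omega),
          show i + (t - 1) = i + t - 1 by omega]
        simp only [h0, true_and, show 0 < i + t by omega]
    · by_cases hj : i + t = j
      · rw [if_neg, if_neg]
        · rw [if_neg (by omega)]; simp
        · intro hl
          rw [hj] at hl
          simpa using h3 _ hl
      · rw [if_pos (show i + t < j by omega), if_pos (show i + (t + 1) ≤ j by omega), add_assoc]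

/-- The embedding of the string module of a submodule substring. -/
theorem exists_incl {c : Q.StringWord} {i j : ℕ} (h : IsBd false c i j) :
    ∃ f : stringModule k Q (c.seg i j) →ₗ[Q.Alg k] stringModule k Q c,
      ∀ x t, coord (f x) t = if i ≤ t ∧ t ≤ j then coord x (t - i) else 0 := by
  classical
  obtain ⟨h1, h2, h3, h4⟩ := h
  have hlen := StringWord.len_seg c i j h2
  have hco : ∀ (x : stringModule k Q (c.seg i j)) t,
      coord (shiftMap (c.seg i j) c (fun t => i ≤ t ∧ t ≤ j) (fun t => t - i) x) t =
        if i ≤ t ∧ t ≤ j then coord x (t - i) else 0 := by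
    intro x t
    rw [coord_shiftMap]
    split_ifs <;> first | rfl | omega
  refine ⟨homOfGen (c.seg i j) c (shiftMap (c.seg i j) c (fun t => i ≤ t ∧ t ≤ j)
    (fun t => t - i)) ?_, hco⟩
  intro g x
  refine coord_ext fun t ht => ?_
  rw [hco]
  rcases g with z | a
  · rw [coord_gen_inl, coord_gen_inl, hco]
    by_cases hp : i ≤ t ∧ t ≤ j
    · rw [if_pos hp, if_pos hp]
      change (if Q.vertex (Q.seg c.1 i j) (t - i) = z then _ else _) = _
      rw [vertex_seg Q c.1 i j (t - i) (by omega) h2, show i + (t - i) = t by omega]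
    · rw [if_neg hp, if_neg hp, ite_self]
  · rw [coord_gen_inr, coord_gen_inr, hco, hco, seg_letters_getElem?, seg_letters_getElem?]
    by_cases hp : i ≤ t ∧ t ≤ j
    · rw [if_pos hp]
      congr 1
      · by_cases h0 : i < t
        · rw [if_pos (show i + (t - i - 1) < j by omega), if_pos (show i ≤ t - 1 ∧ t - 1 ≤ j by omega),
            show i + (t - i - 1) = t - 1 by omega, show t - i - 1 = t - 1 - i by omega]
          simp only [show 0 < t - i by omega, show 0 < t by omega]
        · rw [if_neg (by omega)]
          split_ifs <;> first | rfl | omega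
      · by_cases hj : t = j
        · rw [if_neg (show ¬ (i + (t - i) < j) by omega), if_neg (show ¬ (i ≤ t + 1 ∧ t + 1 ≤ j) by omega)]
          simp
        · rw [if_pos (show i + (t - i) < j by omega), if_pos (show i ≤ t + 1 ∧ t + 1 ≤ j by omega),
            show i + (t - i) = t by omega, show t - i + 1 = t + 1 - i by omega]
    · rw [if_neg hp]
      symm
      convert add_zero (0 : k) using 2
      · split_ifs with h5 h6
        · have := h3 _ (by rw [← h5.2]; congr 1; omega)
          simp at this
        · rfl
        · rfl
      · split_ifs with h5 h6
        · have := h4 _ _ (by omega) h5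
          simp at this
        · rfl
        · rfl

/-- A string module is isomorphic to the string module of the inverse word. -/
theorem exists_inv (c : Q.StringWord) :
    ∃ f : stringModule k Q c →ₗ[Q.Alg k] stringModule k Q c.inv,
      ∀ x, ∀ t ≤ c.len, coord (f x) t = coord x (c.len - t) := by
  classical
  have hco : ∀ (x : stringModule k Q c) t,
      coord (shiftMap c c.inv (fun _ => True) (fun t => c.len - t) x) t =
        if t ≤ c.len then coord x (c.len - t) else 0 := by
    intro x t
    rw [coord_shiftMap, if_pos trivial, StringWord.len_inv]
  refine ⟨homOfGen c c.inv (shiftMap c c.inv (fun _ => True) (fun t => c.len - t)) ?_,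
    fun x t ht => (hco x t).trans (if_pos ht)⟩
  intro g x
  refine coord_ext fun t ht => ?_
  rw [StringWord.len_inv] at ht
  rw [hco, if_pos ht]
  rcases g with z | a
  · rw [coord_gen_inl, coord_gen_inl, hco, if_pos ht]
    change _ = if Q.vertex (Q.inv c.1) t = z then _ else _
    rw [vertex_inv Q c.2 t ht]
  · rw [coord_gen_inr, coord_gen_inr, hco, hco, add_comm]
    congr 1
    · rcases Nat.eq_zero_or_pos t with rfl | h0
      · rw [if_neg, if_neg (by omega)]
        rw [List.getElem?_eq_none (by simp [StringWord.len])]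
        simp
      · rw [inv_letters_getElem? c _ (by omega), if_pos (show t - 1 ≤ c.len by omega),
          show c.len - 1 - (t - 1) = c.len - t by omega,
          show c.len - t + 1 = c.len - (t - 1) by omega]
        refine if_congr ?_ rfl rfl
        rw [Option.map_eq_some_iff]
        constructor
        · intro h; exact ⟨h0, _, h, rfl⟩
        · rintro ⟨_, l, hl, h⟩
          rw [hl, ← flip_flip l, h]; rfl
    · by_cases h1 : t < c.len
      · rw [inv_letters_getElem? c _ h1, if_pos (show t + 1 ≤ c.len by omega),
          show c.len - t - 1 = c.len - 1 - t by omega,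
          show c.len - (t + 1) = c.len - 1 - t by omega]
        refine if_congr ?_ rfl rfl
        rw [Option.map_eq_some_iff]
        constructor
        · intro h; exact ⟨_, h.2, rfl⟩
        · rintro ⟨l, hl, h⟩
          refine ⟨by omega, ?_⟩
          rw [hl, ← flip_flip l, h]; rfl
      · rw [if_neg (by omega), if_neg (show ¬ t + 1 ≤ c.len by omega), ite_self]

/-- The exact sequence of string modules attached to a letter of a word. -/
theorem exists_exact {c : Q.StringWord} {i j p q t : ℕ} (hsub : IsBd false c i j)
    (hfac : IsBd true c p q) (ht : t < c.len)
    (h : (p = 0 ∧ q = t ∧ i = t + 1 ∧ j = c.len) ∨ (i = 0 ∧ j = t ∧ p = t + 1 ∧ q = c.len)) :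
    ∃ (f : stringModule k Q (c.seg i j) →ₗ[Q.Alg k] stringModule k Q c)
      (g : stringModule k Q c →ₗ[Q.Alg k] stringModule k Q (c.seg p q)),
      Function.Injective f ∧ Function.Surjective g ∧ Function.Exact f g ∧
      (∀ x t, coord (f x) t = if i ≤ t ∧ t ≤ j then coord x (t - i) else 0) ∧
      ∀ x t, coord (g x) t = if p + t ≤ q then coord x (p + t) else 0 := by
  obtain ⟨f, hf⟩ := exists_incl (k := k) hsub
  obtain ⟨g, hg⟩ := exists_proj (k := k) hfac
  have hl1 := StringWord.len_seg c i j hsub.2.1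
  have hl2 := StringWord.len_seg c p q hfac.2.1
  refine ⟨f, g, ?_, ?_, ?_, hf, hg⟩
  · intro x y hxy
    refine coord_ext fun s hs => ?_
    have := congrArg (fun z => coord z (i + s)) hxy
    simp only [hf] at this
    rwa [if_pos (by omega), if_pos (by omega), show i + s - i = s by omega] at this
  · intro y
    refine ⟨ofCoord k c fun s => coord y (s - p), coord_ext fun s hs => ?_⟩
    rw [hg, if_pos (by omega), coord_ofCoord, if_pos (by omega), show p + s - p = s by omega]
  · intro x
    constructor
    · intro hx
      refine ⟨ofCoord k (c.seg i j) fun s => coord x (i + s), coord_ext fun s hs => ?_⟩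
      rw [hf, coord_ofCoord, hl1]
      split_ifs with h1 h2
      · congr 1; omega
      · omega
      · have := congrArg (fun z => coord z (s - p)) hx
        simp only [hg, coord_zero] at this
        rw [if_pos (by omega), show p + (s - p) = s by omega] at this
        exact this.symm
    · rintro ⟨y, rfl⟩
      refine coord_ext fun s hs => ?_
      rw [hg, hf, coord_zero]
      split_ifs <;> first | rfl | omega

end Maps

/-! ### Homomorphisms between string modules -/

section Hom

variable {Q : BoundQuiver V E}

/-- The letter `l` of the word `c` or of its inverse leads from the `p`-th to the `p'`-th vertex
of `c`. -/
def Out (c : Q.StringWord) (p : ℕ) (l : E × Bool) (p' : ℕ) : Prop :=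
  (p' = p + 1 ∧ c.1.letters[p]? = some l) ∨ (p = p' + 1 ∧ c.1.letters[p']? = some (flip l))

theorem Out.symm {c : Q.StringWord} {p p' : ℕ} {l : E × Bool} (h : Out c p l p') :
    Out c p' (flip l) p := by
  rcases h with h | h
  · exact Or.inr ⟨h.1, by rw [flip_flip]; exact h.2⟩
  · exact Or.inl h

theorem getElem?_succ_ne_flip (c : Q.StringWord) {t : ℕ} {l : E × Bool}
    (h : c.1.letters[t]? = some l) : c.1.letters[t + 1]? ≠ some (flip l) :=
  fun h' => (step_of_letters Q c.1 c.2 t _ _ h h').2.1 rfl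

theorem Out.unique {c : Q.StringWord} {p p' p'' : ℕ} {l : E × Bool} (h : Out c p l p')
    (h' : Out c p l p'') : p' = p'' := by
  rcases h with ⟨h1, h2⟩ | ⟨h1, h2⟩ <;> rcases h' with ⟨h3, h4⟩ | ⟨h3, h4⟩
  · omega
  · subst h3
    exact absurd (by rw [flip_flip]; exact h2) (getElem?_succ_ne_flip c h4)
  · subst h1
    exact absurd (by rw [flip_flip]; exact h4) (getElem?_succ_ne_flip c h2)
  · omega

theorem Out.le {c : Q.StringWord} {p p' : ℕ} {l : E × Bool} (h : Out c p l p') :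
    p ≤ c.len ∧ p' ≤ c.len := by
  rcases h with ⟨h1, h2⟩ | ⟨h1, h2⟩ <;>
  · have := (List.getElem?_eq_some_iff.1 h2).1
    simp only [StringWord.len]
    omega

variable {k : Type u} [Field k] [Fintype V]

theorem coord_gen_of_out {c : Q.StringWord} {a : E} {q q' : ℕ} (h : Out c q (a, false) q')
    (x : stringModule k Q c) : coord (gen k Q (Sum.inr a) • x) q = coord x q' := by
  rw [coord_gen_inr]
  rcases h with ⟨rfl, h⟩ | ⟨rfl, h⟩
  · rw [if_neg, if_pos h, zero_add]
    rintro ⟨h0, h1⟩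
    refine getElem?_succ_ne_flip c h1 ?_
    rwa [Nat.sub_add_cancel h0]
  · rw [if_pos ⟨by omega, h⟩, if_neg, add_zero, Nat.add_sub_cancel]
    exact getElem?_succ_ne_flip c h

theorem coord_gen_of_not_out {c : Q.StringWord} {a : E} {q : ℕ}
    (h : ∀ q', ¬ Out c q (a, false) q') (x : stringModule k Q c) :
    coord (gen k Q (Sum.inr a) • x) q = 0 := by
  rw [coord_gen_inr, if_neg, if_neg, add_zero]
  · exact fun h' => h (q + 1) (Or.inl ⟨rfl, h'⟩)
  · exact fun h' => h (q - 1) (Or.inr ⟨by omega, h'.2⟩)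

theorem gen_bvec_of_out {c : Q.StringWord} {a : E} {p p' : ℕ} (h : Out c p (a, true) p') :
    gen k Q (Sum.inr a) • bvec k c p = bvec k c p' := by
  refine coord_ext fun t ht => ?_
  rw [coord_bvec _ _ _ h.le.2]
  by_cases h1 : ∃ t', Out c t (a, false) t'
  · obtain ⟨t', h1⟩ := h1
    rw [coord_gen_of_out h1, coord_bvec _ _ _ h.le.1]
    refine if_congr ⟨?_, ?_⟩ rfl rfl
    · rintro rfl
      exact (h.unique h1.symm).symm
    · rintro rfl
      exact h1.unique h.symm
  · rw [coord_gen_of_not_out (fun t' h' => h1 ⟨t', h'⟩), if_neg]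
    rintro rfl
    exact h1 ⟨p, h.symm⟩

theorem gen_bvec_of_not_out {c : Q.StringWord} {a : E} {p : ℕ} (hp : p ≤ c.len)
    (h : ∀ p', ¬ Out c p (a, true) p') : gen k Q (Sum.inr a) • bvec k c p = 0 := by
  refine coord_ext fun t ht => ?_
  rw [coord_zero]
  by_cases h1 : ∃ t', Out c t (a, false) t'
  · obtain ⟨t', h1⟩ := h1
    rw [coord_gen_of_out h1, coord_bvec _ _ _ hp, if_neg]
    rintro rfl
    exact h t h1.symm
  · exact coord_gen_of_not_out (fun t' h' => h1 ⟨t', h'⟩) _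

/-- The entries of the matrix of a homomorphism between string modules. -/
noncomputable def entry {c d : Q.StringWord}
    (f : stringModule k Q c →ₗ[Q.Alg k] stringModule k Q d) (q p : ℕ) : k :=
  coord (f (bvec k c p)) q

variable {c d : Q.StringWord} (f : stringModule k Q c →ₗ[Q.Alg k] stringModule k Q d)

theorem bvec_of_lt {p : ℕ} (h : c.len < p) : bvec k c p = 0 := by
  refine coord_ext fun t ht => ?_
  rw [bvec, coord_ofCoord, coord_zero, if_pos ht, if_neg (by omega)]

theorem le_of_entry_ne {q p : ℕ} (h : entry f q p ≠ 0) : p ≤ c.len ∧ q ≤ d.len := by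
  constructor
  · by_contra hp
    rw [entry, bvec_of_lt (by omega), map_zero, coord_zero] at h
    exact h rfl
  · by_contra hq
    exact h (coord_of_lt _ (by omega))

theorem vertex_eq_of_entry_ne {q p : ℕ} (h : entry f q p ≠ 0) :
    Q.vertex c.1 p = Q.vertex d.1 q := by
  classical
  by_contra hne
  apply h
  have h1 : gen k Q (Sum.inl (Q.vertex c.1 p)) • bvec k c p = bvec k c p := by
    refine coord_ext fun t ht => ?_
    rw [coord_gen_inl, coord_bvec _ _ _ (le_of_entry_ne f h).1]
    split_ifs <;> simp_all
  rw [entry, ← h1, map_smul, coord_gen_inl, if_neg (fun h => hne h.symm)]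

theorem entry_eq_of_out {a : E} {p p' q q' : ℕ} (h : Out c p (a, true) p')
    (h' : Out d q (a, true) q') : entry f q' p' = entry f q p := by
  rw [entry, ← gen_bvec_of_out h, map_smul, coord_gen_of_out h'.symm, entry]

theorem entry_ne_of_out_left {a : E} {p p' q : ℕ} (h : Out c p (a, false) p')
    (h0 : entry f q p ≠ 0) : ∃ q', Out d q (a, false) q' ∧ entry f q' p' ≠ 0 := by
  by_contra hcon
  push Not at hcon
  apply h0
  rw [entry, ← gen_bvec_of_out h.symm, map_smul]
  by_cases hq : ∃ q', Out d q (a, false) q'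
  · obtain ⟨q', hq⟩ := hq
    rw [coord_gen_of_out hq]
    exact hcon q' hq
  · exact coord_gen_of_not_out (fun q' h' => hq ⟨q', h'⟩) _

theorem entry_ne_of_out_right {a : E} {p q q' : ℕ} (h : Out d q (a, true) q')
    (h0 : entry f q p ≠ 0) : ∃ p', Out c p (a, true) p' ∧ entry f q' p' ≠ 0 := by
  by_contra hcon
  push Not at hcon
  apply h0
  rw [entry, ← coord_gen_of_out h.symm, ← map_smul]
  by_cases hp : ∃ p', Out c p (a, true) p'
  · obtain ⟨p', hp⟩ := hp
    rw [gen_bvec_of_out hp]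
    exact hcon p' hp
  · rw [gen_bvec_of_not_out (le_of_entry_ne f h0).1 (fun p' h' => hp ⟨p', h'⟩), map_zero,
      coord_zero]

theorem exists_entry_ne (hf : f ≠ 0) : ∃ q p, entry f q p ≠ 0 := by
  by_contra hcon
  push Not at hcon
  apply hf
  have h1 : ∀ p, f (bvec k c p) = 0 := fun p => coord_ext fun t _ => by
    rw [coord_zero]; exact hcon t p
  ext x
  have h2 : f x = f.restrictScalars k x := rfl
  rw [h2, eq_sum_bvec x, map_sum]
  refine Finset.sum_eq_zero fun t _ => ?_
  rw [map_smul]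
  change _ • f (bvec k c t) = 0
  rw [h1, smul_zero]

/-- A common subword of `c` and `d` joining two nonzero entries of `f`. -/
def IsMatch (len p q : ℕ) : Prop :=
  p + len ≤ c.len ∧ q + len ≤ d.len ∧ (∀ t < len, c.1.letters[p + t]? = d.1.letters[q + t]?) ∧
    entry f q p ≠ 0 ∧ entry f (q + len) (p + len) ≠ 0

variable {f}

/-- A match of maximal length is a factor substring of the source and a submodule substring of
the target. The last hypothesis excludes that a match of length zero can be extended in the
opposite direction. -/
theorem IsMatch.isBd {len p q : ℕ} (h : IsMatch f len p q)
    (hmax : ∀ p q, ¬ IsMatch f (len + 1) p q)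
    (hrev : len = 0 → ∀ p q l, c.1.letters[p]? = some l → d.1.letters[q]? = some (flip l) →
      entry f (q + 1) p ≠ 0 → entry f q (p + 1) ≠ 0 → False) :
    IsBd true c p (p + len) ∧ IsBd false d q (q + len) ∧
      c.seg p (p + len) = d.seg q (q + len) := by
  obtain ⟨h1, h2, h3, h4, h5⟩ := h
  -- a match cannot be extended to the right or to the left
  have right : ∀ l, c.1.letters[p + len]? = some l → d.1.letters[q + len]? = some l →
      entry f (q + len + 1) (p + len + 1) ≠ 0 → False := by
    intro l hl hl' hne
    have hc := (List.getElem?_eq_some_iff.1 hl).1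
    have hd := (List.getElem?_eq_some_iff.1 hl').1
    refine hmax p q ⟨hc, hd, fun t ht => ?_, h4, hne⟩
    rcases Nat.lt_succ_iff_lt_or_eq.1 ht with ht | rfl
    · exact h3 t ht
    · rw [hl, hl']
  have left : ∀ p' q' l, p = p' + 1 → q = q' + 1 → c.1.letters[p']? = some l →
      d.1.letters[q']? = some l → entry f q' p' ≠ 0 → False := by
    rintro p' q' l rfl rfl hl hl' hne
    refine hmax p' q' ⟨by omega, by omega, fun t ht => ?_, hne, ?_⟩
    · rcases t with _ | t
      · rw [add_zero, add_zero, hl, hl']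
      · rw [show p' + (t + 1) = p' + 1 + t by omega, show q' + (t + 1) = q' + 1 + t by omega]
        exact h3 t (by omega)
    · rwa [show q' + (len + 1) = q' + 1 + len by omega,
        show p' + (len + 1) = p' + 1 + len by omega]
  -- the letters of `c` and `d` at the ends of a nonempty match
  have last : 0 < len → c.1.letters[p + len - 1]? = d.1.letters[q + len - 1]? := fun h0 => by
    rw [show p + len - 1 = p + (len - 1) by omega, show q + len - 1 = q + (len - 1) by omega]
    exact h3 _ (by omega)
  have first : 0 < len → c.1.letters[p]? = d.1.letters[q]? := h3 0
  refine ⟨⟨by omega, h1, ?_, ?_⟩, ⟨by omega, h2, ?_, ?_⟩, ?_⟩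
  · rintro ⟨a, b⟩ hl
    by_contra hb
    obtain rfl : b = false := by simpa using hb
    obtain ⟨q', hq', hne⟩ := entry_ne_of_out_left f (Or.inl ⟨rfl, hl⟩) h5
    rcases hq' with ⟨rfl, hd⟩ | ⟨hq, hd⟩
    · exact right _ hl hd hne
    · rcases Nat.eq_zero_or_pos len with h0 | h0
      · subst h0
        simp only [add_zero] at hl hq hne h4
        exact hrev rfl p q' _ hl hd (by rwa [← hq]) hne
      · have := last h0
        rw [show q + len - 1 = q' by omega, hd] at this
        refine getElem?_succ_ne_flip c this ?_
        rw [show p + len - 1 + 1 = p + len by omega, hl, flip_flip]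
  · rintro p' ⟨a, b⟩ hp hl
    by_contra hb
    obtain rfl : b = true := by simpa using hb
    obtain ⟨q', hq', hne⟩ := entry_ne_of_out_left f (a := a) (Or.inr ⟨hp.symm, hl⟩) h4
    rcases hq' with ⟨hq, hd⟩ | ⟨hq, hd⟩
    · rcases Nat.eq_zero_or_pos len with h0 | h0
      · subst hq
        exact hrev h0 p' q _ hl hd hne (by rwa [hp])
      · have := first h0
        rw [hd] at this
        exact getElem?_succ_ne_flip c hl (by rw [hp, this]; rfl)
    · exact left p' q' _ hp.symm hq hl hd hne
  · rintro ⟨a, b⟩ hl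
    by_contra hb
    obtain rfl : b = true := by simpa using hb
    obtain ⟨p', hp', hne⟩ := entry_ne_of_out_right f (Or.inl ⟨rfl, hl⟩) h5
    rcases hp' with ⟨rfl, hc⟩ | ⟨hp, hc⟩
    · exact right _ hc hl hne
    · rcases Nat.eq_zero_or_pos len with h0 | h0
      · subst h0
        simp only [add_zero] at hl hp hne h4
        exact hrev rfl p' q _ hc (by rw [flip_flip]; exact hl) hne (by rwa [← hp])
      · have := last h0
        rw [show p + len - 1 = p' by omega, hc] at this
        refine getElem?_succ_ne_flip d this.symm ?_
        rw [show q + len - 1 + 1 = q + len by omega, hl, flip_flip]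
  · rintro q' ⟨a, b⟩ hq hl
    by_contra hb
    obtain rfl : b = false := by simpa using hb
    obtain ⟨p', hp', hne⟩ := entry_ne_of_out_right f (a := a) (Or.inr ⟨hq.symm, hl⟩) h4
    rcases hp' with ⟨hp, hc⟩ | ⟨hp, hc⟩
    · rcases Nat.eq_zero_or_pos len with h0 | h0
      · subst hp
        exact hrev h0 p q' _ hc hl (by rwa [hq]) hne
      · have := first h0
        rw [hc] at this
        exact getElem?_succ_ne_flip d hl (by rw [hq, ← this]; rfl)
    · exact left p' q' _ hp hq.symm hc hl hne
  · refine Subtype.ext (word_ext (vertex_eq_of_entry_ne f h4) fun t => ?_)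
    rw [seg_letters_getElem?, seg_letters_getElem?]
    by_cases ht : t < len
    · rw [if_pos (by omega), if_pos (by omega), h3 t ht]
    · rw [if_neg (by omega), if_neg (by omega)]

/-- A nonzero homomorphism between string modules identifies a factor substring of the source with
a submodule substring of the target. -/
theorem exists_common_of_ne_zero (hf : f ≠ 0) : ∃ d', (d' = d ∨ d' = d.inv) ∧
    ∃ i j i' j', IsBd true c i j ∧ IsBd false d' i' j' ∧ c.seg i j = d'.seg i' j' := by
  classical
  obtain ⟨r, hr⟩ := exists_inv (k := k) d
  set g := r ∘ₗ f with hg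
  have hge : ∀ q p, q ≤ d.len → entry g q p = entry f (d.len - q) p := fun q p hq => hr _ q hq
  let P : ℕ → Prop := fun n => (∃ p q, IsMatch f n p q) ∨ ∃ p q, IsMatch g n p q
  have hP0 : P 0 := by
    obtain ⟨q, p, h⟩ := exists_entry_ne f hf
    have := le_of_entry_ne f h
    exact Or.inl ⟨p, q, this.1, this.2, fun t ht => by omega, h, h⟩
  have hbound : ∀ n, P n → n ≤ c.len := by
    rintro n (⟨p, q, h⟩ | ⟨p, q, h⟩) <;> have := h.1 <;> omega
  obtain ⟨n, hn, hmax⟩ : ∃ n, P n ∧ ¬ P (n + 1) := by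
    by_contra hcon
    push Not at hcon
    have : ∀ n, P n := fun n => Nat.rec hP0 (fun n ih => hcon n ih) n
    have := hbound _ (this (c.len + 1))
    omega
  rcases hn with ⟨p, q, h⟩ | ⟨p, q, h⟩
  · refine ⟨d, Or.inl rfl, p, p + n, q, q + n, h.isBd (fun p q h => hmax (Or.inl ⟨p, q, h⟩)) ?_⟩
    rintro rfl p q l hc hd h1 h2
    have hlc := (List.getElem?_eq_some_iff.1 hc).1
    have hld := (List.getElem?_eq_some_iff.1 hd).1
    have hld' : q < d.len := hld
    refine hmax (Or.inr ⟨p, d.len - 1 - q, hlc, by rw [StringWord.len_inv]; omega, ?_, ?_, ?_⟩)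
    · intro t ht
      obtain rfl : t = 0 := by omega
      rw [add_zero, add_zero, inv_letters_getElem? _ _ (by omega),
        show d.len - 1 - (d.len - 1 - q) = q by omega, hc, hd, Option.map_some, flip_flip]
    · rw [hge _ _ (by omega), show d.len - (d.len - 1 - q) = q + 1 by omega]
      exact h1
    · rw [hge _ _ (by omega), show d.len - (d.len - 1 - q + (0 + 1)) = q by omega]
      exact h2
  · refine ⟨d.inv, Or.inr rfl, p, p + n, q, q + n,
      h.isBd (fun p q h => hmax (Or.inr ⟨p, q, h⟩)) ?_⟩
    rintro rfl p q l hc hd h1 h2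
    have hlc := (List.getElem?_eq_some_iff.1 hc).1
    have hld := (List.getElem?_eq_some_iff.1 hd).1
    have hld' : q < d.len := by rw [← StringWord.len_inv]; exact hld
    rw [inv_letters_getElem? _ _ hld'] at hd
    obtain ⟨m, hm, hml⟩ := Option.map_eq_some_iff.1 hd
    obtain rfl : m = l := by rw [← flip_flip m, hml, flip_flip]
    refine hmax (Or.inl ⟨p, d.len - 1 - q, hlc, by omega, ?_, ?_, ?_⟩)
    · intro t ht
      obtain rfl : t = 0 := by omega
      rw [add_zero, add_zero, hc, hm]
    · rw [hge _ _ (by omega)] at h1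
      rwa [show d.len - 1 - q = d.len - (q + 1) by omega]
    · rw [hge _ _ (by omega)] at h2
      rwa [show d.len - 1 - q + (0 + 1) = d.len - q by omega]

/-- The diagonal entries of an endomorphism of a string module are equal. -/
theorem entry_self_eq (f : stringModule k Q c →ₗ[Q.Alg k] stringModule k Q c) {p : ℕ}
    (hp : p ≤ c.len) : entry f p p = entry f 0 0 := by
  induction p with
  | zero => rfl
  | succ p ih =>
    rw [← ih (by omega)]
    have hl : c.1.letters[p]? = some c.1.letters[p] := List.getElem?_eq_getElem hp
    generalize c.1.letters[p] = l at hl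
    rcases l with ⟨a, _ | _⟩
    · have h : Out c (p + 1) (a, true) p := Or.inr ⟨rfl, hl⟩
      exact (entry_eq_of_out f h h).symm
    · have h : Out c p (a, true) (p + 1) := Or.inl ⟨rfl, hl⟩
      exact entry_eq_of_out f h h

end Hom

/-! ### Strings of a brick algebra do not revisit a vertex -/

section Thin

variable {k : Type u} [Field k] [Fintype V] {Q : BoundQuiver V E}

theorem entry_comp {c d e : Q.StringWord} (f : stringModule k Q c →ₗ[Q.Alg k] stringModule k Q d)
    (g : stringModule k Q d →ₗ[Q.Alg k] stringModule k Q e) (q p : ℕ) :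
    entry (g ∘ₗ f) q p = ∑ r ∈ Finset.range (d.len + 1), entry f r p * entry g q r := by
  have h : (g ∘ₗ f) (bvec k c p) = g.restrictScalars k (f (bvec k c p)) := rfl
  rw [entry, h, eq_sum_bvec (f (bvec k c p)), map_sum, coord_sum]
  refine Finset.sum_congr rfl fun r _ => ?_
  rw [map_smul, coord_smul]
  rfl

theorem entry_sub {c d : Q.StringWord} (f g : stringModule k Q c →ₗ[Q.Alg k] stringModule k Q d)
    (q p : ℕ) : entry (f - g) q p = entry f q p - entry g q p := by
  have h : f (bvec k c p) = (f - g) (bvec k c p) + g (bvec k c p) := by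
    simp
  rw [entry, entry, entry, h, coord_add]
  ring

theorem entry_id {c : Q.StringWord} {q p : ℕ} (hp : p ≤ c.len) :
    entry (LinearMap.id : stringModule k Q c →ₗ[Q.Alg k] _) q p = if q = p then 1 else 0 :=
  coord_bvec c q p hp

theorem bvec_ne_zero {c : Q.StringWord} {p : ℕ} (hp : p ≤ c.len) : bvec k c p ≠ 0 := by
  intro h
  have := congrArg (fun x => coord x p) h
  simp only [coord_bvec _ _ _ hp, if_true, coord_zero] at this
  exact one_ne_zero this

/-- An idempotent endomorphism of a string module with zero diagonal vanishes, provided that the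
endomorphisms are triangular. -/
theorem eq_zero_of_idem {c : Q.StringWord} (g : stringModule k Q c →ₗ[Q.Alg k] stringModule k Q c)
    (hg : g ∘ₗ g = g) (h0 : entry g 0 0 = 0)
    (htri : (∀ q p, entry g q p ≠ 0 → p ≤ q) ∨ ∀ q p, entry g q p ≠ 0 → q ≤ p) : g = 0 := by
  by_contra hne
  obtain ⟨q, p, hqp⟩ := exists_entry_ne g hne
  -- an entry at minimal distance from the diagonal cannot be a sum of products of two entries
  have key : ∀ n q p, (q - p) + (p - q) = n → entry g q p = 0 := by
    intro n
    induction n using Nat.strong_induction_on with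
    | _ n ih =>
      intro q p hn
      by_contra hne
      have hdiag : ∀ r, r ≤ c.len → entry g r r = 0 := fun r hr => by rw [entry_self_eq g hr, h0]
      have hle := le_of_entry_ne g hne
      have hne' := hne
      rw [← hg, entry_comp] at hne'
      obtain ⟨r, hr, hr'⟩ := Finset.exists_ne_zero_of_sum_ne_zero hne'
      have h1 : entry g r p ≠ 0 := left_ne_zero_of_mul hr'
      have h2 : entry g q r ≠ 0 := right_ne_zero_of_mul hr'
      have hrp : r ≠ p := by rintro rfl; exact h1 (hdiag r hle.1)
      have hrq : r ≠ q := by rintro rfl; exact h2 (hdiag r hle.2)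
      rcases htri with htri | htri
      · have := htri _ _ h1
        have := htri _ _ h2
        exact h1 (ih _ (by omega) r p rfl)
      · have := htri _ _ h1
        have := htri _ _ h2
        exact h1 (ih _ (by omega) r p rfl)
  exact hqp (key _ q p rfl)

/-- A string module all of whose endomorphisms are triangular is indecomposable. -/
theorem indecomposable_of_triangular {c : Q.StringWord}
    (htri : (∀ (g : stringModule k Q c →ₗ[Q.Alg k] stringModule k Q c) (q p : ℕ),
        entry g q p ≠ 0 → p ≤ q) ∨
      ∀ (g : stringModule k Q c →ₗ[Q.Alg k] stringModule k Q c) (q p : ℕ),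
        entry g q p ≠ 0 → q ≤ p) : Indecomposable (stringModule k Q c) := by
  constructor
  · intro h
    have h1 : (𝟙 (stringModule k Q c)) = 0 := h.eq_of_src _ _
    have h2 := congrArg (fun f => f.hom (bvec k c 0)) h1
    exact bvec_ne_zero (k := k) (Nat.zero_le c.len) h2
  · intro Y Z φ
    set e : stringModule k Q c ⟶ stringModule k Q c :=
      φ.hom ≫ biprod.fst ≫ biprod.inl ≫ φ.inv with he
    have hidem : e ≫ e = e := by simp [he]
    have hidem' : e.hom ∘ₗ e.hom = e.hom := congrArg ModuleCat.Hom.hom hidem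
    set lam := entry e.hom 0 0 with hlam
    have hlam2 : lam * lam = lam := by
      conv_rhs => rw [hlam, ← hidem', entry_comp]
      rw [Finset.sum_eq_single 0]
      · intro r _ hr
        by_contra hne
        have h1 := left_ne_zero_of_mul hne
        have h2 := right_ne_zero_of_mul hne
        rcases htri with htri | htri
        · have := htri _ _ _ h2; omega
        · have := htri _ _ _ h1; omega
      · simp
    have h01 : lam = 0 ∨ lam = 1 := by
      have : lam * (lam - 1) = 0 := by rw [mul_sub, hlam2, mul_one, sub_self]
      rcases mul_eq_zero.1 this with h | h
      · exact Or.inl h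
      · exact Or.inr (sub_eq_zero.1 h)
    rcases h01 with h0 | h0
    · left
      have hz : e.hom = 0 := eq_zero_of_idem e.hom hidem' h0
        (htri.imp (fun h => h e.hom) (fun h => h e.hom))
      have hz' : e = 0 := ModuleCat.hom_ext hz
      rw [IsZero.iff_id_eq_zero]
      have : 𝟙 Y = biprod.inl ≫ φ.inv ≫ e ≫ φ.hom ≫ biprod.fst := by simp [he]
      rw [this, hz']
      simp
    · right
      have hz : LinearMap.id - e.hom = 0 := by
        refine eq_zero_of_idem (LinearMap.id - e.hom) ?_ ?_
          (htri.imp (fun h => h _) (fun h => h _))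
        · rw [LinearMap.sub_comp, LinearMap.comp_sub, LinearMap.comp_sub, hidem']
          simp
        · rw [entry_sub, entry_id (Nat.zero_le _), ← hlam, h0]
          simp
      have hz' : e = 𝟙 _ := ModuleCat.hom_ext (sub_eq_zero.1 hz).symm
      rw [IsZero.iff_id_eq_zero]
      have : 𝟙 Z = biprod.inr ≫ φ.inv ≫ 𝟙 _ ≫ φ.hom ≫ biprod.snd := by simp
      rw [this, ← hz', he]
      simp

theorem not_isBrick_of_triangular (hbrick : Q.IsBrickAlgebra k) {c : Q.StringWord}
    (htri : (∀ (g : stringModule k Q c →ₗ[Q.Alg k] stringModule k Q c) (q p : ℕ),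
        entry g q p ≠ 0 → p ≤ q) ∨
      ∀ (g : stringModule k Q c →ₗ[Q.Alg k] stringModule k Q c) (q p : ℕ),
        entry g q p ≠ 0 → q ≤ p)
    (f : stringModule k Q c →ₗ[Q.Alg k] stringModule k Q c) (hf : f ≠ 0)
    (hinj : ¬ Function.Injective f) : False := by
  obtain ⟨F, hF⟩ : ∃ F : stringModule k Q c ⟶ stringModule k Q c, F.hom = f :=
    ⟨ModuleCat.ofHom (X := stringModule k Q c) (Y := stringModule k Q c) f, rfl⟩
  have hiso : IsIso F := hbrick _ inferInstance (indecomposable_of_triangular htri) F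
    (fun h => hf (hF.symm.trans (congrArg ModuleCat.Hom.hom h)))
  rw [← hF] at hinj
  exact hinj ((ModuleCat.mono_iff_injective F).1 inferInstance)

/-- An endomorphism sending a factor substring to an equal submodule substring. -/
theorem exists_endo {c : Q.StringWord} {i j p q : ℕ} (h : IsBd true c i j) (h' : IsBd false c p q)
    (heq : c.seg i j = c.seg p q) (hip : i ≠ p) :
    ∃ f : stringModule k Q c →ₗ[Q.Alg k] stringModule k Q c,
      f ≠ 0 ∧ ¬ Function.Injective f := by
  obtain ⟨f, hf⟩ := exists_proj (k := k) h
  obtain ⟨g, hg⟩ := exists_incl (k := k) h'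
  have hl : j - i = q - p := by
    rw [← StringWord.len_seg c i j h.2.1, heq, StringWord.len_seg c p q h'.2.1]
  have h1 := h.1
  have h2 := h.2.1
  have h1' := h'.1
  have h2' := h'.2.1
  have key : ∀ d : Q.StringWord, c.seg i j = d → ∀ g : stringModule k Q d →ₗ[Q.Alg k]
      stringModule k Q c, (∀ x t, coord (g x) t = if p ≤ t ∧ t ≤ q then coord x (t - p) else 0) →
      ∃ f : stringModule k Q c →ₗ[Q.Alg k] stringModule k Q c,
        ∀ x t, coord (f x) t = if p ≤ t ∧ t ≤ q then coord x (i + (t - p)) else 0 := by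
    rintro _ rfl g hg
    refine ⟨g ∘ₗ f, fun x t => ?_⟩
    rw [LinearMap.comp_apply, hg, hf]
    split_ifs <;> first | rfl | omega
  obtain ⟨e, he⟩ := key _ heq g hg
  refine ⟨e, fun h0 => ?_, fun hinj => ?_⟩
  · have := he (bvec k c i) p
    rw [h0, if_pos (by omega), Nat.sub_self, add_zero, coord_bvec _ _ _ (by omega), if_pos rfl,
      LinearMap.zero_apply, coord_zero] at this
    exact zero_ne_one this
  · -- a basis vector outside of the factor substring is killed
    have hkill : ∀ s, s ≤ c.len → (s < i ∨ j < s) → False := by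
      intro s hs hs'
      refine bvec_ne_zero (k := k) hs (hinj ?_)
      rw [map_zero]
      refine coord_ext fun t ht => ?_
      rw [he, coord_zero, coord_bvec _ _ _ hs]
      split_ifs <;> first | rfl | omega
    by_cases hi : 0 < i
    · exact hkill 0 (by omega) (by omega)
    · exact hkill c.len le_rfl (by omega)

/-- A brick algebra has no nonlazy string from a vertex to itself. If there were one, consider a
shortest one. If its first and last letters have the same direction, then its string module has a
nilpotent endomorphism exchanging the end points. Otherwise it can be prolonged by its maximal
initial part without change of direction, and the resulting string module has a nilpotent
endomorphism that identifies the two copies of this part. In both cases a vertex is visited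
at most twice, so that all endomorphisms are triangular. -/
theorem IsBrickAlgebra.thin (hbrick : Q.IsBrickAlgebra k) (c : Q.StringWord) {i j : ℕ}
    (hi : i ≤ c.len) (hj : j ≤ c.len) (h : Q.vertex c.1 i = Q.vertex c.1 j) : i = j := by
  classical
  by_contra hij
  let P : ℕ → Prop := fun n => 0 < n ∧ ∃ c : Q.StringWord, c.len = n ∧
    Q.vertex c.1 0 = Q.vertex c.1 n
  have hseg : ∀ (c : Q.StringWord) (i j : ℕ), i < j → j ≤ c.len →
      Q.vertex c.1 i = Q.vertex c.1 j → P (j - i) := by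
    intro c i j hij hj h
    refine ⟨by omega, c.seg i j, StringWord.len_seg c i j hj, ?_⟩
    change Q.vertex (Q.seg c.1 i j) 0 = Q.vertex (Q.seg c.1 i j) (j - i)
    rw [vertex_seg Q c.1 i j 0 (by omega) hj, vertex_seg Q c.1 i j _ (by omega) hj, add_zero, h]
    congr 1
    omega
  have hP : ∃ n, P n := by
    rcases lt_or_gt_of_ne hij with h1 | h1
    · exact ⟨_, hseg c i j h1 hj h⟩
    · exact ⟨_, hseg c j i h1 hi h.symm⟩
  clear h hij hi hj i j c
  obtain ⟨hn0, c, hcn, hclosed⟩ := Nat.find_spec hP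
  set n := Nat.find hP with hn
  have hmin : ∀ (c : Q.StringWord) (i j : ℕ), i < j → j ≤ c.len →
      Q.vertex c.1 i = Q.vertex c.1 j → n ≤ j - i :=
    fun c i j h1 h2 h3 => Nat.find_min' hP (hseg c i j h1 h2 h3)
  have hletter : ∀ (c : Q.StringWord) t, t < c.len → ∃ l, c.1.letters[t]? = some l :=
    fun c t ht => ⟨_, List.getElem?_eq_getElem ht⟩
  -- the first and the last letter of a shortest closed string have opposite directions
  have type1 : ∀ c : Q.StringWord, c.len = n → Q.vertex c.1 0 = Q.vertex c.1 n →
      ∀ a a', c.1.letters[0]? = some (a, true) → c.1.letters[n - 1]? = some (a', true) →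
      False := by
    intro c hcn hclosed a a' h0 h1
    have hB : IsBd true c 0 0 := isBd_left h0
    have hB' : IsBd false c n n := by
      have := isBd_right h1
      rwa [Nat.sub_add_cancel hn0, hcn] at this
    have heq : c.seg 0 0 = c.seg n n := by
      refine Subtype.ext (word_ext hclosed fun t => ?_)
      rw [seg_letters_getElem?, seg_letters_getElem?, if_neg (by omega), if_neg (by omega)]
    obtain ⟨f, hf, hf'⟩ := exists_endo (k := k) hB hB' heq hn0.ne
    refine not_isBrick_of_triangular hbrick (Or.inl fun g q p hne => ?_) f hf hf'
    by_contra hlt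
    have hle := le_of_entry_ne g hne
    have := hmin c q p (by omega) hle.1 (vertex_eq_of_entry_ne g hne).symm
    obtain rfl : q = 0 := by omega
    obtain rfl : p = n := by omega
    obtain ⟨q', hq', -⟩ := entry_ne_of_out_left g (a := a') (p' := n - 1)
      (Or.inr ⟨by omega, h1⟩) hne
    rcases hq' with ⟨-, h⟩ | ⟨h, -⟩
    · rw [h0] at h; simp at h
    · omega
  obtain ⟨⟨a, b⟩, h0⟩ := hletter c 0 (by omega)
  obtain ⟨⟨a', b'⟩, h1⟩ := hletter c (n - 1) (by omega)
  have hbb : b' = !b := by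
    by_contra hbb
    obtain rfl : b' = b := by revert hbb; cases b <;> cases b' <;> simp
    cases b' with
    | true => exact type1 c hcn hclosed a a' h0 h1
    | false =>
      refine type1 c.inv (by rw [StringWord.len_inv, hcn]) ?_ a' a ?_ ?_
      · change Q.vertex (Q.inv c.1) 0 = Q.vertex (Q.inv c.1) n
        have hlen : c.1.letters.length = n := hcn
        rw [vertex_inv Q c.2 _ (by omega), vertex_inv Q c.2 _ (by omega), hlen, Nat.sub_self,
          Nat.sub_zero, hclosed]
      · rw [inv_letters_getElem? c _ (by omega), hcn, Nat.sub_zero, h1]; rfl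
      · rw [inv_letters_getElem? c _ (by omega), hcn, Nat.sub_self, h0]; rfl
  subst hbb
  have hn2 : 2 ≤ n := by
    by_contra hlt
    rw [show n - 1 = 0 by omega, h0] at h1
    cases b <;> simp at h1
  -- the first change of direction
  have hm : ∃ m, m < n ∧ ∃ x, c.1.letters[m]? = some (x, !b) := ⟨n - 1, by omega, a', h1⟩
  obtain ⟨hmn, x, hx⟩ := Nat.find_spec hm
  set m := Nat.find hm with hmdef
  have hprefix : ∀ t < m, ∃ y, c.1.letters[t]? = some (y, b) := by
    intro t ht
    obtain ⟨⟨y, b'⟩, hy⟩ := hletter c t (by omega)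
    have := Nat.find_min hm ht
    by_cases hb : b' = b
    · exact ⟨y, by rw [hy, hb]⟩
    · refine absurd ⟨by omega, y, ?_⟩ this
      rw [hy]
      revert hb
      cases b <;> cases b' <;> simp
  have hm0 : 0 < m := by
    by_contra hlt
    rw [show m = 0 by omega, h0] at hx
    cases b <;> simp at hx
  -- the prolonged string
  have hstep : Q.Step (a', !b) (a, b) := by
    have hs : Q.lsrc (a, b) = Q.ltgt (a', !b) := by
      rw [← vertex_of_letter Q c.1 c.2 0 _ h0, hclosed,
        ← vertex_succ Q c.1 (n - 1) _ h1, Nat.sub_add_cancel hn0]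
    refine ⟨hs, ?_, ?_, ?_⟩
    · intro hfl
      obtain rfl : a = a' := congrArg Prod.fst hfl
      rcases Nat.lt_or_ge 2 n with hn3 | hn3
      · have := hmin c 1 (n - 1) (by omega) (by omega) (by
          rw [vertex_succ Q c.1 0 _ h0, vertex_of_letter Q c.1 c.2 _ _ h1, ← ltgt_flip]
          congr 1)
        omega
      · refine getElem?_succ_ne_flip c h0 ?_
        rw [show 0 + 1 = n - 1 by omega, h1]; rfl
    · cases b <;> simp
    · cases b <;> simp
  let w0 : QWord V E := ⟨c.1.start, c.1.letters ++ c.1.letters.take m⟩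
  have hlen : c.1.letters.length = n := hcn
  have hw1 : ∀ t, t < n → w0.letters[t]? = c.1.letters[t]? := fun t ht =>
    List.getElem?_append_left (by omega)
  have hw2 : ∀ t, t < m → w0.letters[n + t]? = c.1.letters[t]? := fun t ht => by
    change (c.1.letters ++ _)[n + t]? = _
    rw [List.getElem?_append_right (by omega), hlen, show n + t - n = t by omega,
      List.getElem?_take, if_pos ht]
  have hwlen : w0.letters.length = n + m := by
    simp only [w0, List.length_append, List.length_take, hlen]; omega
  have hwstr : Q.IsString w0 := by
    rw [isString_iff]
    refine ⟨fun l hl => ?_, fun t l l' hl hl' => ?_⟩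
    · rw [hw1 0 hn0] at hl
      exact ((isString_iff Q c.1).1 c.2).1 l hl
    · have ht : t + 1 < n + m := by rw [← hwlen]; exact (List.getElem?_eq_some_iff.1 hl').1
      rcases lt_trichotomy (t + 1) n with h | h | h
      · rw [hw1 _ (by omega)] at hl hl'
        exact step_of_letters Q c.1 c.2 t l l' hl hl'
      · have e1 : w0.letters[t + 1]? = c.1.letters[0]? := by
          rw [h]; exact hw2 0 hm0
        rw [e1, h0] at hl'
        rw [hw1 _ (by omega), show t = n - 1 by omega, h1] at hl
        obtain rfl : _ = l := by simpa using hl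
        obtain rfl : _ = l' := by simpa using hl'
        exact hstep
      · obtain ⟨s, rfl⟩ := Nat.exists_eq_add_of_le (show n ≤ t by omega)
        rw [hw2 _ (by omega)] at hl
        rw [add_assoc, hw2 _ (by omega)] at hl'
        exact step_of_letters Q c.1 c.2 s l l' hl hl'
  let w : Q.StringWord := ⟨w0, hwstr⟩
  have hwl : w.len = n + m := hwlen
  have hwv : ∀ t ≤ m, Q.vertex w0 (n + t) = Q.vertex w0 t := by
    intro t ht
    rcases Nat.eq_zero_or_pos t with rfl | ht0
    · rw [add_zero, vertex_zero, show n = n - 1 + 1 by omega,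
        vertex_succ Q w0 (n - 1) _ (by rw [hw1 _ (by omega), h1]),
        ← vertex_succ Q c.1 (n - 1) _ h1, Nat.sub_add_cancel hn0, ← hclosed]
      rfl
    · obtain ⟨s, rfl⟩ := Nat.exists_eq_succ_of_ne_zero ht0.ne'
      obtain ⟨y, hy⟩ := hprefix s (by omega)
      rw [Nat.succ_eq_add_one, ← add_assoc, vertex_succ Q w0 (n + s) (y, b) (by
        rw [hw2 _ (by omega), hy]), vertex_succ Q w0 s (y, b) (by rw [hw1 _ (by omega), hy])]
  have hcoll : ∀ p q, p < q → q ≤ w.len → Q.vertex w.1 p = Q.vertex w.1 q →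
      p ≤ m ∧ q = n + p := by
    intro p q hpq hq hv
    have h3 := hmin w p q hpq hq hv
    obtain ⟨t, rfl⟩ := Nat.exists_eq_add_of_le (show n ≤ q by omega)
    have h4 : Q.vertex w.1 p = Q.vertex w.1 t := hv.trans (hwv t (by omega))
    rcases lt_trichotomy p t with h5 | h5 | h5
    · have := hmin w p t h5 (by omega) h4; omega
    · omega
    · have := hmin w t p h5 (by omega) h4.symm; omega
  have hwx : w.1.letters[m]? = some (x, !b) := (hw1 m hmn).trans hx
  have hBd1 : IsBd (!b) w 0 m := isBd_left hwx
  have hBd2 : IsBd b w n (n + m) := by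
    have h5 := isBd_right (c := w) ((hw1 (n - 1) (by omega)).trans h1)
    rwa [Nat.sub_add_cancel hn0, hwl, show (!(a', !b).2) = b by simp] at h5
  have heq : w.seg n (n + m) = w.seg 0 m := by
    refine Subtype.ext (word_ext (hwv 0 (by omega)) fun t => ?_)
    rw [seg_letters_getElem?, seg_letters_getElem?]
    by_cases ht : t < m
    · rw [if_pos (by omega), if_pos (by omega), zero_add]
      exact (hw2 t ht).trans (hw1 t (by omega)).symm
    · rw [if_neg (by omega), if_neg (by omega)]
  -- the last letter of the initial part is not inverse to the first letter after it
  have hlast : ∀ y, w.1.letters[n + m - 1]? = some (y, b) → y ≠ x := by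
    rintro y hy rfl
    have hy' : c.1.letters[m - 1]? = some (y, b) := by
      rw [← hw2 (m - 1) (by omega), ← hy]
      congr 1; omega
    refine getElem?_succ_ne_flip c hy' ?_
    rw [Nat.sub_add_cancel hm0, hx]; rfl
  have hend : w.1.letters[n + m]? = none := List.getElem?_eq_none hwlen.le
  cases b with
  | true =>
    obtain ⟨f, hf, hf'⟩ := exists_endo (k := k) hBd2 hBd1 heq hn0.ne'
    refine not_isBrick_of_triangular hbrick (Or.inr fun g q p hne => ?_) f hf hf'
    by_contra hlt
    have hle := le_of_entry_ne g hne
    obtain ⟨hp, rfl⟩ := hcoll p q (by omega) hle.2 (vertex_eq_of_entry_ne g hne)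
    have hup : ∀ s, p + s ≤ m → entry g (n + (p + s)) (p + s) ≠ 0 := by
      intro s
      induction s with
      | zero => intro _; exact hne
      | succ s ih =>
        intro hs
        obtain ⟨y, hy⟩ := hprefix (p + s) (by omega)
        have o1 : Out w (p + s) (y, true) (p + (s + 1)) :=
          Or.inl ⟨by omega, (hw1 _ (by omega)).trans hy⟩
        have o2 : Out w (n + (p + s)) (y, true) (n + (p + (s + 1))) :=
          Or.inl ⟨by omega, (hw2 _ (by omega)).trans hy⟩
        rw [entry_eq_of_out g o1 o2]
        exact ih (by omega)
    have hlastne := hup (m - p) (by omega)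
    rw [show p + (m - p) = m by omega] at hlastne
    obtain ⟨q', hq', -⟩ := entry_ne_of_out_left g (a := x) (p' := m + 1)
      (Or.inl ⟨rfl, hwx⟩) hlastne
    rcases hq' with ⟨-, h⟩ | ⟨h, h'⟩
    · rw [hend] at h; simp at h
    · exact hlast x (by rw [show n + m - 1 = q' by omega, h']; rfl) rfl
  | false =>
    obtain ⟨f, hf, hf'⟩ := exists_endo (k := k) hBd1 hBd2 heq.symm hn0.ne
    refine not_isBrick_of_triangular hbrick (Or.inl fun g q p hne => ?_) f hf hf'
    by_contra hlt
    have hle := le_of_entry_ne g hne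
    obtain ⟨hp, rfl⟩ := hcoll q p (by omega) hle.1 (vertex_eq_of_entry_ne g hne).symm
    have hup : ∀ s, q + s ≤ m → entry g (q + s) (n + (q + s)) ≠ 0 := by
      intro s
      induction s with
      | zero => intro _; exact hne
      | succ s ih =>
        intro hs
        obtain ⟨y, hy⟩ := hprefix (q + s) (by omega)
        have o1 : Out w (q + (s + 1)) (y, true) (q + s) :=
          Or.inr ⟨by omega, (hw1 _ (by omega)).trans hy⟩
        have o2 : Out w (n + (q + (s + 1))) (y, true) (n + (q + s)) :=
          Or.inr ⟨by omega, (hw2 _ (by omega)).trans hy⟩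
        rw [← entry_eq_of_out g o2 o1]
        exact ih (by omega)
    have hlastne := hup (m - q) (by omega)
    rw [show q + (m - q) = m by omega] at hlastne
    obtain ⟨p', hp', -⟩ := entry_ne_of_out_right g (a := x) (q' := m + 1)
      (Or.inl ⟨rfl, hwx⟩) hlastne
    rcases hp' with ⟨-, h⟩ | ⟨h, h'⟩
    · rw [hend] at h; simp at h
    · exact hlast x (by rw [show n + m - 1 = p' by omega, h']; rfl) rfl

end Thin

/-! ### Lifts of strings to the doubled quiver -/

/-- Every string word of the quiver visits every vertex at most once. -/
def Thin (Q : BoundQuiver V E) : Prop :=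
  ∀ (c : Q.StringWord) (i j : ℕ), i ≤ c.len → j ≤ c.len →
    Q.vertex c.1 i = Q.vertex c.1 j → i = j

theorem Thin.seg_inj {Q : BoundQuiver V E} (hQ : Q.Thin) {c : Q.StringWord} {i j i' j' : ℕ}
    (hij : i ≤ j) (hj : j ≤ c.len) (hij' : i' ≤ j') (hj' : j' ≤ c.len)
    (h : (c.seg i j).toStr = (c.seg i' j').toStr) : i = i' ∧ j = j' := by
  have hlen := StringWord.len_eq_of_toStr_eq h
  rw [StringWord.len_seg c i j hj, StringWord.len_seg c i' j' hj'] at hlen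
  rcases (StringWord.toStr_eq_iff _ _).1 h with h | h
  · have := hQ c i i' (by omega) (by omega) (congrArg (fun d : Q.StringWord => d.1.start) h)
    omega
  · have h1 : Q.vertex (Q.seg c.1 i j) 0 = Q.vertex (Q.inv (Q.seg c.1 i' j')) 0 :=
      congrArg (fun d : Q.StringWord => Q.vertex d.1 0) h
    have h2 : Q.vertex (Q.seg c.1 i j) (j - i) = Q.vertex (Q.inv (Q.seg c.1 i' j')) (j - i) :=
      congrArg (fun d : Q.StringWord => Q.vertex d.1 (j - i)) h
    have hl : (Q.seg c.1 i' j').letters.length = j' - i' := seg_length Q c.1 i' j' hj'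
    rw [vertex_inv Q (isString_seg Q c.2 i' j') _ (by omega), hl,
      vertex_seg Q c.1 _ _ _ (by omega) hj, vertex_seg Q c.1 _ _ _ (by omega) hj'] at h1 h2
    have h1' := hQ c _ _ (by omega) (by omega) h1
    have h2' := hQ c _ _ (by omega) (by omega) h2
    omega

/-- The letter of the quiver to which a letter of the doubled quiver specializes. -/
def specLetter (l : (E ⊕ E) × Bool) : E × Bool :=
  Sum.elim (fun a => (a, l.2)) (fun a => (a, !l.2)) l.1

theorem specLetter_flip (l : (E ⊕ E) × Bool) : specLetter (flip l) = flip (specLetter l) := by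
  rcases l with ⟨a | a, b⟩ <;> simp [specLetter, flip]

theorem specLetter_inj {l m : (E ⊕ E) × Bool} (h : specLetter l = specLetter m)
    (h' : l.2 = m.2) : l = m := by
  rcases l with ⟨a | a, b⟩ <;> rcases m with ⟨a' | a', b'⟩ <;> simp_all [specLetter]

theorem lsrc_specLetter (Q : BoundQuiver V E) (l : (E ⊕ E) × Bool) :
    Q.lsrc (specLetter l) = Q.double.lsrc l := by
  rcases l with ⟨a | a, _ | _⟩ <;> simp [specLetter, lsrc, double]

theorem ltgt_specLetter (Q : BoundQuiver V E) (l : (E ⊕ E) × Bool) :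
    Q.ltgt (specLetter l) = Q.double.ltgt l := by
  rcases l with ⟨a | a, _ | _⟩ <;> simp [specLetter, ltgt, double]

theorem specialize_getElem? (d : QWord V (E ⊕ E)) (t : ℕ) :
    (specialize d).letters[t]? = d.letters[t]?.map specLetter := by
  simp only [specialize, List.getElem?_map]
  rfl

theorem specialize_length (d : QWord V (E ⊕ E)) :
    (specialize d).letters.length = d.letters.length := by simp [specialize]

theorem vertex_specialize (Q : BoundQuiver V E) (d : QWord V (E ⊕ E)) (t : ℕ)
    (ht : t ≤ d.letters.length) : Q.vertex (specialize d) t = Q.double.vertex d t := by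
  cases t with
  | zero => rfl
  | succ t =>
    have h : d.letters[t]? = some d.letters[t] := List.getElem?_eq_getElem ht
    rw [vertex_succ Q.double d t _ h, vertex_succ Q _ t _ (by rw [specialize_getElem?, h]; rfl),
      ltgt_specLetter]

theorem specialize_seg (Q : BoundQuiver V E) (d : QWord V (E ⊕ E)) (i j : ℕ)
    (hi : i ≤ d.letters.length) :
    specialize (Q.double.seg d i j) = Q.seg (specialize d) i j := by
  refine word_ext (vertex_specialize Q d i hi).symm fun t => ?_
  rw [specialize_getElem?, seg_getElem?, seg_getElem?, specialize_getElem?]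
  split_ifs <;> rfl

theorem specialize_inv (Q : BoundQuiver V E) (d : QWord V (E ⊕ E)) :
    specialize (Q.double.inv d) = Q.inv (specialize d) := by
  refine word_ext ?_ fun t => ?_
  · change _ = Q.vertex (specialize d) _
    rw [specialize_length, vertex_specialize Q d _ le_rfl]
    rfl
  · by_cases ht : t < d.letters.length
    · rw [specialize_getElem?, inv_getElem? _ _ _ ht,
        inv_getElem? _ _ _ (by rw [specialize_length]; exact ht), specialize_length,
        specialize_getElem?]
      cases d.letters[d.letters.length - 1 - t]? with
      | none => rfl
      | some l => simp [specLetter_flip]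
    · rw [List.getElem?_eq_none (by rw [specialize_length, inv_length]; omega),
        List.getElem?_eq_none (by rw [inv_length, specialize_length]; omega)]

/-- Words of the doubled quiver specializing to strings are strings. -/
theorem isString_of_specialize (Q : BoundQuiver V E) {d : QWord V (E ⊕ E)}
    (h : Q.IsString (specialize d)) : Q.double.IsString d := by
  rw [isString_iff] at h ⊢
  refine ⟨fun l hl => ?_, fun t l m hl hm => ?_⟩
  · rw [← lsrc_specLetter]
    exact h.1 _ (by rw [specialize_getElem?, hl]; rfl)
  · obtain ⟨h1, h2, h3, h4⟩ := h.2 t _ _ (by rw [specialize_getElem?, hl]; rfl)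
      (by rw [specialize_getElem?, hm]; rfl)
    refine ⟨by rw [← lsrc_specLetter, ← ltgt_specLetter, h1], fun hf => h2 ?_, ?_, ?_⟩
    · rw [hf, specLetter_flip]
    · rcases l with ⟨a, b⟩
      rcases m with ⟨a', b'⟩
      rintro rfl rfl (⟨_, _, h⟩ | ⟨_, _, h⟩)
      · exact h3 rfl rfl h
      · exact h4 rfl rfl h
    · rcases l with ⟨a, b⟩
      rcases m with ⟨a', b'⟩
      rintro rfl rfl (⟨_, _, h⟩ | ⟨_, _, h⟩)
      · exact h4 rfl rfl h
      · exact h3 rfl rfl h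

/-- The words of the doubled quiver that specialize to strings: the orientations of strings. -/
def Lift (Q : BoundQuiver V E) : Type (max v w) :=
  {d : Q.double.StringWord // Q.IsString (specialize d.1)}

namespace Lift

variable {Q : BoundQuiver V E}

/-- The underlying string word. -/
def down (d : Q.Lift) : Q.StringWord := ⟨specialize d.1.1, d.2⟩

/-- The underlying string. -/
def str (d : Q.Lift) : Q.Str := d.down.toStr

/-- Number of letters. -/
abbrev len (d : Q.Lift) : ℕ := d.1.len

/-- The part of an oriented string between two of its vertices. -/
def seg (d : Q.Lift) (i j : ℕ) (hi : i ≤ d.len) : Q.Lift :=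
  ⟨d.1.seg i j, by
    have := isString_seg Q d.2 i j
    rwa [← specialize_seg Q d.1.1 i j hi] at this⟩

/-- The inverse of an oriented string. -/
def inv (d : Q.Lift) : Q.Lift :=
  ⟨d.1.inv, by
    have := isString_inv Q d.2
    rwa [← specialize_inv Q d.1.1] at this⟩

theorem len_down (d : Q.Lift) : d.down.len = d.len := specialize_length d.1.1

theorem down_seg (d : Q.Lift) (i j : ℕ) (hi : i ≤ d.len) : (d.seg i j hi).down = d.down.seg i j :=
  Subtype.ext (specialize_seg Q d.1.1 i j hi)

theorem down_inv (d : Q.Lift) : d.inv.down = d.down.inv := Subtype.ext (specialize_inv Q d.1.1)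

theorem inv_inv (d : Q.Lift) : d.inv.inv = d := Subtype.ext (StringWord.inv_inv d.1)

theorem len_inv (d : Q.Lift) : d.inv.len = d.len := StringWord.len_inv d.1

theorem len_seg (d : Q.Lift) {i j : ℕ} (hi : i ≤ d.len) (hj : j ≤ d.len) :
    (d.seg i j hi).len = j - i := StringWord.len_seg d.1 i j hj

theorem str_inv (d : Q.Lift) : d.inv.str = d.str := by
  rw [str, down_inv, StringWord.toStr_inv]; rfl

theorem down_letters (d : Q.Lift) (t : ℕ) :
    d.down.1.letters[t]? = d.1.1.letters[t]?.map specLetter := specialize_getElem? d.1.1 t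

theorem ext_of_down {d e : Q.Lift} (h : d.down = e.down)
    (h' : ∀ (t : ℕ) (l m : (E ⊕ E) × Bool), d.1.1.letters[t]? = some l → e.1.1.letters[t]? = some m → l.2 = m.2) :
    d = e := by
  refine Subtype.ext (Subtype.ext (word_ext ?_ fun t => ?_))
  · exact congrArg (fun c : Q.StringWord => c.1.start) h
  · have h1 : d.down.1.letters[t]? = e.down.1.letters[t]? := by rw [h]
    rw [down_letters, down_letters] at h1
    cases hd : d.1.1.letters[t]? with
    | none =>
      rw [hd] at h1
      cases he : e.1.1.letters[t]? with
      | none => rfl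
      | some m => rw [he] at h1; simp at h1
    | some l =>
      cases he : e.1.1.letters[t]? with
      | none => rw [hd, he] at h1; simp at h1
      | some m =>
        rw [hd, he] at h1
        exact congrArg some (specLetter_inj (by simpa using h1) (h' t l m hd he))

theorem seg_whole (d : Q.Lift) : d.seg 0 d.len (Nat.zero_le _) = d :=
  Subtype.ext (StringWord.seg_whole d.1)

theorem seg_seg (d : Q.Lift) {i j a b : ℕ} (hi : i ≤ d.len) (ha : a ≤ (d.seg i j hi).len)
    (hab : a ≤ b) (hb : i + b ≤ j) (hj : j ≤ d.len) :
    (d.seg i j hi).seg a b ha = d.seg (i + a) (i + b) (by omega) :=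
  Subtype.ext (StringWord.seg_seg d.1 hab hb hj)

theorem seg_inv (d : Q.Lift) {i j : ℕ} (hij : i ≤ j) (hj : j ≤ d.len) (hi : i ≤ d.inv.len) :
    d.inv.seg i j hi = (d.seg (d.len - j) (d.len - i) (by omega)).inv :=
  Subtype.ext (StringWord.seg_inv d.1 hij hj)

/-- The string underlying the part of `d` between two of its vertices. -/
def strSeg (d : Q.Lift) (i j : ℕ) : Q.Str := (d.down.seg i j).toStr

theorem str_seg (d : Q.Lift) (i j : ℕ) (hi : i ≤ d.len) : (d.seg i j hi).str = d.strSeg i j := by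
  rw [str, down_seg]; rfl

theorem strSeg_whole (d : Q.Lift) : d.strSeg 0 d.len = d.str := by
  rw [← str_seg d 0 d.len (Nat.zero_le _), seg_whole]

theorem strSeg_seg (d : Q.Lift) {i j a b : ℕ} (hi : i ≤ d.len) 
    (hab : a ≤ b) (hb : i + b ≤ j) (hj : j ≤ d.len) :
    (d.seg i j hi).strSeg a b = d.strSeg (i + a) (i + b) := by
  rw [strSeg, down_seg, StringWord.seg_seg _ hab hb (by rw [len_down]; exact hj)]; rfl

theorem strSeg_inv (d : Q.Lift) {i j : ℕ} (hij : i ≤ j) (hj : j ≤ d.len) :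
    d.inv.strSeg i j = d.strSeg (d.len - j) (d.len - i) := by
  rw [strSeg, down_inv, StringWord.seg_inv _ hij (by rw [len_down]; exact hj), StringWord.toStr_inv,
    len_down]
  rfl

theorem strSeg_inj (hQ : Q.Thin) {d : Q.Lift} {i j i' j' : ℕ}
    (hij : i ≤ j) (hj : j ≤ d.len) (hij' : i' ≤ j') (hj' : j' ≤ d.len)
    (h : d.strSeg i j = d.strSeg i' j') : i = i' ∧ j = j' :=
  hQ.seg_inj hij (by rw [len_down]; exact hj) hij' (by rw [len_down]; exact hj') h

theorem isConcat_strSeg (d : Q.Lift) {i j k : ℕ} (hij : i ≤ j) (hjk : j < k) (hk : k ≤ d.len) :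
    IsConcat (d.strSeg i j) (d.strSeg (j + 1) k) (d.strSeg i k) :=
  StringWord.isConcat_seg d.down hij hjk (by rw [len_down]; exact hk)

theorem isConcat_str_iff {d : Q.Lift} {u v : Q.Str} :
    IsConcat u v d.str ↔ ∃ i < d.len,
      (u = d.strSeg 0 i ∧ v = d.strSeg (i + 1) d.len) ∨
      (v = d.strSeg 0 i ∧ u = d.strSeg (i + 1) d.len) := by
  rw [str, isConcat_toStr_iff, len_down]; rfl

/-- The orientation of a string word with prescribed directions of its letters. -/
theorem exists_lift (c : Q.StringWord) (ε : ℕ → Bool) : ∃ d : Q.Lift, d.down = c ∧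
    d.1.1 = ⟨c.1.start, c.1.letters.mapIdx fun i l =>
      (if ε i = l.2 then Sum.inl l.1 else Sum.inr l.1, ε i)⟩ ∧
    ∀ t l, d.1.1.letters[t]? = some l → l.2 = ε t := by
  set d0 : QWord V (E ⊕ E) := ⟨c.1.start, c.1.letters.mapIdx fun i l =>
      (if ε i = l.2 then Sum.inl l.1 else Sum.inr l.1, ε i)⟩ with hd0
  have hs : specialize d0 = c.1 := by
    refine word_ext rfl fun t => ?_
    rw [specialize_getElem?, hd0]
    simp only [List.getElem?_mapIdx, Option.map_map]
    cases c.1.letters[t]? with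
    | none => rfl
    | some l =>
      rcases l with ⟨a, b⟩
      by_cases h : ε t = b
      · simp [specLetter, h]
      · have : (!ε t) = b := by revert h; cases ε t <;> cases b <;> simp
        simp [specLetter, h, this]
  have hstr : Q.IsString (specialize d0) := by rw [hs]; exact c.2
  refine ⟨⟨⟨d0, isString_of_specialize Q hstr⟩, hstr⟩, Subtype.ext hs, rfl, fun t l hl => ?_⟩
  change d0.letters[t]? = _ at hl
  rw [hd0] at hl
  simp only [List.getElem?_mapIdx] at hl
  obtain ⟨m, -, rfl⟩ := Option.map_eq_some_iff.1 hl
  rfl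

/-- All the factor substrings (for `b = true`), respectively submodule substrings (for
`b = false`), of the oriented string `d` lie in `B`. -/
def Good (b : Bool) (B : Set Q.Str) (d : Q.Lift) : Prop :=
  ∀ i j, IsBd b d.1 i j → d.strSeg i j ∈ B

variable {b : Bool} {B : Set Q.Str} {d : Q.Lift}

theorem Good.str_mem (h : d.Good b B) : d.str ∈ B := by
  rw [← strSeg_whole]
  exact h _ _ (isBd_whole b d.1)

theorem Good.mono {B' : Set Q.Str} (h : d.Good b B) (hB : B ⊆ B') : d.Good b B' :=
  fun i j hij => hB (h i j hij)

theorem Good.seg (h : d.Good b B) {i j : ℕ} (hij : IsBd b d.1 i j) (hi : i ≤ d.len) :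
    (d.seg i j hi).Good b B := by
  intro p q hpq
  have hq := hpq.2.1
  change q ≤ (d.seg i j hi).len at hq
  rw [len_seg d hi hij.2.1] at hq
  have := hij.1
  rw [strSeg_seg d hi hpq.1 (by omega) hij.2.1]
  exact h _ _ (hij.trans hpq)

theorem Good.inv (h : d.Good b B) : d.inv.Good b B := by
  intro i j hij
  have h2 := hij.2.1
  change j ≤ d.inv.len at h2
  rw [len_inv] at h2
  rw [strSeg_inv d hij.1 h2]
  have := hij.inv
  change IsBd b d.inv.inv.1 (d.inv.len - j) (d.inv.len - i) at this
  rw [inv_inv, len_inv] at this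
  exact h _ _ this

theorem strSeg_mem_of_closed (hB : IsClosedStr B) {i j k : ℕ} (hij : i ≤ j) (hjk : j < k)
    (hk : k ≤ d.len) (h1 : d.strSeg i j ∈ B) (h2 : d.strSeg (j + 1) k ∈ B) : d.strSeg i k ∈ B :=
  hB _ _ _ (isConcat_strSeg d hij hjk hk) h1 h2

theorem strSeg_mem_of_coclosed (hB : IsClosedStr Bᶜ) {i j k : ℕ} (hij : i ≤ j) (hjk : j < k)
    (hk : k ≤ d.len) (h : d.strSeg i k ∈ B) : d.strSeg i j ∈ B ∨ d.strSeg (j + 1) k ∈ B := by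
  by_contra hcon
  push Not at hcon
  exact hB _ _ _ (isConcat_strSeg d hij hjk hk) hcon.1 hcon.2 h

/-- Every string in a biclosed set `B` has an orientation all of whose factor substrings
(submodule substrings, if `b = false`) lie in `B`: a letter is direct (inverse) if and only if
the part of the string before it lies in `B`. -/
theorem exists_good (hB' : IsClosedStr Bᶜ) (b : Bool) {c : Q.StringWord}
    (hc : c.toStr ∈ B) : ∃ d : Q.Lift, d.down = c ∧ d.Good b B := by
  classical
  obtain ⟨d, hd, -, hε⟩ := exists_lift c fun t => if (c.seg 0 t).toStr ∈ B then b else !b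
  refine ⟨d, hd, fun i j hij => ?_⟩
  obtain ⟨h1, h2, h3, h4⟩ := hij
  have hseg : ∀ p q, d.strSeg p q = (c.seg p q).toStr := fun p q => by rw [strSeg, hd]
  have hleft : d.strSeg 0 j ∈ B := by
    rcases eq_or_lt_of_le h2 with rfl | h2
    · rw [strSeg_whole, str, hd]; exact hc
    · have hl : d.1.1.letters[j]? = some d.1.1.letters[j] := List.getElem?_eq_getElem h2
      have := h3 _ hl
      rw [hε _ _ hl] at this
      by_contra hn
      rw [hseg] at hn
      rw [if_neg hn] at this
      cases b <;> simp at this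
  rcases i with _ | i
  · exact hleft
  · have hi : i < d.1.1.letters.length := lt_of_lt_of_le h1 h2
    have hl : d.1.1.letters[i]? = some d.1.1.letters[i] := List.getElem?_eq_getElem hi
    have := h4 i _ rfl hl
    rw [hε _ _ hl] at this
    refine (strSeg_mem_of_coclosed hB' (Nat.zero_le i) (by omega) h2 hleft).resolve_left fun hn => ?_
    rw [hseg] at hn
    rw [if_pos hn] at this
    cases b <;> simp at this

/-- Two orientations `e`, `d` of the same string agree on a part which is a factor substring of
`e` and a submodule substring of `d`. -/
theorem exists_common {d e : Q.Lift} (h : e.down = d.down) :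
    ∃ i j, ∃ hi : i ≤ e.len, ∃ hi' : i ≤ d.len, IsBd true e.1 i j ∧ IsBd false d.1 i j ∧
      e.seg i j hi = d.seg i j hi' := by
  classical
  have hlen : e.len = d.len := by rw [← len_down, ← len_down, h]
  have hlet : ∀ t, t < d.len → ∃ l m, e.1.1.letters[t]? = some l ∧ d.1.1.letters[t]? = some m :=
    fun t ht => ⟨_, _, List.getElem?_eq_getElem (show t < e.1.len by
      have : e.1.len = d.len := hlen
      omega), List.getElem?_eq_getElem ht⟩
  let P : ℕ → Prop := fun t => t = d.len ∨ ∃ l m, e.1.1.letters[t]? = some l ∧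
    d.1.1.letters[t]? = some m ∧ l.2 = true ∧ m.2 = false
  have hP : ∃ t, P t := ⟨d.len, Or.inl rfl⟩
  have hj := Nat.find_spec hP
  have hjmin := fun t => Nat.find_min hP (m := t)
  set j := Nat.find hP
  have hjle : j ≤ d.len := Nat.find_min' hP (Or.inl rfl)
  let P' : ℕ → Prop := fun s => s ≤ j ∧ ∀ t, s ≤ t → t < j → ∀ l m, e.1.1.letters[t]? = some l →
    d.1.1.letters[t]? = some m → l.2 = m.2
  have hP' : ∃ s, P' s := ⟨j, le_rfl, fun t h1 h2 => by omega⟩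
  obtain ⟨hij, hagree⟩ := Nat.find_spec hP'
  have himin := fun t => Nat.find_min hP' (m := t)
  set i := Nat.find hP'
  have hleft : ∀ t l m, t + 1 = i → e.1.1.letters[t]? = some l → d.1.1.letters[t]? = some m →
      l.2 = false ∧ m.2 = true := by
    intro t l m ht hl hm
    have hne : l.2 ≠ m.2 := by
      intro hlm
      refine himin t (by omega) ⟨by omega, fun s hs1 hs2 l' m' hl' hm' => ?_⟩
      rcases eq_or_lt_of_le hs1 with rfl | hs1
      · rw [← Option.some.inj (hl.symm.trans hl'), ← Option.some.inj (hm.symm.trans hm'), hlm]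
      · exact hagree s (by omega) hs2 l' m' hl' hm'
    have hnot : ¬ (l.2 = true ∧ m.2 = false) := fun hlm =>
      hjmin t (by omega) (Or.inr ⟨l, m, hl, hm, hlm⟩)
    revert hne hnot
    cases l.2 <;> cases m.2 <;> simp
  have hlene : e.1.len = d.1.len := hlen
  have hjle' : j ≤ d.1.len := hjle
  refine ⟨i, j, by omega, by omega, ⟨hij, by omega, fun l hl => ?_, fun t l ht hl => ?_⟩,
    ⟨hij, by omega, fun m hm => ?_, fun t m ht hm => ?_⟩, ?_⟩
  · rcases hj with hj | ⟨l', m', hl', hm', h1, h2⟩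
    · have := (List.getElem?_eq_some_iff.1 hl).1
      have h9 : e.1.1.letters.length = d.len := hlen
      omega
    · rw [Option.some.inj (hl.symm.trans hl'), h1]
  · obtain ⟨l', m', hl', hm'⟩ := hlet t (by omega)
    obtain rfl : l = l' := Option.some.inj (hl.symm.trans hl')
    exact (hleft t l m' ht hl hm').1
  · rcases hj with hj | ⟨l', m', hl', hm', h1, h2⟩
    · have := (List.getElem?_eq_some_iff.1 hm).1
      have h9 : d.1.1.letters.length = d.len := rfl
      omega
    · rw [Option.some.inj (hm.symm.trans hm'), h2]
  · obtain ⟨l', m', hl', hm'⟩ := hlet t (by omega)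
    obtain rfl : m = m' := Option.some.inj (hm.symm.trans hm')
    exact (hleft t l' m ht hl' hm).2
  · refine ext_of_down (by rw [down_seg, down_seg, h]) fun t l m hl hm => ?_
    change (e.1.seg i j).1.letters[t]? = _ at hl
    change (d.1.seg i j).1.letters[t]? = _ at hm
    rw [seg_letters_getElem?] at hl hm
    split_ifs at hl hm
    exact hagree _ (by omega) (by assumption) l m hl hm

end Lift

/-! ### Removable strings of a biclosed set -/

section Removable

variable {Q : BoundQuiver V E}

/-- The number of letters of a string. -/
def Str.length (x : Q.Str) : ℕ :=
  Quotient.lift (fun c : Q.StringWord => c.len)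
    (fun _ _ h => StringWord.len_eq_of_toStr_eq (Quotient.sound h)) x

theorem StringWord.length_toStr (c : Q.StringWord) : c.toStr.length = c.len := rfl

theorem Lift.length_str (d : Q.Lift) : d.str.length = d.len := d.len_down

theorem Lift.length_strSeg (d : Q.Lift) (i : ℕ) {j : ℕ} (hj : j ≤ d.len) :
    (d.strSeg i j).length = j - i :=
  StringWord.len_seg d.down i j (by rw [Lift.len_down]; exact hj)

theorem IsConcat.exists_seg {u v x : Q.Str} (h : IsConcat u v x) :
    ∃ (e : Q.StringWord) (i : ℕ), i < e.len ∧ e.toStr = x ∧ (e.seg 0 i).toStr = u ∧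
      (e.seg (i + 1) e.len).toStr = v := by
  obtain ⟨e, rfl⟩ := StringWord.exists_toStr x
  obtain ⟨i, hi, ⟨rfl, rfl⟩ | ⟨rfl, rfl⟩⟩ := isConcat_toStr_iff.1 h
  · exact ⟨e, i, hi, rfl, rfl, rfl⟩
  · refine ⟨e.inv, e.len - (i + 1), by rw [StringWord.len_inv]; omega,
      StringWord.toStr_inv e, ?_, ?_⟩
    · rw [StringWord.seg_inv e (by omega) (by omega), StringWord.toStr_inv,
        Nat.sub_sub_self hi, Nat.sub_zero]
    · rw [StringWord.len_inv, StringWord.seg_inv e (by omega) le_rfl, StringWord.toStr_inv,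
        Nat.sub_self, show e.len - (e.len - (i + 1) + 1) = i by omega]

theorem IsConcat.length_eq {u v x : Q.Str} (h : IsConcat u v x) :
    x.length = u.length + v.length + 1 := by
  obtain ⟨e, i, hi, rfl, rfl, rfl⟩ := h.exists_seg
  rw [StringWord.length_toStr, StringWord.length_toStr, StringWord.length_toStr,
    StringWord.len_seg e _ _ (by omega), StringWord.len_seg e _ _ le_rfl]
  omega

theorem IsConcat.left_ne {u v x : Q.Str} (h : IsConcat u v x) : u ≠ x := by
  rintro rfl
  have := h.length_eq
  omega

theorem IsConcat.right_ne {u v x : Q.Str} (h : IsConcat u v x) : v ≠ x := h.symm.left_ne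

theorem Thin.not_isConcat_self (hQ : Q.Thin) {u x : Q.Str} : ¬ IsConcat u u x := by
  intro h
  obtain ⟨e, i, hi, rfl, rfl, h2⟩ := h.exists_seg
  have := hQ.seg_inj (by omega) le_rfl (by omega) (by omega) h2
  omega

theorem Thin.length_lt [Fintype V] (hQ : Q.Thin) (x : Q.Str) : x.length < Fintype.card V := by
  obtain ⟨c, rfl⟩ := StringWord.exists_toStr x
  have hinj : Function.Injective fun i : Fin (c.len + 1) => Q.vertex c.1 i := fun i j h =>
    Fin.ext (hQ c _ _ (Nat.lt_succ_iff.1 i.2) (Nat.lt_succ_iff.1 j.2) h)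
  have := Fintype.card_le_of_injective _ hinj
  rwa [Fintype.card_fin] at this

/-- The string `x` of the biclosed set `B` is such that `B` without `x` is biclosed: it is not a
concatenation of elements of `B`, and it is not needed for a concatenation with a string outside
of `B`. -/
structure IsRem (B : Set Q.Str) (x : Q.Str) : Prop where
  mem : x ∈ B
  indec : ∀ u v, IsConcat u v x → u ∈ B → v ∉ B
  ext : ∀ u z, IsConcat u x z → z ∈ B → u ∈ B

theorem IsRem.isClosed {B : Set Q.Str} {x : Q.Str} (h : IsRem B x) (hB : IsClosedStr B) :
    IsClosedStr (B \ {x}) := by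
  rintro u v z hz ⟨hu, -⟩ ⟨hv, -⟩
  refine ⟨hB u v z hz hu hv, ?_⟩
  rintro rfl
  exact h.indec u v hz hu hv

theorem IsRem.isCoclosed {B : Set Q.Str} {x : Q.Str} (h : IsRem B x) (hQ : Q.Thin)
    (hB : IsClosedStr Bᶜ) : IsClosedStr (B \ {x})ᶜ := by
  have key : ∀ u, u ∈ (B \ {x})ᶜ → u ∈ Bᶜ ∨ u = x := by
    intro u hu
    by_contra hcon
    push Not at hcon
    exact hu ⟨not_not.1 hcon.1, hcon.2⟩
  rintro u v z hz hu hv ⟨hzB, -⟩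
  rcases key u hu with hu' | rfl <;> rcases key v hv with hv' | rfl
  · exact hB u v z hz hu' hv' hzB
  · exact hu' (h.ext u z hz hzB)
  · exact hv' (h.ext v z hz.symm hzB)
  · exact hQ.not_isConcat_self hz

theorem isRem_of_biclosed {B : Set Q.Str} {x : Q.Str} (hx : x ∈ B) (h1 : IsClosedStr (B \ {x}))
    (h2 : IsClosedStr (B \ {x})ᶜ) : IsRem B x := by
  refine ⟨hx, fun u v hx hu hv => ?_, fun u z hz hzB => ?_⟩
  · exact (h1 u v x hx ⟨hu, hx.left_ne⟩ ⟨hv, hx.right_ne⟩).2 rfl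
  · by_contra hu
    exact h2 u x z hz (fun h => hu h.1) (fun h => h.2 rfl) ⟨hzB, fun h => hz.right_ne h.symm⟩

/-- Strictly between two biclosed sets `C ⊂ B` there is a biclosed set obtained from `B` by removing
one string. One takes a longest string in `B \ C` among those which are not concatenations of two
elements of `B`. -/
theorem exists_isRem [Fintype V] (hQ : Q.Thin) {B C : Set Q.Str} (hB : IsClosedStr B)
    (hB' : IsClosedStr Bᶜ) (hC : IsClosedStr C) (hC' : IsClosedStr Cᶜ) (hCB : C ⊆ B)
    (hne : ∃ x ∈ B, x ∉ C) : ∃ x, x ∉ C ∧ IsRem B x := by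
  classical
  let S : Set Q.Str := {x | x ∈ B ∧ x ∉ C ∧ ∀ u v, IsConcat u v x → u ∈ B → v ∉ B}
  have hS : ∃ n, ∃ x ∈ S, x.length + n = Fintype.card V := by
    have hex : ∃ n, ∃ x ∈ B, x ∉ C ∧ x.length = n := by
      obtain ⟨x, h1, h2⟩ := hne
      exact ⟨_, x, h1, h2, rfl⟩
    obtain ⟨x, h1, h2, h3⟩ := Nat.find_spec hex
    have hmin := fun n => Nat.find_min hex (m := n)
    refine ⟨Fintype.card V - x.length, x, ⟨h1, h2, fun u v hx hu hv => ?_⟩, ?_⟩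
    · have hlen := hx.length_eq
      by_cases huC : u ∈ C
      · by_cases hvC : v ∈ C
        · exact h2 (hC u v x hx huC hvC)
        · exact hmin v.length (by omega) ⟨v, hv, hvC, rfl⟩
      · exact hmin u.length (by omega) ⟨u, hu, huC, rfl⟩
    · have := hQ.length_lt x
      omega
  obtain ⟨x, ⟨hxB, hxC, hx⟩, hxn⟩ := Nat.find_spec hS
  have hmax := fun n => Nat.find_min hS (m := n)
  refine ⟨x, hxC, hxB, hx, ?_⟩
  by_contra hcon
  -- a shortest string `u` violating the condition
  have hex : ∃ n u z, IsConcat u x z ∧ z ∈ B ∧ u ∉ B ∧ u.length = n := by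
    push Not at hcon
    obtain ⟨u, z, h1, h2, h3⟩ := hcon
    exact ⟨_, u, z, h1, h2, h3, rfl⟩
  obtain ⟨u, z, hz, hzB, huB, hun⟩ := Nat.find_spec hex
  have hmin := fun n => Nat.find_min hex (m := n)
  have hlen := hz.length_eq
  have hzV := hQ.length_lt z
  refine hmax (Fintype.card V - z.length) (by omega) ⟨z, ⟨hzB, ?_, ?_⟩, ?_⟩
  · exact hC' u x z hz (fun h => huB (hCB h)) hxC
  · obtain ⟨e, i, hi, rfl, rfl, rfl⟩ := hz.exists_seg
    have cl : ∀ {p q r}, p ≤ q → q < r → r ≤ e.len → (e.seg p q).toStr ∈ B →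
        (e.seg (q + 1) r).toStr ∈ B → (e.seg p r).toStr ∈ B :=
      fun h1 h2 h3 => hB _ _ _ (StringWord.isConcat_seg e h1 h2 h3)
    have key : ∀ t < e.len, (e.seg 0 t).toStr ∈ B → (e.seg (t + 1) e.len).toStr ∈ B → False := by
      intro t ht h1 h2
      rcases lt_trichotomy t i with hti | rfl | hti
      · -- the violating string could be shortened
        refine hmin (i - (t + 1)) ?_ ⟨(e.seg (t + 1) i).toStr, (e.seg (t + 1) e.len).toStr,
          StringWord.isConcat_seg e hti hi le_rfl, h2, fun h3 => huB (cl (by omega) hti hi.le h1 h3),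
          StringWord.len_seg e _ _ hi.le⟩
        rw [← hun, StringWord.length_toStr, StringWord.len_seg e _ _ hi.le]
        omega
      · exact huB h1
      · refine hB' _ _ _ (StringWord.isConcat_seg e (Nat.zero_le i) hti ht.le) huB ?_ h1
        exact fun h3 => hx _ _ (StringWord.isConcat_seg e hti ht le_rfl) h3 h2
    intro u v huv hu hv
    obtain ⟨t, ht, ⟨rfl, rfl⟩ | ⟨rfl, rfl⟩⟩ := isConcat_toStr_iff.1 huv
    · exact key t ht hu hv
    · exact key t ht hv hu
  · omega

/-- The oriented string `d` is the label of an edge going down from the biclosed set `B`. -/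
structure IsDown (B : Set Q.Str) (d : Q.Lift) : Prop where
  isRem : IsRem B d.str
  good : d.Good true B

/-- An end of an oriented string to the left of one of its letters, or the complementary end,
according to the direction of the letter, is a factor substring. -/
theorem Lift.Good.break_mem {b : Bool} {B : Set Q.Str} {d : Q.Lift} (h : d.Good b B) {t : ℕ}
    {l : (E ⊕ E) × Bool} (hl : d.1.1.letters[t]? = some l) :
    (l.2 = b → d.strSeg 0 t ∈ B) ∧ (l.2 = (!b) → d.strSeg (t + 1) d.len ∈ B) := by
  constructor
  · rintro rfl
    exact h _ _ (isBd_left hl)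
  · intro hb
    have := isBd_right hl
    rw [hb, Bool.not_not] at this
    exact h _ _ this

theorem Lift.isConcat_str (d : Q.Lift) {t : ℕ} (ht : t < d.len) :
    IsConcat (d.strSeg 0 t) (d.strSeg (t + 1) d.len) d.str :=
  Lift.isConcat_str_iff.2 ⟨t, ht, Or.inl ⟨rfl, rfl⟩⟩

theorem Lift.exists_letter (d : Q.Lift) {t : ℕ} (ht : t < d.len) :
    ∃ l, d.1.1.letters[t]? = some l := ⟨_, List.getElem?_eq_getElem ht⟩

/-- The submodule substrings of the label of an edge from `B` down to `B \ {x}` do not lie in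
`B \ {x}`. -/
theorem IsDown.good_false {B : Set Q.Str} {d : Q.Lift} (h : IsDown B d) (hB : IsClosedStr B) :
    d.Good false (B \ {d.str})ᶜ := by
  rintro i j hij ⟨hmem, hne⟩
  obtain ⟨h1, h2, h3, h4⟩ := hij
  change j ≤ d.len at h2
  have hright : j < d.len → d.strSeg 0 j ∉ B := by
    intro hj hm
    obtain ⟨l, hl⟩ := d.exists_letter hj
    exact h.isRem.indec _ _ (d.isConcat_str hj) hm ((h.good.break_mem hl).2 (h3 l hl))
  rcases i with _ | i
  · rcases eq_or_lt_of_le h2 with rfl | hj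
    · exact hne (by rw [Lift.strSeg_whole]; rfl)
    · exact hright hj hmem
  · obtain ⟨l, hl⟩ := d.exists_letter (t := i) (by omega)
    have hleft := (h.good.break_mem hl).1 (h4 i l rfl hl)
    rcases eq_or_lt_of_le h2 with rfl | hj
    · exact h.isRem.indec _ _ (d.isConcat_str (by omega)) hleft hmem
    · exact hright hj (Lift.strSeg_mem_of_closed hB (Nat.zero_le i) (by omega) h2 hleft hmem)

/-- A factor substring of the label of an edge down from `B` which can be removed from `B` is the
whole label. -/
theorem IsDown.eq_whole {B : Set Q.Str} {d : Q.Lift} (h : IsDown B d) {i j : ℕ}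
    (hij : IsBd true d.1 i j) (hrem : IsRem B (d.strSeg i j)) : i = 0 ∧ j = d.len := by
  obtain ⟨h1, h2, h3, h4⟩ := hij
  change j ≤ d.len at h2
  have hj : j = d.len := by
    by_contra hj
    have hj : j < d.len := lt_of_le_of_ne h2 hj
    obtain ⟨l, hl⟩ := d.exists_letter hj
    have hleft := (h.good.break_mem hl).1 (h3 l hl)
    refine h.isRem.indec _ _ (d.isConcat_str hj) hleft
      (hrem.ext _ _ (d.isConcat_strSeg h1 hj le_rfl).symm ?_)
    refine h.good _ _ ⟨by omega, le_rfl, fun l hl => ?_, h4⟩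
    rw [List.getElem?_eq_none le_rfl] at hl
    simp at hl
  refine ⟨?_, hj⟩
  by_contra hi
  obtain ⟨i, rfl⟩ := Nat.exists_eq_succ_of_ne_zero hi
  obtain ⟨l, hl⟩ := d.exists_letter (t := i) (by omega)
  have hright := (h.good.break_mem hl).2 (h4 i l rfl hl)
  refine h.isRem.indec _ _ (d.isConcat_str (by omega))
    (hrem.ext _ _ (d.isConcat_strSeg (Nat.zero_le i) (by omega) h2) ?_) hright
  rw [hj, Lift.strSeg_whole]
  exact h.isRem.mem

end Removable

/-! ### Labels as oriented strings -/

section Labels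

variable {Q : BoundQuiver V E}

theorem take_isString_iff {c : Q.StringWord} {t : ℕ} {D : Set Q.Str} :
    (∃ p : Q.StringWord, p.1 = ⟨c.1.start, c.1.letters.take t⟩ ∧ p.toStr ∈ D) ↔
      (c.seg 0 t).toStr ∈ D := by
  constructor
  · rintro ⟨p, hp, hD⟩
    obtain rfl : p = c.seg 0 t := Subtype.ext hp
    exact hD
  · intro h
    exact ⟨c.seg 0 t, rfl, h⟩

/-- The oriented string `d` represents the label `p` if they have the same underlying string, and
the direct letters of `d` are those before which there is a split belonging to `p`. -/
theorem isStr_iff {p : Q.Label} {d : Q.double.StringWord} :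
    IsStr p d ↔ ∃ e : Q.Lift, e.1 = d ∧ e.str = p.1.1 ∧ ∀ (t : ℕ) (l : (E ⊕ E) × Bool),
      e.1.1.letters[t]? = some l → (l.2 = true ↔ e.strSeg 0 t ∈ p.1.2) := by
  classical
  have key : ∀ (c : Q.StringWord) (D : Set Q.Str), ∃ e : Q.Lift, e.down = c ∧
      e.1.1 = liftWord c D ∧ ∀ (t : ℕ) (l : (E ⊕ E) × Bool),
        e.1.1.letters[t]? = some l → (l.2 = true ↔ e.strSeg 0 t ∈ D) := by
    intro c D
    obtain ⟨e, he, h1, h2⟩ := Lift.exists_lift c fun i => decide (∃ p : Q.StringWord,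
      p.1 = ⟨c.1.start, c.1.letters.take i⟩ ∧ p.toStr ∈ D)
    refine ⟨e, he, ?_, fun t l hl => ?_⟩
    · rw [h1, liftWord]
    · rw [h2 t l hl, decide_eq_true_iff, take_isString_iff, Lift.strSeg, he]
  constructor
  · rintro ⟨c, hc, hd⟩
    obtain ⟨e, he, h1, h2⟩ := key c p.1.2
    exact ⟨e, Subtype.ext (h1.trans hd.symm), by rw [Lift.str, he, hc], h2⟩
  · rintro ⟨e, rfl, h1, h2⟩
    obtain ⟨e', he', h1', h2'⟩ := key e.down p.1.2
    refine ⟨e.down, h1, ?_⟩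
    rw [← h1']
    have : e = e' := by
      refine Lift.ext_of_down he'.symm fun t l m hl hm => ?_
      have hs : e.strSeg 0 t = e'.strSeg 0 t := by rw [Lift.strSeg, Lift.strSeg, he']
      have := (h2 t l hl).trans ((iff_of_eq (by rw [hs])).trans (h2' t m hm).symm)
      exact Bool.eq_iff_iff.2 this
    rw [this]

theorem exists_isStr_of_label (p : Q.Label) : ∃ e : Q.Lift, IsStr p e.1 := by
  classical
  obtain ⟨c, hc⟩ := StringWord.exists_toStr p.1.1
  obtain ⟨e, he, -, h2⟩ := Lift.exists_lift c fun i => decide ((c.seg 0 i).toStr ∈ p.1.2)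
  refine ⟨e, isStr_iff.2 ⟨e, rfl, by rw [Lift.str, he, hc], fun t l hl => ?_⟩⟩
  rw [h2 t l hl, decide_eq_true_iff, Lift.strSeg, he]

theorem IsStr.str_eq {p : Q.Label} {e : Q.Lift} (h : IsStr p e.1) : e.str = p.1.1 := by
  obtain ⟨e', he, h1, -⟩ := isStr_iff.1 h
  rw [← h1, Subtype.ext he]

theorem IsStr.mem_iff {p : Q.Label} {e : Q.Lift} (h : IsStr p e.1) {t : ℕ} {l : (E ⊕ E) × Bool}
    (hl : e.1.1.letters[t]? = some l) : l.2 = true ↔ e.strSeg 0 t ∈ p.1.2 := by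
  obtain ⟨e', he, -, h2⟩ := isStr_iff.1 h
  obtain rfl : e' = e := Subtype.ext he
  exact h2 t l hl

theorem IsStr.label_unique {p p' : Q.Label} {e : Q.Lift} (h : IsStr p e.1) (h' : IsStr p' e.1) :
    p = p' := by
  have hstr : p.1.1 = p'.1.1 := h.str_eq.symm.trans h'.str_eq
  have key : ∀ {p p' : Q.Label}, IsStr p e.1 → IsStr p' e.1 → ∀ u ∈ p.1.2, u ∈ p'.1.2 := by
    intro p p' h h' u hu
    obtain ⟨v, hv⟩ := p.2.1 u hu
    have hv : IsConcat u v e.str := by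
      rw [h.str_eq]
      exact hv.elim id IsConcat.symm
    have hv1 : IsConcat u v p.1.1 := by rw [← h.str_eq]; exact hv
    have hv2 : IsConcat u v p'.1.1 := by rw [← h'.str_eq]; exact hv
    obtain ⟨i, hi, ⟨rfl, rfl⟩ | ⟨rfl, rfl⟩⟩ := Lift.isConcat_str_iff.1 hv
    · obtain ⟨l, hl⟩ := e.exists_letter hi
      exact (h'.mem_iff hl).1 ((h.mem_iff hl).2 hu)
    · obtain ⟨l, hl⟩ := e.exists_letter hi
      rw [p'.2.2 _ _ hv2, ← h'.mem_iff hl, h.mem_iff hl]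
      exact (p.2.2 _ _ hv1).1 hu
  exact Subtype.ext (Prod.ext hstr (Set.Subset.antisymm (key h h') (key h' h)))

theorem IsStr.inv {p : Q.Label} {e : Q.Lift} (he : IsStr p e.1) : IsStr p e.inv.1 := by
  refine isStr_iff.2 ⟨e.inv, rfl, (Lift.str_inv e).trans he.str_eq, fun t l hl => ?_⟩
  have ht : t < e.len := by
    rw [← Lift.len_inv]; exact (List.getElem?_eq_some_iff.1 hl).1
  change e.1.inv.1.letters[t]? = _ at hl
  rw [inv_letters_getElem? _ _ ht] at hl
  obtain ⟨m, hm, rfl⟩ := Option.map_eq_some_iff.1 hl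
  have h1 := he.mem_iff hm
  have h2 := e.isConcat_str (t := e.len - 1 - t) (by omega)
  rw [he.str_eq] at h2
  rw [Lift.strSeg_inv e (Nat.zero_le t) ht.le, Nat.sub_zero,
    show e.len - t = e.len - 1 - t + 1 by omega, p.2.2 _ _ h2.symm, ← h1]
  simp [flip]

/-- Every oriented string represents a label. -/
theorem Thin.exists_label (hQ : Q.Thin) (e : Q.Lift) : ∃ p : Q.Label, IsStr p e.1 := by
  let D : Set Q.Str := {u | ∃ (t : ℕ) (l : (E ⊕ E) × Bool), e.1.1.letters[t]? = some l ∧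
    ((l.2 = true ∧ u = e.strSeg 0 t) ∨ (l.2 = false ∧ u = e.strSeg (t + 1) e.len))}
  have hlt : ∀ {t : ℕ} {l : (E ⊕ E) × Bool}, e.1.1.letters[t]? = some l → t < e.len :=
    fun hl => (List.getElem?_eq_some_iff.1 hl).1
  have hD1 : ∀ {t : ℕ} {l : (E ⊕ E) × Bool}, e.1.1.letters[t]? = some l →
      (e.strSeg 0 t ∈ D ↔ l.2 = true) := by
    intro t l hl
    refine ⟨?_, fun h => ⟨t, l, hl, Or.inl ⟨h, rfl⟩⟩⟩
    rintro ⟨s, m, hm, ⟨h1, h2⟩ | ⟨h1, h2⟩⟩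
    · have := Lift.strSeg_inj hQ (Nat.zero_le _) (hlt hl).le (Nat.zero_le _) (hlt hm).le h2
      obtain rfl : t = s := this.2
      rwa [Option.some.inj (hl.symm.trans hm)]
    · have := Lift.strSeg_inj hQ (Nat.zero_le _) (hlt hl).le (hlt hm) le_rfl h2
      omega
  have hD2 : ∀ {t : ℕ} {l : (E ⊕ E) × Bool}, e.1.1.letters[t]? = some l →
      (e.strSeg (t + 1) e.len ∈ D ↔ l.2 = false) := by
    intro t l hl
    refine ⟨?_, fun h => ⟨t, l, hl, Or.inr ⟨h, rfl⟩⟩⟩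
    rintro ⟨s, m, hm, ⟨h1, h2⟩ | ⟨h1, h2⟩⟩
    · have := Lift.strSeg_inj hQ (hlt hl) le_rfl (Nat.zero_le _) (hlt hm).le h2
      omega
    · have := Lift.strSeg_inj hQ (hlt hl) le_rfl (hlt hm) le_rfl h2
      obtain rfl : t = s := by omega
      rwa [Option.some.inj (hl.symm.trans hm)]
  refine ⟨⟨(e.str, D), ?_, ?_⟩, isStr_iff.2 ⟨e, rfl, rfl, fun t l hl => (hD1 hl).symm⟩⟩
  · rintro u ⟨t, l, hl, ⟨-, rfl⟩ | ⟨-, rfl⟩⟩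
    · exact ⟨_, Or.inl (e.isConcat_str (hlt hl))⟩
    · exact ⟨_, Or.inr (e.isConcat_str (hlt hl))⟩
  · intro u v huv
    obtain ⟨i, hi, ⟨rfl, rfl⟩ | ⟨rfl, rfl⟩⟩ := Lift.isConcat_str_iff.1 huv
    · obtain ⟨l, hl⟩ := e.exists_letter hi
      change e.strSeg 0 i ∈ D ↔ e.strSeg (i + 1) e.len ∉ D
      rw [hD1 hl, hD2 hl]; simp
    · obtain ⟨l, hl⟩ := e.exists_letter hi
      change e.strSeg (i + 1) e.len ∈ D ↔ e.strSeg 0 i ∉ D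
      rw [hD1 hl, hD2 hl]; simp

/-- The orientation given by the label of an edge of the poset of biclosed sets. -/
theorem HasLabel.isDown {C B : Q.Bic} {p : Q.Label} (h : HasLabel C B p) {e : Q.Lift}
    (he : IsStr p e.1) : IsDown B.1 e ∧ C.1 = B.1 \ {e.str} := by
  obtain ⟨hcov, hnot, hins, hD⟩ := h
  rw [← he.str_eq] at hnot hins hD
  have hC : C.1 = B.1 \ {e.str} := by
    rw [hins]
    ext u
    simp only [Set.mem_sdiff, Set.mem_insert_iff, Set.mem_singleton_iff]
    constructor
    · intro hu
      exact ⟨Or.inr hu, fun h => hnot (h ▸ hu)⟩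
    · rintro ⟨rfl | hu, h⟩
      · exact absurd rfl h
      · exact hu
  have hmem : e.str ∈ B.1 := by rw [hins]; exact Set.mem_insert _ _
  refine ⟨⟨isRem_of_biclosed hmem (hC ▸ C.2.1) (hC ▸ C.2.2), fun i j hij => ?_⟩, hC⟩
  obtain ⟨h1, h2, h3, h4⟩ := hij
  change j ≤ e.len at h2
  have hleft : e.strSeg 0 j ∈ B.1 := by
    rcases eq_or_lt_of_le h2 with rfl | hj
    · rw [Lift.strSeg_whole]; exact hmem
    · obtain ⟨l, hl⟩ := e.exists_letter hj
      have := (he.mem_iff hl).1 (h3 l hl)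
      rw [hD] at this
      rw [hins]
      exact Set.mem_insert_of_mem _ this.2
  rcases i with _ | i
  · exact hleft
  · refine (Lift.strSeg_mem_of_coclosed B.2.2 (Nat.zero_le i) h1 h2 hleft).resolve_left fun hm => ?_
    obtain ⟨l, hl⟩ := e.exists_letter (t := i) (by omega)
    have hcon := e.isConcat_str (t := i) (by omega)
    have hmC : e.strSeg 0 i ∈ C.1 := by rw [hC]; exact ⟨hm, hcon.left_ne⟩
    have : e.strSeg 0 i ∈ p.1.2 := by
      rw [hD]; exact ⟨⟨_, Or.inl hcon⟩, hmC⟩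
    rw [← he.mem_iff hl, h4 i l rfl hl] at this
    simp at this

/-- The biclosed set obtained by removing a removable string. -/
def Bic.erase (hQ : Q.Thin) (B : Q.Bic) {x : Q.Str} (h : IsRem B.1 x) : Q.Bic :=
  ⟨B.1 \ {x}, h.isClosed B.2.1, h.isCoclosed hQ B.2.2⟩

theorem Bic.erase_covBy (hQ : Q.Thin) (B : Q.Bic) {x : Q.Str} (h : IsRem B.1 x) :
    B.erase hQ h ⋖ B := by
  have hle : B.erase hQ h ≤ B := fun u hu => hu.1
  refine ⟨lt_of_le_not_ge hle fun h' => (h' h.mem).2 rfl, fun C h1 h2 => ?_⟩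
  have h1' : B.1 \ {x} ⊆ C.1 := h1.le
  have h2' : C.1 ⊆ B.1 := h2.le
  by_cases hx : x ∈ C.1
  · refine h2.not_ge fun u hu => ?_
    by_cases hux : u = x
    · rw [hux]; exact hx
    · exact h1' ⟨hu, hux⟩
  · refine h1.not_ge fun u hu => ⟨h2' hu, ?_⟩
    rintro rfl
    exact hx hu

/-- The edges down from a biclosed set remove one string. -/
theorem Bic.exists_of_covBy [Fintype V] (hQ : Q.Thin) {B C : Q.Bic} (h : C ⋖ B) :
    ∃ (x : Q.Str) (hx : IsRem B.1 x), C = B.erase hQ hx := by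
  have hle : C.1 ⊆ B.1 := h.lt.le
  have hne : ∃ x ∈ B.1, x ∉ C.1 := by
    by_contra hcon
    push Not at hcon
    exact h.lt.not_ge hcon
  obtain ⟨x, hxC, hx⟩ := exists_isRem hQ B.2.1 B.2.2 C.2.1 C.2.2 hle hne
  refine ⟨x, hx, ?_⟩
  have h1 : C ≤ B.erase hQ hx := fun u hu => ⟨hle hu, by rintro rfl; exact hxC hu⟩
  rcases h.eq_or_eq h1 (B.erase_covBy hQ hx).lt.le with h2 | h2
  · exact h2.symm
  · exact absurd h2 (B.erase_covBy hQ hx).lt.ne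

theorem IsDown.exists_hasLabel (hQ : Q.Thin) {B : Q.Bic} {e : Q.Lift} (h : IsDown B.1 e) :
    ∃ p : Q.Label, IsStr p e.1 ∧ HasLabel (B.erase hQ h.isRem) B p := by
  set D : Set Q.Str := {u | IsSplit u e.str ∧ u ∈ (B.erase hQ h.isRem).1} with hD
  have hDmem : ∀ {u v}, IsConcat u v e.str → (u ∈ D ↔ u ∈ B.1) := fun huv =>
    ⟨fun hu => hu.2.1, fun hu => ⟨⟨_, Or.inl huv⟩, hu, huv.left_ne⟩⟩
  have hxor : ∀ {u v}, IsConcat u v e.str → (u ∈ B.1 ↔ v ∉ B.1) := by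
    intro u v huv
    refine ⟨h.isRem.indec u v huv, fun hv => ?_⟩
    by_contra hu
    exact B.2.2 u v _ huv hu hv h.isRem.mem
  refine ⟨⟨(e.str, D), fun u hu => hu.1, fun u v huv => ?_⟩, ?_, ?_⟩
  · change u ∈ D ↔ v ∉ D
    rw [hDmem huv, hDmem huv.symm, hxor huv]
  · refine isStr_iff.2 ⟨e, rfl, rfl, fun t l hl => ?_⟩
    have ht : t < e.len := (List.getElem?_eq_some_iff.1 hl).1
    have hcon := e.isConcat_str ht
    change _ ↔ _ ∈ D
    rw [hDmem hcon]
    refine ⟨(h.good.break_mem hl).1, fun hm => ?_⟩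
    by_contra hl2
    exact (hxor hcon).1 hm ((h.good.break_mem hl).2 (by simpa using hl2))
  · refine ⟨B.erase_covBy hQ h.isRem, fun hm => hm.2 rfl, ?_, rfl⟩
    change B.1 = insert e.str (B.1 \ {e.str})
    rw [Set.insert_sdiff_singleton, Set.insert_eq_of_mem h.isRem.mem]

end Labels

end BoundQuiver

/-! ### Torsion classes and wide subcategories in terms of linear maps -/

namespace Shadow

variable {Λ : Type w} [Ring Λ]

theorem epi_of_surjective {X Y : ModuleCat.{u} Λ} (f : X →ₗ[Λ] Y) (hf : Function.Surjective f) :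
    Epi (ModuleCat.ofHom f : X ⟶ Y) :=
  (ModuleCat.epi_iff_surjective _).2 hf

theorem prop_of_exact (T : ObjectProperty (ModuleCat.{u} Λ)) (hT : T.IsClosedUnderExtensions)
    {X Y Z : ModuleCat.{u} Λ} (f : X →ₗ[Λ] Y) (g : Y →ₗ[Λ] Z) (hf : Function.Injective f)
    (hg : Function.Surjective g) (hfg : Function.Exact f g) (hX : T X) (hZ : T Z) : T Y := by
  let S : ShortComplex (ModuleCat.{u} Λ) :=
    ⟨(ModuleCat.ofHom f : X ⟶ Y), (ModuleCat.ofHom g : Y ⟶ Z),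
      ModuleCat.hom_ext hfg.linearMap_comp_eq_zero⟩
  have hS : S.ShortExact := ModuleCat.shortComplex_shortExact S hfg hf hg
  exact T.prop_X₂_of_shortExact hS hX hZ

theorem isClosedUnderExtensions_of_exact (T : ObjectProperty (ModuleCat.{u} Λ))
    (hT : ∀ ⦃X Y Z : ModuleCat.{u} Λ⦄ (f : X →ₗ[Λ] Y) (g : Y →ₗ[Λ] Z), Function.Injective f →
      Function.Surjective g → Function.Exact f g → T X → T Z → T Y) :
    T.IsClosedUnderExtensions where
  prop_X₂_of_shortExact {S} hS h₁ h₃ :=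
    hT S.f.hom S.g.hom hS.moduleCat_injective_f hS.moduleCat_surjective_g
      ((ShortComplex.ShortExact.moduleCat_exact_iff_function_exact S).1 hS.exact) h₁ h₃

theorem isZero_iff {X : ModuleCat.{u} Λ} : IsZero X ↔ Subsingleton X := by
  constructor
  · intro h
    exact ModuleCat.subsingleton_of_isZero h
  · intro h
    exact ModuleCat.isZero_of_subsingleton X

theorem finite_of_exact {X Y Z : ModuleCat.{u} Λ} (f : X →ₗ[Λ] Y) (g : Y →ₗ[Λ] Z)
    (hg : Function.Surjective g) (hfg : Function.Exact f g)
    (hX : Module.Finite Λ X) (hZ : Module.Finite Λ Z) : Module.Finite Λ Y := by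
  have h1 : Module.Finite Λ (LinearMap.range f) := Module.Finite.range f
  rw [← LinearMap.exact_iff.1 hfg] at h1
  have h2 : Module.Finite Λ (Y ⧸ LinearMap.ker g) :=
    Module.Finite.equiv (g.quotKerEquivOfSurjective hg).symm
  exact Module.Finite.of_submodule_quotient (LinearMap.ker g)

theorem exists_lift_of_exact {X Y Z W : Type*} [AddCommGroup X] [AddCommGroup Y] [AddCommGroup Z]
    [AddCommGroup W] [Module Λ X] [Module Λ Y] [Module Λ Z] [Module Λ W]
    {f : X →ₗ[Λ] Y} {g : Y →ₗ[Λ] Z} (hf : Function.Injective f)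
    (hfg : Function.Exact f g) (h : W →ₗ[Λ] Y) (hgh : ∀ x, g (h x) = 0) :
    ∃ h' : W →ₗ[Λ] X, ∀ x, f (h' x) = h x := by
  have h1 : ∀ x, h x ∈ LinearMap.range f := fun x => (hfg (h x)).1 (hgh x)
  refine ⟨(LinearEquiv.ofInjective f hf).symm.toLinearMap ∘ₗ h.codRestrict _ h1, fun x => ?_⟩
  have := LinearEquiv.apply_symm_apply (LinearEquiv.ofInjective f hf) (h.codRestrict _ h1 x)
  exact congrArg Subtype.val this

theorem exists_desc_of_exact {X Y Z W : Type*} [AddCommGroup X] [AddCommGroup Y] [AddCommGroup Z]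
    [AddCommGroup W] [Module Λ X] [Module Λ Y] [Module Λ Z] [Module Λ W]
    {f : X →ₗ[Λ] Y} {g : Y →ₗ[Λ] Z} (hg : Function.Surjective g)
    (hfg : Function.Exact f g) (h : Y →ₗ[Λ] W) (hhf : ∀ x, h (f x) = 0) :
    ∃ h' : Z →ₗ[Λ] W, ∀ y, h' (g y) = h y := by
  have h1 : LinearMap.ker g ≤ LinearMap.ker h := by
    intro y hy
    obtain ⟨x, rfl⟩ := (hfg y).1 hy
    exact hhf x
  refine ⟨(LinearMap.ker g).liftQ h h1 ∘ₗ (g.quotKerEquivOfSurjective hg).symm.toLinearMap,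
    fun y => ?_⟩
  have : (g.quotKerEquivOfSurjective hg).symm (g y) = (LinearMap.ker g).mkQ y := by
    rw [LinearEquiv.symm_apply_eq]; rfl
  simp [this]

namespace IsTorsionClass

variable {T : ObjectProperty (ModuleCat.{u} Λ)}

theorem of_surjective (hT : IsTorsionClass T) {X Y : ModuleCat.{u} Λ} (f : X →ₗ[Λ] Y)
    (hf : Function.Surjective f) (hX : T X) : T Y := by
  have := hT.quotients
  have := epi_of_surjective f hf
  exact T.prop_of_epi (ModuleCat.ofHom f : X ⟶ Y) hX

theorem congr (hT : IsTorsionClass T) {X Y : ModuleCat.{u} Λ} (e : X ≃ₗ[Λ] Y) (hX : T X) : T Y :=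
  hT.of_surjective e.toLinearMap e.surjective hX

theorem of_exact (hT : IsTorsionClass T) {X Y Z : ModuleCat.{u} Λ} (f : X →ₗ[Λ] Y)
    (g : Y →ₗ[Λ] Z) (hf : Function.Injective f) (hg : Function.Surjective g)
    (hfg : Function.Exact f g) (hX : T X) (hZ : T Z) : T Y :=
  prop_of_exact T hT.extensions f g hf hg hfg hX hZ

theorem of_subsingleton (hT : IsTorsionClass T) {X : ModuleCat.{u} Λ} (hX : Subsingleton X) :
    T X := by
  obtain ⟨Z, -, hZ⟩ := hT.zero.exists_zero
  exact hT.of_surjective (0 : Z →ₗ[Λ] X) (fun x => ⟨0, Subsingleton.elim _ _⟩) hZ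

theorem of_linear (hfin : ∀ X, T X → Module.Finite Λ X)
    (hzero : ∀ X : ModuleCat.{u} Λ, Subsingleton X → T X)
    (hquot : ∀ ⦃X Y : ModuleCat.{u} Λ⦄ (f : X →ₗ[Λ] Y), Function.Surjective f → T X → T Y)
    (hext : ∀ ⦃X Y Z : ModuleCat.{u} Λ⦄ (f : X →ₗ[Λ] Y) (g : Y →ₗ[Λ] Z), Function.Injective f →
      Function.Surjective g → Function.Exact f g → T X → T Z → T Y) : IsTorsionClass T where
  finite := hfin
  zero := ⟨ModuleCat.of Λ PUnit, isZero_iff.2 (inferInstanceAs (Subsingleton PUnit)),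
    hzero _ (inferInstanceAs (Subsingleton PUnit))⟩
  quotients := ⟨fun f _ hX => hquot f.hom ((ModuleCat.epi_iff_surjective f).1 inferInstance) hX⟩
  extensions := isClosedUnderExtensions_of_exact T hext

theorem inf {T' : ObjectProperty (ModuleCat.{u} Λ)} (hT : IsTorsionClass T)
    (hT' : IsTorsionClass T') : IsTorsionClass (T ⊓ T') :=
  of_linear (fun X hX => hT.finite X hX.1)
    (fun _ hX => ⟨hT.of_subsingleton hX, hT'.of_subsingleton hX⟩)
    (fun _ _ f hf hX => ⟨hT.of_surjective f hf hX.1, hT'.of_surjective f hf hX.2⟩)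
    (fun _ _ _ f g hf hg hfg hX hZ =>
      ⟨hT.of_exact f g hf hg hfg hX.1 hZ.1, hT'.of_exact f g hf hg hfg hX.2 hZ.2⟩)

end IsTorsionClass

/-- The finitely generated modules without nonzero maps to the objects of `P`. -/
def perp (P : ObjectProperty (ModuleCat.{u} Λ)) : ObjectProperty (ModuleCat.{u} Λ) := fun X =>
  Module.Finite Λ X ∧ ∀ Y, P Y → ∀ f : X →ₗ[Λ] Y, f = 0

theorem isTorsionClass_perp (P : ObjectProperty (ModuleCat.{u} Λ)) : IsTorsionClass (perp P) := by
  refine .of_linear (fun X hX => hX.1) ?_ ?_ ?_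
  · intro X hX
    refine ⟨inferInstance, fun Y _ f => LinearMap.ext fun x => ?_⟩
    rw [Subsingleton.elim x 0, map_zero, map_zero]
  · intro X Y f hf hX
    have := hX.1
    refine ⟨Module.Finite.of_surjective f hf, fun Z hZ g => LinearMap.ext fun y => ?_⟩
    obtain ⟨x, rfl⟩ := hf y
    exact DFunLike.congr_fun (hX.2 Z hZ (g ∘ₗ f)) x
  · intro X Y Z f g hf hg hfg hX hZ
    refine ⟨finite_of_exact f g hg hfg hX.1 hZ.1, fun W hW h => ?_⟩
    obtain ⟨h', hh'⟩ := exists_desc_of_exact hg hfg h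
      (fun x => DFunLike.congr_fun (hX.2 W hW (h ∘ₗ f)) x)
    ext y
    rw [← hh' y, hZ.2 W hW h']
    rfl

theorem isTorsionClass_finite :
    IsTorsionClass (fun X : ModuleCat.{u} Λ => Module.Finite Λ X) := by
  refine .of_linear (fun X hX => hX) ?_ ?_ ?_
  · intro X hX
    infer_instance
  · intro X Y f hf hX
    exact Module.Finite.of_surjective f hf
  · intro X Y Z f g hf hg hfg hX hZ
    exact finite_of_exact f g hg hfg hX hZ

theorem isTorsionClass_torsionClosure {P : ObjectProperty (ModuleCat.{u} Λ)}
    (hP : ∀ X, P X → Module.Finite Λ X) : IsTorsionClass (torsionClosure P) := by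
  refine .of_linear (fun X hX => hX _ isTorsionClass_finite hP) ?_ ?_ ?_
  · intro X hX T hT _
    exact hT.of_subsingleton hX
  · intro X Y f hf hX T hT hPT
    exact hT.of_surjective f hf (hX T hT hPT)
  · intro X Y Z f g hf hg hfg hX hZ T hT hPT
    exact hT.of_exact f g hf hg hfg (hX T hT hPT) (hZ T hT hPT)

theorem le_torsionClosure (P : ObjectProperty (ModuleCat.{u} Λ)) : P ≤ torsionClosure P :=
  fun X hX _ _ hPT => hPT X hX

/-- A nonzero object of the torsion class generated by `P` receives a nonzero map from an object
of `P`, because the objects of this class without maps to `X` form a torsion class. -/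
theorem exists_ne_zero_of_torsionClosure {P : ObjectProperty (ModuleCat.{u} Λ)}
    (hP : ∀ X, P X → Module.Finite Λ X) {X : ModuleCat.{u} Λ} (hX : torsionClosure P X)
    (h0 : Nontrivial X) : ∃ Y, P Y ∧ ∃ f : Y →ₗ[Λ] X, f ≠ 0 := by
  by_contra hcon
  push Not at hcon
  have h1 : P ≤ perp (fun Y => Y = X) := by
    intro Y hY
    refine ⟨hP Y hY, ?_⟩
    rintro _ rfl f
    exact hcon Y hY f
  have h2 := (hX _ (isTorsionClass_perp _) h1).2 X rfl LinearMap.id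
  obtain ⟨x, hx⟩ := exists_ne (0 : X)
  exact hx (DFunLike.congr_fun h2 x)

namespace IsWide

variable {T : ObjectProperty (ModuleCat.{u} Λ)}

theorem of_exact (hT : IsWide T) {X Y Z : ModuleCat.{u} Λ} (f : X →ₗ[Λ] Y)
    (g : Y →ₗ[Λ] Z) (hf : Function.Injective f) (hg : Function.Surjective g)
    (hfg : Function.Exact f g) (hX : T X) (hZ : T Z) : T Y :=
  prop_of_exact T hT.extensions f g hf hg hfg hX hZ

theorem of_exact_left (hT : IsWide T) {X Y Z : ModuleCat.{u} Λ} (f : X →ₗ[Λ] Y)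
    (g : Y →ₗ[Λ] Z) (hf : Function.Injective f) (hfg : Function.Exact f g) (hY : T Y)
    (hZ : T Z) : T X := by
  have := hT.kernels
  exact T.prop_of_isLimit_kernelFork
    (ModuleCat.isLimitKernelFork (ModuleCat.ofHom f : X ⟶ Y) (ModuleCat.ofHom g : Y ⟶ Z) hfg hf)
    hY hZ

theorem of_exact_right (hT : IsWide T) {X Y Z : ModuleCat.{u} Λ} (f : X →ₗ[Λ] Y)
    (g : Y →ₗ[Λ] Z) (hg : Function.Surjective g) (hfg : Function.Exact f g) (hX : T X)
    (hY : T Y) : T Z := by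
  have := hT.cokernels
  exact T.prop_of_isColimit_cokernelCofork
    (ModuleCat.isColimitCokernelCofork (ModuleCat.ofHom f : X ⟶ Y) (ModuleCat.ofHom g : Y ⟶ Z)
      hfg hg) hX hY

theorem congr (hT : IsWide T) {X Y : ModuleCat.{u} Λ} (e : X ≃ₗ[Λ] Y) (hX : T X) : T Y := by
  refine hT.of_exact_right (0 : X →ₗ[Λ] X) e.toLinearMap e.surjective ?_ hX hX
  intro x
  exact e.map_eq_zero_iff.trans ⟨fun h => ⟨0, h.symm⟩, fun ⟨_, h⟩ => h.symm⟩

theorem of_subsingleton (hT : IsWide T) {X : ModuleCat.{u} Λ} (hX : Subsingleton X) : T X := by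
  obtain ⟨Z, hZ, hZT⟩ := hT.zero.exists_zero
  have := isZero_iff.1 hZ
  exact hT.congr (LinearEquiv.ofBijective (0 : Z →ₗ[Λ] X)
    ⟨fun _ _ _ => Subsingleton.elim _ _, fun x => ⟨0, Subsingleton.elim _ _⟩⟩) hZT

theorem ker (hT : IsWide T) {X Y : ModuleCat.{u} Λ} (f : X →ₗ[Λ] Y) (hX : T X) (hY : T Y) :
    T (ModuleCat.of Λ (LinearMap.ker f)) :=
  hT.of_exact_left (X := ModuleCat.of Λ (LinearMap.ker f)) (LinearMap.ker f).subtype f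
    Subtype.val_injective (LinearMap.exact_subtype_ker_map f) hX hY

theorem coker (hT : IsWide T) {X Y : ModuleCat.{u} Λ} (f : X →ₗ[Λ] Y) (hX : T X) (hY : T Y) :
    T (ModuleCat.of Λ (Y ⧸ LinearMap.range f)) :=
  hT.of_exact_right (Z := ModuleCat.of Λ (Y ⧸ LinearMap.range f)) f (LinearMap.range f).mkQ
    (Submodule.mkQ_surjective _) (LinearMap.exact_map_mkQ_range f) hX hY

/-- Wide subcategories are closed under direct summands: a summand is the kernel of the projection
to a complement. -/
theorem of_retract (hT : IsWide T) {X Y : ModuleCat.{u} Λ} (i : X →ₗ[Λ] Y) (r : Y →ₗ[Λ] X)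
    (hir : ∀ x, r (i x) = x) (hY : T Y) : T X := by
  refine hT.of_exact_left i (LinearMap.id - i ∘ₗ r) (Function.LeftInverse.injective hir) ?_ hY hY
  intro y
  constructor
  · intro h
    exact ⟨r y, (sub_eq_zero.1 h).symm⟩
  · rintro ⟨x, rfl⟩
    simp [hir]

/-- The image of a map is the kernel of the projection to the cokernel. -/
theorem range (hT : IsWide T) {X Y Z : ModuleCat.{u} Λ} (g : X →ₗ[Λ] Z) (f : Z →ₗ[Λ] Y)
    (hg : Function.Surjective g) (hf : Function.Injective f) (hX : T X) (hY : T Y) : T Z := by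
  refine hT.of_exact_left f (LinearMap.range (f ∘ₗ g)).mkQ
    (Z := ModuleCat.of Λ (Y ⧸ LinearMap.range (f ∘ₗ g))) hf ?_ hY (hT.coker (f ∘ₗ g) hX hY)
  intro y
  rw [Submodule.mkQ_apply, Submodule.Quotient.mk_eq_zero]
  constructor
  · rintro ⟨x, rfl⟩
    exact ⟨g x, rfl⟩
  · rintro ⟨z, rfl⟩
    obtain ⟨x, rfl⟩ := hg z
    exact ⟨x, rfl⟩

theorem of_linear (hfin : ∀ X, T X → Module.Finite Λ X)
    (hzero : ∀ X : ModuleCat.{u} Λ, Subsingleton X → T X)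
    (hequiv : ∀ ⦃X Y : ModuleCat.{u} Λ⦄, (X ≃ₗ[Λ] Y) → T X → T Y)
    (hker : ∀ ⦃X Y : ModuleCat.{u} Λ⦄ (f : X →ₗ[Λ] Y), T X → T Y →
      T (ModuleCat.of Λ (LinearMap.ker f)))
    (hcoker : ∀ ⦃X Y : ModuleCat.{u} Λ⦄ (f : X →ₗ[Λ] Y), T X → T Y →
      T (ModuleCat.of Λ (Y ⧸ LinearMap.range f)))
    (hext : ∀ ⦃X Y Z : ModuleCat.{u} Λ⦄ (f : X →ₗ[Λ] Y) (g : Y →ₗ[Λ] Z), Function.Injective f →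
      Function.Surjective g → Function.Exact f g → T X → T Z → T Y) : IsWide T where
  finite := hfin
  zero := ⟨ModuleCat.of Λ PUnit, isZero_iff.2 (inferInstanceAs (Subsingleton PUnit)),
    hzero _ (inferInstanceAs (Subsingleton PUnit))⟩
  kernels := ⟨by
    intro _ ⟨f, k, hk, hf⟩
    exact hequiv ((ModuleCat.kernelIsLimit f).conePointUniqueUpToIso hk).toLinearEquiv
      (hker f.hom hf.1 hf.2)⟩
  cokernels := ⟨by
    intro _ ⟨f, k, hk, hf⟩
    exact hequiv ((ModuleCat.cokernelIsColimit f).coconePointUniqueUpToIso hk).toLinearEquiv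
      (hcoker f.hom hf.1 hf.2)⟩
  extensions := isClosedUnderExtensions_of_exact T hext

/-- If `q : B → L` is a cokernel of `a : A → B` and factors as `p b` through `b : B → D`, then `L` is
a direct summand of the cokernel of `b a`. -/
theorem of_quotient_step (hT : IsWide T) {A B D L : ModuleCat.{u} Λ}
    (a : A →ₗ[Λ] B) (b : B →ₗ[Λ] D) (p : D →ₗ[Λ] L) (q : B →ₗ[Λ] L)
    (hq : Function.Surjective q) (haq : Function.Exact a q) (hpb : ∀ x, p (b x) = q x)
    (hA : T A) (hD : T D) : T L := by
  let R := LinearMap.range (b ∘ₗ a)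
  have hC : T (ModuleCat.of Λ (D ⧸ R)) := hT.coker (b ∘ₗ a) hA hD
  obtain ⟨p', hp'⟩ := exists_desc_of_exact R.mkQ_surjective (LinearMap.exact_map_mkQ_range _) p
    (fun x => (hpb (a x)).trans (haq.apply_apply_eq_zero x))
  obtain ⟨s, hs⟩ := exists_desc_of_exact hq haq (R.mkQ ∘ₗ b)
    (fun x => (Submodule.Quotient.mk_eq_zero R).2 ⟨x, rfl⟩)
  refine hT.of_retract (Y := ModuleCat.of Λ (D ⧸ R)) s p' (fun y => ?_) hC
  obtain ⟨x, rfl⟩ := hq y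
  rw [hs]
  exact (hp' (b x)).trans (hpb x)

/-- If `q : L → B` is a kernel of `a : B → A` and factors as `b p` through `b : D → B`, then `L` is a
direct summand of the kernel of `a b`. -/
theorem of_sub_step (hT : IsWide T) {A B D L : ModuleCat.{u} Λ}
    (a : B →ₗ[Λ] A) (b : D →ₗ[Λ] B) (p : L →ₗ[Λ] D) (q : L →ₗ[Λ] B)
    (hq : Function.Injective q) (hqa : Function.Exact q a) (hbp : ∀ x, b (p x) = q x)
    (hA : T A) (hD : T D) : T L := by
  have hK := hT.ker (a ∘ₗ b) hD hA
  obtain ⟨r, hr⟩ := exists_lift_of_exact hq hqa (b ∘ₗ (LinearMap.ker (a ∘ₗ b)).subtype)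
    (fun x => x.2)
  have hp : ∀ x, p x ∈ LinearMap.ker (a ∘ₗ b) := by
    intro x
    rw [LinearMap.mem_ker, LinearMap.comp_apply, hbp]
    exact hqa.apply_apply_eq_zero x
  refine hT.of_retract (Y := ModuleCat.of Λ (LinearMap.ker (a ∘ₗ b))) (p.codRestrict _ hp) r
    (fun x => hq ?_) hK
  exact (hr _).trans (hbp x)

/-- If `Y` is a quotient of a Noetherian object `X` of a wide subcategory by a submodule lying in
the torsion class generated by some objects of the subcategory, then `Y` lies in it as well:
a maximal submodule of the kernel with quotient in the subcategory is the whole kernel. -/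
theorem of_torsion_ker (hT : IsWide T) {P : ObjectProperty (ModuleCat.{u} Λ)} (hPT : P ≤ T)
    {X Y : ModuleCat.{u} Λ} [IsNoetherian Λ X] (f : X →ₗ[Λ] Y) (hf : Function.Surjective f)
    (hX : T X) (hN : torsionClosure P (ModuleCat.of Λ (LinearMap.ker f))) : T Y := by
  have hPfin : ∀ Z, P Z → Module.Finite Λ Z := fun Z hZ => hT.finite Z (hPT Z hZ)
  have htors := isTorsionClass_torsionClosure hPfin
  let 𝒮 : Set (Submodule Λ X) :=
    {N | N ≤ LinearMap.ker f ∧ T (ModuleCat.of Λ (X ⧸ N))}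
  have h𝒮 : 𝒮.Nonempty :=
    ⟨⊥, bot_le, hT.congr (Y := ModuleCat.of Λ (X ⧸ (⊥ : Submodule Λ X)))
      (Submodule.quotEquivOfEqBot _ rfl).symm hX⟩
  obtain ⟨N, ⟨hNf, hNT⟩, hmax⟩ := exists_maximal_of_wellFoundedGT (· ∈ 𝒮) h𝒮
  by_cases hNk : N = LinearMap.ker f
  · subst hNk
    exact hT.congr (X := ModuleCat.of Λ (X ⧸ LinearMap.ker f)) (f.quotKerEquivOfSurjective hf) hNT
  exfalso
  let K : Submodule Λ (X ⧸ N) := (LinearMap.ker f).map N.mkQ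
  have hK : torsionClosure P (ModuleCat.of Λ K) := by
    refine htors.of_surjective (X := ModuleCat.of Λ (LinearMap.ker f))
      (N.mkQ.submoduleMap (LinearMap.ker f)) ?_ hN
    exact LinearMap.submoduleMap_surjective _ _
  have hK0 : Nontrivial K := by
    rw [Submodule.nontrivial_iff_ne_bot]
    intro h
    apply hNk
    refine le_antisymm hNf fun x hx => ?_
    have : N.mkQ x ∈ K := Submodule.mem_map_of_mem hx
    rw [h] at this
    exact (Submodule.Quotient.mk_eq_zero N).1 this
  obtain ⟨Z, hZ, g, hg⟩ := exists_ne_zero_of_torsionClosure hPfin hK hK0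
  let g' : Z →ₗ[Λ] (X ⧸ N) := K.subtype ∘ₗ g
  let N' : Submodule Λ X := (LinearMap.range g').comap N.mkQ
  have h1 : N' ∈ 𝒮 := by
    constructor
    · intro x hx
      obtain ⟨z, hz⟩ := hx
      obtain ⟨y, hy, hyx⟩ := (g z).2
      have h3 : x - y ∈ N := by
        rw [← Submodule.Quotient.mk_eq_zero, Submodule.Quotient.mk_sub, sub_eq_zero]
        exact hz.symm.trans hyx.symm
      have := add_mem (hNf h3) hy
      simpa using this
    · refine hT.of_exact_right (X := Z) (Y := ModuleCat.of Λ (X ⧸ N))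
        (Z := ModuleCat.of Λ (X ⧸ N')) g'
        (N.liftQ N'.mkQ ?_) ?_ ?_ (hPT Z hZ) hNT
      · intro x hx
        rw [LinearMap.mem_ker, Submodule.mkQ_apply, Submodule.Quotient.mk_eq_zero]
        refine ⟨0, ?_⟩
        rw [map_zero]
        exact ((Submodule.Quotient.mk_eq_zero N).2 hx).symm
      · intro y
        obtain ⟨x, rfl⟩ := N'.mkQ_surjective y
        exact ⟨N.mkQ x, by simp⟩
      · intro y
        obtain ⟨x, rfl⟩ := N.mkQ_surjective y
        change N'.mkQ x = 0 ↔ _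
        rw [Submodule.mkQ_apply, Submodule.Quotient.mk_eq_zero]
        rfl
  have h2 : N ≤ N' := by
    intro x hx
    refine ⟨0, ?_⟩
    rw [map_zero]
    exact ((Submodule.Quotient.mk_eq_zero N).2 hx).symm
  have h3 := hmax h1 h2
  apply hg
  ext z
  obtain ⟨x, hx⟩ := N.mkQ_surjective (g' z)
  have hx' : x ∈ N := h3 ⟨z, hx.symm⟩
  have : g' z = 0 := hx.symm.trans ((Submodule.Quotient.mk_eq_zero N).2 hx')
  exact this

end IsWide

end Shadow

/-! ### Iterated extensions of a semibrick -/

namespace Shadow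

variable {Λ : Type w} [Ring Λ]

/-- `S` is a semibrick: every nonzero map between objects of `S` is bijective. -/
def IsSemibrick (S : ObjectProperty (ModuleCat.{u} Λ)) : Prop :=
  ∀ X Y, S X → S Y → ∀ f : X →ₗ[Λ] Y, f ≠ 0 → Function.Bijective f

/-- The modules with a finite filtration whose subquotients lie in `S`. -/
inductive Filt (S : ObjectProperty (ModuleCat.{u} Λ)) : ObjectProperty (ModuleCat.{u} Λ)
  | zero (X : ModuleCat.{u} Λ) (h : Subsingleton X) : Filt S X
  | ext (X Y Z : ModuleCat.{u} Λ) (f : X →ₗ[Λ] Y) (g : Y →ₗ[Λ] Z) (hf : Function.Injective f)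
      (hg : Function.Surjective g) (hfg : Function.Exact f g) (hX : S X) (hZ : Filt S Z) : Filt S Y

namespace Filt

variable {S : ObjectProperty (ModuleCat.{u} Λ)}

theorem congr {X Y : ModuleCat.{u} Λ} (e : X ≃ₗ[Λ] Y) (hX : Filt S X) : Filt S Y := by
  cases hX with
  | zero _ h => exact .zero _ e.symm.toEquiv.subsingleton
  | ext A _ Z f g hf hg hfg hA hZ =>
    refine .ext A Y Z (e.toLinearMap ∘ₗ f) (g ∘ₗ e.symm.toLinearMap) (e.injective.comp hf)
      (hg.comp e.symm.surjective) ?_ hA hZ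
    intro y
    refine (hfg (e.symm y)).trans ⟨?_, ?_⟩
    · rintro ⟨x, hx⟩
      exact ⟨x, by simp [hx]⟩
    · rintro ⟨x, rfl⟩
      exact ⟨x, by simp⟩

theorem of_mem {X : ModuleCat.{u} Λ} (hX : S X) : Filt S X := by
  refine .ext X X (ModuleCat.of Λ PUnit.{u + 1}) LinearMap.id 0 Function.injective_id
    (fun x => ⟨0, Subsingleton.elim (α := PUnit) _ _⟩) ?_ hX
    (.zero _ (inferInstanceAs (Subsingleton PUnit)))
  intro x
  exact ⟨fun _ => ⟨x, rfl⟩, fun _ => rfl⟩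

theorem finite (hS : ∀ X, S X → Module.Finite Λ X) {X : ModuleCat.{u} Λ} (hX : Filt S X) :
    Module.Finite Λ X := by
  induction hX with
  | zero _ h => infer_instance
  | ext A Y Z f g hf hg hfg hA hZ ih => exact finite_of_exact f g hg hfg (hS A hA) ih

theorem of_exact {X Z : ModuleCat.{u} Λ} (hX : Filt S X) (hZ : Filt S Z) :
    ∀ {Y : ModuleCat.{u} Λ} (f : X →ₗ[Λ] Y) (g : Y →ₗ[Λ] Z), Function.Injective f →
      Function.Surjective g → Function.Exact f g → Filt S Y := by
  induction hX with
  | zero X h =>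
    intro Y f g hf hg hfg
    refine hZ.congr (LinearEquiv.ofBijective g ⟨?_, hg⟩).symm
    rw [injective_iff_map_eq_zero]
    intro y hy
    obtain ⟨x, rfl⟩ := (hfg y).1 hy
    rw [Subsingleton.elim x 0, map_zero]
  | ext A X C a c ha hc hac hA hC ih =>
    intro Y f g hf hg hfg
    -- `Y` is an extension of `Y / A` by `A`, and `Y / A` is an extension of `Z` by `X / A`.
    let N := LinearMap.range (f ∘ₗ a)
    refine .ext A Y (ModuleCat.of Λ (Y ⧸ N)) (f ∘ₗ a) N.mkQ (hf.comp ha)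
      N.mkQ_surjective (LinearMap.exact_map_mkQ_range _) hA ?_
    obtain ⟨f', hf'⟩ := exists_desc_of_exact hc hac (N.mkQ ∘ₗ f)
      (fun x => (Submodule.Quotient.mk_eq_zero N).2 ⟨x, rfl⟩)
    obtain ⟨g', hg'⟩ := exists_desc_of_exact N.mkQ_surjective
      (LinearMap.exact_map_mkQ_range (f ∘ₗ a)) g (fun x => hfg.apply_apply_eq_zero (a x))
    refine ih f' g' ?_ ?_ ?_
    · rw [injective_iff_map_eq_zero]
      intro y hy
      obtain ⟨x, rfl⟩ := hc y
      rw [hf'] at hy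
      obtain ⟨z, hz⟩ := (Submodule.Quotient.mk_eq_zero N).1 hy
      rw [← hf hz]
      exact hac.apply_apply_eq_zero z
    · intro z
      obtain ⟨y, rfl⟩ := hg z
      exact ⟨N.mkQ y, hg' y⟩
    · intro y
      obtain ⟨y, rfl⟩ := N.mkQ_surjective y
      rw [hg']
      constructor
      · intro hy
        obtain ⟨x, rfl⟩ := (hfg y).1 hy
        exact ⟨c x, hf' x⟩
      · rintro ⟨x, hx⟩
        obtain ⟨x, rfl⟩ := hc x
        rw [hf'] at hx
        rw [← hg', ← hx]
        exact (hg' (f x)).trans (hfg.apply_apply_eq_zero x)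

theorem ker_of_eq {X Y Z : ModuleCat.{u} Λ} {f : X →ₗ[Λ] Y} {g : X →ₗ[Λ] Z}
    (h : LinearMap.ker f = LinearMap.ker g) (hf : Filt S (ModuleCat.of Λ (LinearMap.ker f))) :
    Filt S (ModuleCat.of Λ (LinearMap.ker g)) :=
  hf.congr (X := ModuleCat.of Λ (LinearMap.ker f)) (Y := ModuleCat.of Λ (LinearMap.ker g))
    (LinearEquiv.ofEq _ _ h)

/-- A nonzero map to an object of a semibrick is surjective with filtered kernel. -/
theorem surjective_and_ker (hS : IsSemibrick S) {X B : ModuleCat.{u} Λ} (hX : Filt S X)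
    (hB : S B) : ∀ h : X →ₗ[Λ] B, h ≠ 0 →
      Function.Surjective h ∧ Filt S (ModuleCat.of Λ (LinearMap.ker h)) := by
  induction hX with
  | zero X _ =>
    intro h h0
    exact (h0 (LinearMap.ext fun x => by rw [Subsingleton.elim x 0, map_zero, map_zero])).elim
  | ext A X C a c ha hc hac hA hC ih =>
    intro h h0
    by_cases hh : h ∘ₗ a = 0
    · have ha0 : ∀ x, h (a x) = 0 := fun x => DFunLike.congr_fun hh x
      obtain ⟨h', hh'⟩ := exists_desc_of_exact hc hac h ha0
      have h'0 : h' ≠ 0 := by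
        rintro rfl
        exact h0 (LinearMap.ext fun x => (hh' x).symm)
      obtain ⟨h1, h2⟩ := ih h' h'0
      refine ⟨fun b => ?_, ?_⟩
      · obtain ⟨y, rfl⟩ := h1 b
        obtain ⟨x, rfl⟩ := hc y
        exact ⟨x, (hh' x).symm⟩
      · refine .ext A (ModuleCat.of Λ (LinearMap.ker h)) (ModuleCat.of Λ (LinearMap.ker h'))
          (a.codRestrict _ ha0)
          ((c ∘ₗ (LinearMap.ker h).subtype).codRestrict _ fun x => (hh' x.1).trans x.2) ?_ ?_ ?_
          hA h2
        · intro x y hxy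
          exact ha (congrArg Subtype.val hxy)
        · rintro ⟨y, hy⟩
          obtain ⟨x, rfl⟩ := hc y
          exact ⟨⟨x, (hh' x).symm.trans hy⟩, rfl⟩
        · rintro ⟨x, hx⟩
          refine Subtype.ext_iff.trans ((hac x).trans ⟨?_, ?_⟩)
          · rintro ⟨y, rfl⟩
            exact ⟨y, rfl⟩
          · rintro ⟨y, hy⟩
            exact ⟨y, congrArg Subtype.val hy⟩
    · have hbij := hS A B hA hB _ hh
      refine ⟨fun b => ?_, ?_⟩
      · obtain ⟨x, hx⟩ := hbij.2 b
        exact ⟨a x, hx⟩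
      · -- The kernel of `h` is a complement of `A`, hence isomorphic to `C`.
        refine hC.congr (Y := ModuleCat.of Λ (LinearMap.ker h))
          (LinearEquiv.ofBijective (c ∘ₗ (LinearMap.ker h).subtype) ⟨?_, ?_⟩).symm
        · rw [injective_iff_map_eq_zero]
          rintro ⟨x, hx⟩ hcx
          obtain ⟨y, rfl⟩ := (hac x).1 hcx
          have : y = 0 := hbij.1 ((LinearMap.mem_ker.1 hx).trans (map_zero _).symm)
          subst this
          exact Subtype.ext (map_zero a)
        · intro z
          obtain ⟨x, rfl⟩ := hc z
          obtain ⟨y, hy⟩ := hbij.2 (h x)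
          refine ⟨⟨x - a y, ?_⟩, ?_⟩
          · rw [LinearMap.mem_ker, map_sub, sub_eq_zero]
            exact hy.symm
          · change c (x - a y) = c x
            rw [map_sub, hac.apply_apply_eq_zero, sub_zero]

/-- Kernels and cokernels of maps between filtered modules are filtered. This is proved by
induction on the target: with `A ⊆ Y` in `S`, compare `h : X → Y` with `X → Y / A`; the snake
lemma relates the kernels and cokernels of the two maps through the induced map from
`ker (X → Y / A)` to `A`. -/
theorem ker_and_coker (hS : IsSemibrick S) {X Y : ModuleCat.{u} Λ} (hX : Filt S X)
    (hY : Filt S Y) : ∀ h : X →ₗ[Λ] Y, Filt S (ModuleCat.of Λ (LinearMap.ker h)) ∧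
      Filt S (ModuleCat.of Λ (Y ⧸ LinearMap.range h)) := by
  induction hY with
  | zero Y _ =>
    intro h
    have h0 : h = 0 := LinearMap.ext fun x => Subsingleton.elim _ _
    refine ⟨?_, .zero _ (Submodule.mkQ_surjective (LinearMap.range h)).subsingleton⟩
    subst h0
    exact hX.congr (Y := ModuleCat.of Λ (LinearMap.ker (0 : X →ₗ[Λ] Y)))
      (LinearEquiv.ofTop _ LinearMap.ker_zero).symm
  | ext A Y C a c ha hc hac hA hC ih =>
    intro h
    obtain ⟨hk, hq⟩ := ih (c ∘ₗ h)
    obtain ⟨t, ht⟩ := exists_lift_of_exact ha hac (h ∘ₗ (LinearMap.ker (c ∘ₗ h)).subtype)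
      (fun x => x.2)
    let p : (Y ⧸ LinearMap.range h) →ₗ[Λ] (C ⧸ LinearMap.range (c ∘ₗ h)) :=
      (LinearMap.range h).mapQ (LinearMap.range (c ∘ₗ h)) c (by
        rintro _ ⟨x, rfl⟩
        exact ⟨x, rfl⟩)
    have hp : Function.Surjective p := by
      intro z
      obtain ⟨z, rfl⟩ := Submodule.mkQ_surjective _ z
      obtain ⟨y, rfl⟩ := hc z
      exact ⟨(LinearMap.range h).mkQ y, rfl⟩
    have hpk : ∀ y, p ((LinearMap.range h).mkQ y) = 0 →
        ∃ b, (LinearMap.range h).mkQ y = (LinearMap.range h).mkQ (a b) := by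
      intro y hy
      obtain ⟨x, hx⟩ := (Submodule.Quotient.mk_eq_zero _).1 hy
      have h1 : c (y - h x) = 0 := by
        rw [map_sub, sub_eq_zero]
        exact hx.symm
      obtain ⟨b, hb⟩ := (hac _).1 h1
      refine ⟨b, ?_⟩
      rw [hb, map_sub, eq_comm, sub_eq_self]
      exact (Submodule.Quotient.mk_eq_zero _).2 ⟨x, rfl⟩
    by_cases ht0 : t = 0
    · subst ht0
      have hle : ∀ x, c (h x) = 0 → h x = 0 := fun x hx => (ht ⟨x, hx⟩).symm.trans (map_zero a)
      constructor
      · refine ker_of_eq (f := c ∘ₗ h) (g := h) (le_antisymm (fun x hx => hle x hx) fun x hx => ?_)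
          hk
        rw [LinearMap.mem_ker] at hx ⊢
        rw [LinearMap.comp_apply, hx, map_zero]
      · refine .ext A _ _ ((LinearMap.range h).mkQ ∘ₗ a) p ?_ hp ?_ hA hq
        · rw [injective_iff_map_eq_zero]
          intro b hb
          obtain ⟨x, hx⟩ := (Submodule.Quotient.mk_eq_zero _).1 hb
          have h1 : c (h x) = 0 := by
            rw [hx]
            exact hac.apply_apply_eq_zero b
          rw [hle x h1] at hx
          exact ha (hx.symm.trans (map_zero a).symm)
        · intro y
          obtain ⟨y, rfl⟩ := Submodule.mkQ_surjective _ y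
          constructor
          · intro hy
            obtain ⟨b, hb⟩ := hpk y hy
            exact ⟨b, hb.symm⟩
          · rintro ⟨b, hb⟩
            rw [← hb]
            refine (Submodule.Quotient.mk_eq_zero _).2 ?_
            rw [hac.apply_apply_eq_zero b]
            exact zero_mem _
    · obtain ⟨hts, htk⟩ := surjective_and_ker hS hk hA t ht0
      constructor
      · refine htk.congr (X := ModuleCat.of Λ (LinearMap.ker t))
          (Y := ModuleCat.of Λ (LinearMap.ker h)) (LinearEquiv.ofBijective
          (((LinearMap.ker (c ∘ₗ h)).subtype ∘ₗ (LinearMap.ker t).subtype).codRestrict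
            (LinearMap.ker h) ?_) ⟨?_, ?_⟩)
        · rintro ⟨x, hx⟩
          refine (ht x).symm.trans ?_
          rw [LinearMap.mem_ker.1 hx, map_zero]
        · intro x y hxy
          have h1 : (x : LinearMap.ker t).1.1 = (y : LinearMap.ker t).1.1 :=
            congrArg (fun z : LinearMap.ker h => z.1) hxy
          exact Subtype.ext (Subtype.ext h1)
        · rintro ⟨x, hx⟩
          have hx' : x ∈ LinearMap.ker (c ∘ₗ h) := by
            rw [LinearMap.mem_ker] at hx ⊢
            rw [LinearMap.comp_apply, hx, map_zero]
          exact ⟨⟨⟨x, hx'⟩, ha ((ht ⟨x, hx'⟩).trans (hx.trans (map_zero a).symm))⟩, rfl⟩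
      · refine hq.congr (X := ModuleCat.of Λ (C ⧸ LinearMap.range (c ∘ₗ h)))
          (Y := ModuleCat.of Λ (Y ⧸ LinearMap.range h))
          (LinearEquiv.ofBijective p ⟨?_, hp⟩).symm
        rw [injective_iff_map_eq_zero]
        intro y hy
        obtain ⟨y, rfl⟩ := Submodule.mkQ_surjective _ y
        obtain ⟨b, hb⟩ := hpk y hy
        obtain ⟨x, rfl⟩ := hts b
        rw [hb, ht]
        exact (Submodule.Quotient.mk_eq_zero _).2 ⟨x.1, rfl⟩

end Filt

/-- The modules filtered by a semibrick form a wide subcategory. -/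
theorem isWide_filt {S : ObjectProperty (ModuleCat.{u} Λ)} (hS : IsSemibrick S)
    (hfin : ∀ X, S X → Module.Finite Λ X) : IsWide (Filt S) :=
  .of_linear (fun _ hX => hX.finite hfin) Filt.zero (fun _ _ e hX => hX.congr e)
    (fun _ _ f hX hY => (Filt.ker_and_coker hS hX hY f).1)
    (fun _ _ f hX hY => (Filt.ker_and_coker hS hX hY f).2)
    (fun _ _ _ f g hf hg hfg hX hZ => hX.of_exact hZ f g hf hg hfg)

/-! ### Direct sums of modules with local endomorphism rings -/

/-- The finite direct sums of objects of `P`. -/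
inductive Dir (P : ObjectProperty (ModuleCat.{u} Λ)) : ObjectProperty (ModuleCat.{u} Λ)
  | zero (X : ModuleCat.{u} Λ) (h : Subsingleton X) : Dir P X
  | cons (X A X' : ModuleCat.{u} Λ) (e : X ≃ₗ[Λ] A × X') (hA : P A) (hX' : Dir P X') : Dir P X

namespace Dir

variable {P : ObjectProperty (ModuleCat.{u} Λ)}

theorem exists_pi {X : ModuleCat.{u} Λ} (hX : Dir P X) :
    ∃ (n : ℕ) (F : Fin n → ModuleCat.{u} Λ), (∀ i, P (F i)) ∧
      Nonempty (X ≃ₗ[Λ] ((i : Fin n) → F i)) := by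
  induction hX with
  | zero X h =>
    exact ⟨0, Fin.elim0, fun i => i.elim0, ⟨LinearEquiv.ofBijective 0
      ⟨fun _ _ _ => Subsingleton.elim _ _, fun x => ⟨0, funext fun i => i.elim0⟩⟩⟩⟩
  | cons X A X' e hA hX' ih =>
    obtain ⟨n, F, hF, ⟨e'⟩⟩ := ih
    refine ⟨n + 1, Fin.cons A F, ?_, ⟨?_⟩⟩
    · intro i
      induction i using Fin.cases with
      | zero => exact hA
      | succ i => exact hF i
    · exact e ≪≫ₗ (LinearEquiv.prodCongr (LinearEquiv.refl Λ A) e') ≪≫ₗ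
        Fin.consLinearEquiv Λ (fun i => ((Fin.cons A F : Fin (n + 1) → ModuleCat.{u} Λ) i : Type u))

theorem mem_add {X : ModuleCat.{u} Λ} (hX : Dir P X) : add P X := by
  obtain ⟨n, F, hF, ⟨e⟩⟩ := hX.exists_pi
  refine ⟨n, F, ModuleCat.of Λ PUnit, hF, ⟨?_⟩⟩
  refine ModuleCat.biprodIsoProd _ _ ≪≫ LinearEquiv.toModuleIso ?_ ≪≫
    (ModuleCat.biproductIsoPi F).symm
  exact LinearEquiv.prodUnique (R := Λ) (M := X) (M₂ := PUnit.{u + 1}) ≪≫ₗ e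

end Dir

theorem le_add (P : ObjectProperty (ModuleCat.{u} Λ)) : P ≤ add P := fun X hX =>
  (Dir.cons X X (ModuleCat.of Λ PUnit.{u + 1})
    (LinearEquiv.prodUnique (R := Λ) (M := X) (M₂ := PUnit.{u + 1})).symm hX
    (.zero _ (inferInstanceAs (Subsingleton PUnit)))).mem_add

theorem exists_pi_of_add {P : ObjectProperty (ModuleCat.{u} Λ)} {X : ModuleCat.{u} Λ}
    (hX : add P X) : ∃ (n : ℕ) (F : Fin n → ModuleCat.{u} Λ) (Y : ModuleCat.{u} Λ),
      (∀ i, P (F i)) ∧ Nonempty ((X × Y) ≃ₗ[Λ] ((i : Fin n) → F i)) := by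
  obtain ⟨n, F, Y, hF, ⟨e⟩⟩ := hX
  exact ⟨n, F, Y, hF, ⟨((ModuleCat.biprodIsoProd X Y).symm ≪≫ e ≪≫
    ModuleCat.biproductIsoPi F).toLinearEquiv⟩⟩

theorem add_mono {P P' : ObjectProperty (ModuleCat.{u} Λ)} (h : P ≤ P') : add P ≤ add P' := by
  rintro X ⟨n, F, Y, hF, e⟩
  exact ⟨n, F, Y, fun i => h _ (hF i), e⟩

theorem pi_mem_of_prod (R : ObjectProperty (ModuleCat.{u} Λ))
    (hzero : ∀ X : ModuleCat.{u} Λ, Subsingleton X → R X)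
    (hprod : ∀ ⦃X Y Z : ModuleCat.{u} Λ⦄, (Y ≃ₗ[Λ] X × Z) → R X → R Z → R Y) :
    ∀ (n : ℕ) (F : Fin n → ModuleCat.{u} Λ), (∀ i, R (F i)) →
      R (ModuleCat.of Λ ((i : Fin n) → F i))
  | 0, _, _ => hzero _ ⟨fun _ _ => funext fun i => i.elim0⟩
  | n + 1, F, hF => hprod (X := F 0) (Z := ModuleCat.of Λ ((i : Fin n) → F i.succ))
      (Y := ModuleCat.of Λ ((i : Fin (n + 1)) → F i))
      (Fin.consLinearEquiv Λ (fun i => (F i : Type u))).symm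
      (hF 0) (pi_mem_of_prod R hzero hprod n _ fun i => hF i.succ)

/-- If the composite `A → X → A` is bijective, where the first map is arbitrary and the second
one is a component of an isomorphism `X × Y ≃ A × B`, then `A` can be cancelled. -/
theorem exists_cancel {X Y A B : Type*} [AddCommGroup X] [AddCommGroup Y] [AddCommGroup A]
    [AddCommGroup B] [Module Λ X] [Module Λ Y] [Module Λ A] [Module Λ B]
    (e : (X × Y) ≃ₗ[Λ] A × B) (α : A →ₗ[Λ] X)
    (hα : Function.Bijective fun z => (e (α z, 0)).1) :
    ∃ K : Submodule Λ X, Nonempty (X ≃ₗ[Λ] A × K) ∧ Nonempty ((K × Y) ≃ₗ[Λ] B) := by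
  let β : X →ₗ[Λ] A := LinearMap.fst Λ A B ∘ₗ e.toLinearMap ∘ₗ LinearMap.inl Λ X Y
  let γ : Y →ₗ[Λ] A := LinearMap.fst Λ A B ∘ₗ e.toLinearMap ∘ₗ LinearMap.inr Λ X Y
  have hβγ : ∀ x y, (e (x, y)).1 = β x + γ y := by
    intro x y
    have : ((x, y) : X × Y) = (x, 0) + (0, y) := by simp
    rw [this, map_add]
    rfl
  let s : A →ₗ[Λ] X := α ∘ₗ (LinearEquiv.ofBijective (β ∘ₗ α) hα).symm.toLinearMap
  have hs : ∀ z, β (s z) = z := fun z =>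
    LinearEquiv.apply_symm_apply (LinearEquiv.ofBijective (β ∘ₗ α) hα) z
  have hs' : ∀ x, (LinearMap.id - s ∘ₗ β : X →ₗ[Λ] X) x ∈ LinearMap.ker β := by
    intro x
    change β (x - s (β x)) = 0
    rw [map_sub, hs, sub_self]
  refine ⟨LinearMap.ker β, ⟨LinearEquiv.ofBijective (β.prod
    ((LinearMap.id - s ∘ₗ β).codRestrict (LinearMap.ker β) hs')) ⟨?_, ?_⟩⟩,
    ⟨LinearEquiv.ofBijective (LinearMap.snd Λ A B ∘ₗ e.toLinearMap ∘ₗ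
      (((LinearMap.ker β).subtype ∘ₗ LinearMap.fst Λ _ Y - s ∘ₗ γ ∘ₗ LinearMap.snd Λ _ Y).prod
        (LinearMap.snd Λ _ Y))) ⟨?_, ?_⟩⟩⟩
  · rw [injective_iff_map_eq_zero]
    intro x hx
    have h1 : β x = 0 := congrArg Prod.fst hx
    have h2 : x - s (β x) = 0 := congrArg (fun p => (Prod.snd p).1) hx
    rwa [h1, map_zero, sub_zero] at h2
  · rintro ⟨z, x, hx⟩
    rw [LinearMap.mem_ker] at hx
    refine ⟨s z + x, Prod.ext ?_ (Subtype.ext ?_)⟩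
    · change β (s z + x) = z
      rw [map_add, hs, hx, add_zero]
    · change s z + x - s (β (s z + x)) = x
      rw [map_add, hs, hx, add_zero, add_sub_cancel_left]
  · rw [injective_iff_map_eq_zero]
    rintro ⟨⟨x, hx⟩, y⟩ h
    have h2 : (e (x - s (γ y), y)).2 = 0 := h
    have h1 : (e (x - s (γ y), y)).1 = 0 := by
      rw [hβγ, map_sub, hs, LinearMap.mem_ker.1 hx]
      simp
    have h3 : (x - s (γ y), y) = (0 : X × Y) :=
      (LinearEquiv.map_eq_zero_iff e).1 (Prod.ext h1 h2)
    have hy : y = 0 := congrArg Prod.snd h3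
    have hx0 : x - s (γ y) = 0 := congrArg Prod.fst h3
    subst hy
    rw [map_zero, map_zero, sub_zero] at hx0
    exact Prod.ext (Subtype.ext hx0) rfl
  · intro z
    obtain ⟨⟨x, y⟩, hxy⟩ := e.surjective (0, z)
    have h1 : β x + γ y = 0 := by
      rw [← hβγ, hxy]
    refine ⟨(⟨x + s (γ y), ?_⟩, y), ?_⟩
    · rw [LinearMap.mem_ker, map_add, hs, h1]
    · change (e (x + s (γ y) - s (γ y), y)).2 = z
      rw [add_sub_cancel_right, hxy]

/-- The endomorphism ring of every object of `P` is local. -/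
def HasLocalEnd (P : ObjectProperty (ModuleCat.{u} Λ)) : Prop :=
  ∀ X, P X → ∀ f : X →ₗ[Λ] X, Function.Bijective f ∨ Function.Bijective fun x => x - f x

theorem dir_of_equiv_pi {P : ObjectProperty (ModuleCat.{u} Λ)} (hP : HasLocalEnd P) :
    ∀ (n : ℕ) (F : Fin n → ModuleCat.{u} Λ), (∀ i, P (F i)) → ∀ X Y : ModuleCat.{u} Λ,
      ((X × Y) ≃ₗ[Λ] ((i : Fin n) → F i)) → Dir P X
  | 0, F, _, X, Y, e => by
    refine .zero _ ⟨fun x x' => ?_⟩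
    have : ((x, 0) : X × Y) = (x', 0) := e.injective (funext fun i => i.elim0)
    exact congrArg Prod.fst this
  | n + 1, F, hF, X, Y, e => by
    let e' : (X × Y) ≃ₗ[Λ] (F 0) × ((i : Fin n) → F i.succ) :=
      e ≪≫ₗ (Fin.consLinearEquiv Λ (fun i => (F i : Type u))).symm
    -- The identity of `F 0` is the sum of its factorizations through `X` and through `Y`.
    let α : F 0 →ₗ[Λ] X := LinearMap.fst Λ X Y ∘ₗ e'.symm.toLinearMap ∘ₗ LinearMap.inl Λ _ _
    let α' : F 0 →ₗ[Λ] Y := LinearMap.snd Λ X Y ∘ₗ e'.symm.toLinearMap ∘ₗ LinearMap.inl Λ _ _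
    have hsum : ∀ z, z - (e' (α z, 0)).1 = (e' (0, α' z)).1 := by
      intro z
      rw [sub_eq_iff_eq_add, ← Prod.fst_add, ← map_add]
      have : ((0, α' z) + (α z, 0) : X × Y) = e'.symm (z, 0) := by
        simp only [Prod.mk_add_mk, zero_add, add_zero]
        rfl
      rw [this, e'.apply_symm_apply]
    rcases hP (F 0) (hF 0) (LinearMap.fst Λ _ _ ∘ₗ e'.toLinearMap ∘ₗ LinearMap.inl Λ X Y ∘ₗ α)
      with h | h
    · obtain ⟨K, ⟨e₁⟩, ⟨e₂⟩⟩ := exists_cancel e' α h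
      exact .cons X (F 0) (ModuleCat.of Λ K) e₁ (hF 0)
        (dir_of_equiv_pi hP n _ (fun i => hF i.succ) _ Y e₂)
    · have h' : Function.Bijective fun z => ((LinearEquiv.prodComm Λ Y X ≪≫ₗ e') (α' z, 0)).1 := by
        have : (fun z => ((LinearEquiv.prodComm Λ Y X ≪≫ₗ e') (α' z, 0)).1) =
            fun z => z - (e' (α z, 0)).1 := funext fun z => (hsum z).symm
        rw [this]
        exact h
      obtain ⟨K, -, ⟨e₂⟩⟩ := exists_cancel (LinearEquiv.prodComm Λ Y X ≪≫ₗ e') α' h'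
      exact dir_of_equiv_pi hP n _ (fun i => hF i.succ) X (ModuleCat.of Λ K)
        (LinearEquiv.prodComm Λ X K ≪≫ₗ e₂)

/-- The Krull-Schmidt property: if the endomorphism rings of the objects of `P` are local, then
direct summands of direct sums of objects of `P` are direct sums of objects of `P`. -/
theorem dir_of_add {P : ObjectProperty (ModuleCat.{u} Λ)} (hP : HasLocalEnd P)
    {X : ModuleCat.{u} Λ} (hX : add P X) : Dir P X := by
  obtain ⟨n, F, Y, hF, ⟨e⟩⟩ := exists_pi_of_add hX
  exact dir_of_equiv_pi hP n F hF X Y e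

theorem Dir.inf {P R : ObjectProperty (ModuleCat.{u} Λ)}
    (hR : ∀ ⦃X Y : ModuleCat.{u} Λ⦄ (i : X →ₗ[Λ] Y) (r : Y →ₗ[Λ] X), (∀ x, r (i x) = x) →
      R Y → R X) {X : ModuleCat.{u} Λ} (hX : Dir P X) (hRX : R X) : Dir (P ⊓ R) X := by
  induction hX with
  | zero X h => exact .zero X h
  | cons X A X' e hA hX' ih =>
    refine .cons X A X' e ⟨hA, ?_⟩ (ih ?_)
    · exact hR (e.symm.toLinearMap ∘ₗ LinearMap.inl Λ A X') (LinearMap.fst Λ A X' ∘ₗ e.toLinearMap)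
        (fun x => by simp) hRX
    · exact hR (e.symm.toLinearMap ∘ₗ LinearMap.inr Λ A X') (LinearMap.snd Λ A X' ∘ₗ e.toLinearMap)
        (fun x => by simp) hRX

theorem exact_of_equiv_prod {X Y Z : Type*} [AddCommGroup X] [AddCommGroup Y] [AddCommGroup Z]
    [Module Λ X] [Module Λ Y] [Module Λ Z] (e : Y ≃ₗ[Λ] X × Z) :
    Function.Injective (e.symm.toLinearMap ∘ₗ LinearMap.inl Λ X Z) ∧
      Function.Surjective (LinearMap.snd Λ X Z ∘ₗ e.toLinearMap) ∧
      Function.Exact (e.symm.toLinearMap ∘ₗ LinearMap.inl Λ X Z)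
        (LinearMap.snd Λ X Z ∘ₗ e.toLinearMap) := by
  refine ⟨e.symm.injective.comp LinearMap.inl_injective, Prod.snd_surjective.comp e.surjective, ?_⟩
  intro y
  constructor
  · intro h
    refine ⟨(e y).1, ?_⟩
    have h' : (e y).2 = 0 := h
    change e.symm ((e y).1, 0) = y
    rw [← h', Prod.mk.eta, e.symm_apply_apply]
  · rintro ⟨x, rfl⟩
    simp

theorem IsTorsionClass.of_retract {T : ObjectProperty (ModuleCat.{u} Λ)} (hT : IsTorsionClass T)
    ⦃X Y : ModuleCat.{u} Λ⦄ (i : X →ₗ[Λ] Y) (r : Y →ₗ[Λ] X) (hir : ∀ x, r (i x) = x) (hY : T Y) :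
    T X :=
  hT.of_surjective r (fun x => ⟨i x, hir x⟩) hY

theorem IsTorsionClass.of_equiv_prod {T : ObjectProperty (ModuleCat.{u} Λ)}
    (hT : IsTorsionClass T) ⦃X Y Z : ModuleCat.{u} Λ⦄ (e : Y ≃ₗ[Λ] X × Z) (hX : T X) (hZ : T Z) :
    T Y :=
  have h := exact_of_equiv_prod e
  hT.of_exact _ _ h.1 h.2.1 h.2.2 hX hZ

theorem IsWide.of_equiv_prod {T : ObjectProperty (ModuleCat.{u} Λ)}
    (hT : IsWide T) ⦃X Y Z : ModuleCat.{u} Λ⦄ (e : Y ≃ₗ[Λ] X × Z) (hX : T X) (hZ : T Z) :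
    T Y :=
  have h := exact_of_equiv_prod e
  hT.of_exact _ _ h.1 h.2.1 h.2.2 hX hZ

theorem mem_of_add {P R : ObjectProperty (ModuleCat.{u} Λ)} (hPR : P ≤ R)
    (hzero : ∀ X : ModuleCat.{u} Λ, Subsingleton X → R X)
    (hprod : ∀ ⦃X Y Z : ModuleCat.{u} Λ⦄, (Y ≃ₗ[Λ] X × Z) → R X → R Z → R Y)
    (hR : ∀ ⦃X Y : ModuleCat.{u} Λ⦄ (i : X →ₗ[Λ] Y) (r : Y →ₗ[Λ] X), (∀ x, r (i x) = x) →
      R Y → R X) : add P ≤ R := by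
  intro X hX
  obtain ⟨n, F, Y, hF, ⟨e⟩⟩ := exists_pi_of_add hX
  exact hR (Y := ModuleCat.of Λ ((i : Fin n) → F i)) (e.toLinearMap ∘ₗ LinearMap.inl Λ X Y)
    (LinearMap.fst Λ X Y ∘ₗ e.symm.toLinearMap) (fun x => by simp)
    (pi_mem_of_prod R hzero hprod n F fun i => hPR _ (hF i))

theorem IsWide.add_le {P T : ObjectProperty (ModuleCat.{u} Λ)} (hT : IsWide T) (h : P ≤ T) :
    add P ≤ T :=
  mem_of_add h (fun _ hX => hT.of_subsingleton hX) hT.of_equiv_prod (fun _ _ => hT.of_retract)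

theorem IsTorsionClass.add_le {P T : ObjectProperty (ModuleCat.{u} Λ)} (hT : IsTorsionClass T)
    (h : P ≤ T) : add P ≤ T :=
  mem_of_add h (fun _ hX => hT.of_subsingleton hX) hT.of_equiv_prod hT.of_retract

end Shadow

namespace BoundQuiver

variable {V : Type v} {E : Type w}

/-! ### String modules of lifts -/

section Words

variable {k : Type u} [Field k] [Fintype V] {Q : BoundQuiver V E}

theorem exists_proj_surjective {c : Q.StringWord} {i j : ℕ} (h : IsBd true c i j) :
    ∃ f : stringModule k Q c →ₗ[Q.Alg k] stringModule k Q (c.seg i j), Function.Surjective f ∧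
      (Function.Injective f → i = 0 ∧ j = c.len) ∧
      ∀ x t, coord (f x) t = if i + t ≤ j then coord x (i + t) else 0 := by
  obtain ⟨f, hf⟩ := exists_proj (k := k) h
  have hij := h.1
  have hj : j ≤ c.len := h.2.1
  refine ⟨f, ?_, ?_, hf⟩
  · intro y
    refine ⟨ofCoord k c fun t => coord y (t - i), coord_ext fun t ht => ?_⟩
    rw [StringWord.len_seg _ _ _ h.2.1] at ht
    rw [hf, if_pos (by omega), coord_ofCoord, if_pos (by omega), Nat.add_sub_cancel_left]
  · intro hinj
    have key : ∀ s ≤ c.len, i ≤ s ∧ s ≤ j := by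
      intro s hs
      by_contra hcon
      refine bvec_ne_zero (k := k) hs (hinj ((coord_ext fun t ht => ?_).trans (map_zero f).symm))
      rw [hf, coord_zero]
      split_ifs with h1
      · rw [coord_bvec _ _ _ hs, if_neg (by omega)]
      · rfl
    have h0 := key 0 (Nat.zero_le _)
    have h1 := key c.len le_rfl
    omega

theorem exists_incl_injective {c : Q.StringWord} {i j : ℕ} (h : IsBd false c i j) :
    ∃ f : stringModule k Q (c.seg i j) →ₗ[Q.Alg k] stringModule k Q c, Function.Injective f ∧
      (Function.Surjective f → i = 0 ∧ j = c.len) ∧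
      ∀ x t, coord (f x) t = if i ≤ t ∧ t ≤ j then coord x (t - i) else 0 := by
  obtain ⟨f, hf⟩ := exists_incl (k := k) h
  have hij := h.1
  have hj : j ≤ c.len := h.2.1
  refine ⟨f, ?_, ?_, hf⟩
  · intro x y hxy
    refine coord_ext fun t ht => ?_
    rw [StringWord.len_seg _ _ _ h.2.1] at ht
    have h1 := hf x (i + t)
    have h2 := hf y (i + t)
    rw [if_pos (by omega), Nat.add_sub_cancel_left] at h1 h2
    rw [← h1, ← h2, hxy]
  · intro hsurj
    have key : ∀ s ≤ c.len, i ≤ s ∧ s ≤ j := by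
      intro s hs
      obtain ⟨x, hx⟩ := hsurj (bvec k c s)
      have h1 := congrArg (fun y => coord y s) hx
      by_contra hcon
      simp only [hf, coord_bvec _ _ _ hs, if_true, if_neg hcon] at h1
      exact zero_ne_one h1
    have h0 := key 0 (Nat.zero_le _)
    have h1 := key c.len le_rfl
    omega

end Words

namespace Lift

section Comparison

variable {Q : BoundQuiver V E}

theorem vertex_inj (hQ : Q.Thin) (d : Q.Lift) {i j : ℕ} (hi : i ≤ d.len) (hj : j ≤ d.len)
    (h : Q.double.vertex d.1.1 i = Q.double.vertex d.1.1 j) : i = j := by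
  refine hQ d.down i j (d.len_down.symm ▸ hi) (d.len_down.symm ▸ hj) ?_
  change Q.vertex (specialize d.1.1) i = Q.vertex (specialize d.1.1) j
  rw [vertex_specialize Q _ _ hi, vertex_specialize Q _ _ hj, h]

theorem eq_or_symm {d e : Q.Lift} (h : d = e ∨ d = e.inv) : e = d ∨ e = d.inv := by
  rcases h with rfl | rfl
  · exact Or.inl rfl
  · exact Or.inr (inv_inv e).symm

/-- A lift can be replaced by its inverse to compare two lifts of the same string. -/
theorem exists_down_eq {d : Q.Lift} {c : Q.StringWord} (h : d.str = c.toStr) :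
    ∃ e : Q.Lift, (e = d ∨ e = d.inv) ∧ e.down = c := by
  rcases (StringWord.toStr_eq_iff _ _).1 h with h | h
  · exact ⟨d, Or.inl rfl, h⟩
  · refine ⟨d.inv, Or.inr rfl, ?_⟩
    rw [down_inv, h, StringWord.inv_inv]

theorem strSeg_eq_of_seg_eq {d e : Q.Lift} {i j i' j' : ℕ} {hi : i ≤ d.len} {hi' : i' ≤ e.len}
    (h : d.seg i j hi = e.seg i' j' hi') : d.strSeg i j = e.strSeg i' j' := by
  rw [← str_seg d i j hi, ← str_seg e i' j' hi', h]

theorem eq_of_length {d e : Q.Lift} {i j i' j' : ℕ} {hi : i ≤ d.len} {hi' : i' ≤ e.len}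
    (hs : d.seg i j hi = e.seg i' j' hi') (h : i = 0 ∧ j = d.len) (h' : i' = 0 ∧ j' = e.len) :
    d = e := by
  obtain ⟨rfl, rfl⟩ := h
  obtain ⟨rfl, rfl⟩ := h'
  rwa [seg_whole, seg_whole] at hs

/-- Lifts of the two parts of a break of a string extend to a lift of the whole string. -/
theorem exists_glue {c : Q.StringWord} {t : ℕ} (ht : t < c.len) {d e : Q.Lift}
    (hd : d.down = c.seg 0 t) (he : e.down = c.seg (t + 1) c.len) :
    ∃ (f : Q.Lift) (h0 : t + 1 ≤ f.len), f.down = c ∧ f.seg 0 t (Nat.zero_le _) = d ∧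
      f.seg (t + 1) f.len h0 = e := by
  obtain ⟨f, hf, -, hε⟩ := Lift.exists_lift c fun s =>
    if s < t then (d.1.1.letters[s]?.map Prod.snd).getD true
    else (e.1.1.letters[s - (t + 1)]?.map Prod.snd).getD true
  have hlen : f.len = c.len := by rw [← f.len_down, hf]
  refine ⟨f, by omega, hf, ?_, ?_⟩
  · refine Lift.ext_of_down (by rw [Lift.down_seg, hf, hd]) fun s l m hl hm => ?_
    have hl' := (seg_letters_getElem? f.1 0 t s).symm.trans hl
    rw [Nat.zero_add] at hl'
    split_ifs at hl' with hs
    rw [hε s l hl', if_pos hs, hm]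
    rfl
  · refine Lift.ext_of_down (by rw [Lift.down_seg, hf, he, hlen]) fun s l m hl hm => ?_
    have hl' := (seg_letters_getElem? f.1 (t + 1) f.len s).symm.trans hl
    split_ifs at hl' with hs
    rw [hε _ l hl', if_neg (by omega), Nat.add_sub_cancel_left, hm]
    rfl

end Comparison

section Modules

variable (k : Type u) [Field k] [Fintype V] {Q : BoundQuiver V E}

/-- The string module `M(d)` over `Π(A)`. -/
noncomputable abbrev mod (d : Q.Lift) : ModuleCat.{u} (Q.double.Alg k) :=
  stringModule k Q.double d.1

variable {k}

theorem nontrivial_mod (d : Q.Lift) : Nontrivial (d.mod k) :=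
  ⟨bvec k d.1 0, 0, bvec_ne_zero (Nat.zero_le _)⟩

theorem id_ne_zero (d : Q.Lift) :
    (LinearMap.id : d.mod k →ₗ[Q.double.Alg k] d.mod k) ≠ 0 := fun h =>
  bvec_ne_zero (k := k) (Nat.zero_le d.len) (DFunLike.congr_fun h (bvec k d.1 0))

/-- The endomorphisms of `M(d)` are scalars, because the vertices of `d` are distinct. -/
theorem endo_eq_smul (hQ : Q.Thin) (d : Q.Lift) (f : d.mod k →ₗ[Q.double.Alg k] d.mod k)
    (x : d.mod k) : f x = entry f 0 0 • x := by
  refine coord_ext fun t ht => ?_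
  have h : f x = f.restrictScalars k x := rfl
  rw [h, eq_sum_bvec x, map_sum, coord_sum, ← eq_sum_bvec x, coord_smul,
    Finset.sum_eq_single t]
  · rw [map_smul, coord_smul, mul_comm]
    congr 1
    exact entry_self_eq f ht
  · intro p hp hpt
    rw [map_smul, coord_smul]
    by_contra hne
    have hne' : entry f t p ≠ 0 := right_ne_zero_of_mul hne
    exact hpt (d.vertex_inj hQ (le_of_entry_ne f hne').1 (le_of_entry_ne f hne').2
      (vertex_eq_of_entry_ne f hne'))
  · intro h
    exact (h (Finset.mem_range.2 (Nat.lt_succ_of_le ht))).elim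

theorem endo_bijective (hQ : Q.Thin) (d : Q.Lift) (f : d.mod k →ₗ[Q.double.Alg k] d.mod k)
    (hf : f ≠ 0) : Function.Bijective f := by
  have hr : entry f 0 0 ≠ 0 := by
    intro h
    refine hf (LinearMap.ext fun x => ?_)
    rw [endo_eq_smul hQ, h, zero_smul]
    rfl
  constructor
  · intro x y hxy
    rw [endo_eq_smul hQ, endo_eq_smul hQ] at hxy
    exact smul_right_injective _ hr hxy
  · intro y
    refine ⟨(entry f 0 0)⁻¹ • y, ?_⟩
    rw [endo_eq_smul hQ, smul_inv_smul₀ hr]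

theorem exists_equiv_inv (d : Q.Lift) :
    Nonempty (d.mod k ≃ₗ[Q.double.Alg k] d.inv.mod k) := by
  obtain ⟨f, hf⟩ := exists_inv (k := k) d.1
  refine ⟨LinearEquiv.ofBijective f ⟨?_, ?_⟩⟩
  · intro x y hxy
    refine coord_ext fun t ht => ?_
    have h1 := hf x (d.1.len - t) (by omega)
    have h2 := hf y (d.1.len - t) (by omega)
    rw [show d.1.len - (d.1.len - t) = t by omega] at h1 h2
    rw [← h1, ← h2, hxy]
  · intro y
    refine ⟨ofCoord k d.1 fun t => coord (c := d.inv.1) y (d.len - t), coord_ext fun t ht => ?_⟩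
    have ht' : t ≤ d.1.len := by rwa [StringWord.len_inv] at ht
    rw [hf _ t ht', coord_ofCoord, if_pos (by omega)]
    congr 1
    change d.1.len - (d.1.len - t) = t
    omega

theorem exists_equiv {d e : Q.Lift} (h : d = e ∨ d = e.inv) :
    Nonempty (d.mod k ≃ₗ[Q.double.Alg k] e.mod k) := by
  rcases h with rfl | rfl
  · exact ⟨LinearEquiv.refl _ _⟩
  · obtain ⟨f⟩ := exists_equiv_inv (k := k) e
    exact ⟨f.symm⟩

theorem exists_proj {d : Q.Lift} {i j : ℕ} (h : IsBd true d.1 i j) (hi : i ≤ d.len) :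
    ∃ f : d.mod k →ₗ[Q.double.Alg k] (d.seg i j hi).mod k, Function.Surjective f ∧
      (Function.Injective f → i = 0 ∧ j = d.len) := by
  obtain ⟨f, h1, h2, -⟩ := exists_proj_surjective (k := k) h
  exact ⟨f, h1, h2⟩

theorem exists_incl {d : Q.Lift} {i j : ℕ} (h : IsBd false d.1 i j) (hi : i ≤ d.len) :
    ∃ f : (d.seg i j hi).mod k →ₗ[Q.double.Alg k] d.mod k, Function.Injective f ∧
      (Function.Surjective f → i = 0 ∧ j = d.len) := by
  obtain ⟨f, h1, h2, -⟩ := exists_incl_injective (k := k) h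
  exact ⟨f, h1, h2⟩

/-- A nonzero map `M(d) → M(e)` yields a common substring, on top of `d` and at the bottom
of `e`. -/
theorem exists_common_of_ne_zero {d e : Q.Lift} {f : d.mod k →ₗ[Q.double.Alg k] e.mod k}
    (hf : f ≠ 0) : ∃ e' : Q.Lift, (e' = e ∨ e' = e.inv) ∧
      ∃ i j i' j', ∃ hi : i ≤ d.len, ∃ hi' : i' ≤ e'.len,
        IsBd true d.1 i j ∧ IsBd false e'.1 i' j' ∧ d.seg i j hi = e'.seg i' j' hi' := by
  obtain ⟨c, hc, i, j, i', j', h, h', hs⟩ := BoundQuiver.exists_common_of_ne_zero hf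
  have : ∃ e' : Q.Lift, (e' = e ∨ e' = e.inv) ∧ e'.1 = c := by
    rcases hc with rfl | rfl
    · exact ⟨e, Or.inl rfl, rfl⟩
    · exact ⟨e.inv, Or.inr rfl, rfl⟩
  obtain ⟨e', he', rfl⟩ := this
  exact ⟨e', he', i, j, i', j', h.1.trans h.2.1, h'.1.trans h'.2.1, h, h', Subtype.ext hs⟩

theorem exists_hom_of_common {d e : Q.Lift} {i j i' j' : ℕ} (h : IsBd true d.1 i j)
    (h' : IsBd false e.1 i' j') {hi : i ≤ d.len} {hi' : i' ≤ e.len}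
    (hs : d.seg i j hi = e.seg i' j' hi') :
    ∃ f : d.mod k →ₗ[Q.double.Alg k] e.mod k, f ≠ 0 ∧
      (Function.Bijective f → (i = 0 ∧ j = d.len) ∧ i' = 0 ∧ j' = e.len) := by
  obtain ⟨p, hp, hp'⟩ := exists_proj (k := k) h hi
  obtain ⟨q, hq, hq'⟩ := exists_incl (k := k) h' hi'
  have key : ∃ f : (d.seg i j hi).mod k →ₗ[Q.double.Alg k] e.mod k, Function.Injective f ∧
      (Function.Surjective f → i' = 0 ∧ j' = e.len) := by
    rw [hs]
    exact ⟨q, hq, hq'⟩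
  obtain ⟨q, hq, hq'⟩ := key
  refine ⟨q ∘ₗ p, ?_, fun hb => ⟨hp' (Function.Injective.of_comp (f := q) hb.1),
    hq' (Function.Surjective.of_comp (g := p) hb.2)⟩⟩
  intro h0
  refine (d.seg i j hi).id_ne_zero (k := k) (LinearMap.ext fun y => hq ?_)
  obtain ⟨x, rfl⟩ := hp y
  exact (DFunLike.congr_fun h0 x).trans (map_zero q).symm

/-- There are no nonzero maps from strings whose tops lie in `B` to strings whose bottoms lie
outside of `B`. -/
theorem Good.hom_eq_zero {B : Set Q.Str} {d e : Q.Lift} (hd : d.Good true B)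
    (he : e.Good false Bᶜ) (f : d.mod k →ₗ[Q.double.Alg k] e.mod k) : f = 0 := by
  by_contra hf
  obtain ⟨e', he', i, j, i', j', hi, hi', h, h', hs⟩ := exists_common_of_ne_zero hf
  have hg : e'.Good false Bᶜ := by
    rcases he' with rfl | rfl
    · exact he
    · exact he.inv
  have h2 := hg i' j' h'
  rw [← strSeg_eq_of_seg_eq hs] at h2
  exact h2 (hd i j h)

/-- Isomorphic string modules belong to the same word up to inversion. -/
theorem eq_or_eq_inv_of_equiv (hQ : Q.Thin) {d e : Q.Lift}
    (f : d.mod k ≃ₗ[Q.double.Alg k] e.mod k) : e = d ∨ e = d.inv := by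
  have hf : f.toLinearMap ≠ 0 := by
    intro h
    refine d.id_ne_zero (k := k) (LinearMap.ext fun x => f.injective ?_)
    exact (DFunLike.congr_fun h x).trans (map_zero f).symm
  obtain ⟨e', he', i, j, i', j', hi, hi', h, h', hs⟩ := exists_common_of_ne_zero hf
  obtain ⟨g, hg, hg'⟩ := exists_hom_of_common (k := k) h h' hs
  obtain ⟨ε⟩ := exists_equiv (k := k) he'
  have hb := endo_bijective hQ d (f.symm.toLinearMap ∘ₗ ε.toLinearMap ∘ₗ g) (by
    intro h0
    refine hg (LinearMap.ext fun x => ε.injective (f.symm.injective ?_))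
    exact (DFunLike.congr_fun h0 x).trans (by simp))
  have hgb : Function.Bijective g := by
    have h1 : ⇑g = (ε.symm ∘ f) ∘ (f.symm.toLinearMap ∘ₗ ε.toLinearMap ∘ₗ g) := by
      funext x
      simp
    rw [h1]
    exact (ε.symm.bijective.comp f.bijective).comp hb
  obtain ⟨h1, h2⟩ := hg' hgb
  rw [eq_of_length hs h1 h2]
  exact eq_or_symm he'

theorem bijective_of_eq (hQ : Q.Thin) {d e : Q.Lift} (h : d = e ∨ d = e.inv)
    (f : d.mod k →ₗ[Q.double.Alg k] e.mod k) (hf : f ≠ 0) : Function.Bijective f := by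
  obtain ⟨ε⟩ := exists_equiv (k := k) h
  have hb := endo_bijective hQ d (ε.symm.toLinearMap ∘ₗ f) (by
    intro h0
    refine hf (LinearMap.ext fun x => ε.symm.injective ?_)
    exact (DFunLike.congr_fun h0 x).trans (map_zero ε.symm).symm)
  have h1 : ⇑f = ε ∘ (ε.symm.toLinearMap ∘ₗ f) := by
    funext x
    simp
  rw [h1]
  exact ε.bijective.comp hb

/-- A word with a substring `[i, j]` at the bottom is an iterated extension of this substring and
the two remaining parts. -/
theorem mem_of_sub {R : ObjectProperty (ModuleCat.{u} (Q.double.Alg k))}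
    (hR : R.IsClosedUnderExtensions) {d : Q.Lift} {i j : ℕ} (h : IsBd false d.1 i j)
    (hi : i ≤ d.len) (hmid : R ((d.seg i j hi).mod k))
    (hleft : ∀ t, t + 1 = i → R ((d.seg 0 t (Nat.zero_le _)).mod k))
    (hright : ∀ hj : j + 1 ≤ d.len, R ((d.seg (j + 1) d.len hj).mod k)) : R (d.mod k) := by
  have hij := h.1
  have hj : j ≤ d.len := h.2.1
  have h1 : R ((d.seg i d.len hi).mod k) := by
    by_cases hj' : j + 1 ≤ d.len
    · obtain ⟨l, hl⟩ := (d.seg i d.len hi).exists_letter (t := j - i)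
        (by rw [len_seg d hi le_rfl]; omega)
      have hl2 : l.2 = false := by
        refine h.2.2.1 l ?_
        have := seg_letters_getElem? d.1 i d.len (j - i)
        rw [if_pos (by omega), show i + (j - i) = j by omega] at this
        exact this.symm.trans hl
      have hb1 := isBd_left hl
      have hb2 := isBd_right hl
      rw [hl2] at hb1 hb2
      obtain ⟨f, g, hf, hg, hfg, -⟩ := exists_exact (k := k) hb1 hb2
        (by change _ < (d.seg i d.len hi).len; rw [len_seg d hi le_rfl]; omega)
        (Or.inr ⟨rfl, rfl, rfl, rfl⟩)
      refine Shadow.prop_of_exact R hR f g hf hg hfg ?_ ?_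
      · have : (d.seg i d.len hi).1.seg 0 (j - i) = (d.seg i j hi).1 := by
          have := StringWord.seg_seg d.1 (i := i) (j := d.len) (a := 0) (b := j - i)
            (Nat.zero_le _) (by omega) le_rfl
          rwa [Nat.add_zero, show i + (j - i) = j by omega] at this
        rw [this]
        exact hmid
      · have : (d.seg i d.len hi).1.seg (j - i + 1) (d.seg i d.len hi).1.len =
            (d.seg (j + 1) d.len hj').1 := by
          have h3 := len_seg d hi le_rfl
          have := StringWord.seg_seg d.1 (i := i) (j := d.len) (a := j - i + 1) (b := d.len - i)
            (by omega) (by omega) le_rfl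
          rw [show i + (j - i + 1) = j + 1 by omega, show i + (d.len - i) = d.len by omega] at this
          rw [← h3] at this
          exact this
        rw [this]
        exact hright hj'
    · have : j = d.len := by omega
      subst this
      exact hmid
  rcases Nat.eq_zero_or_pos i with rfl | hi0
  · rwa [seg_whole] at h1
  obtain ⟨t, rfl⟩ : ∃ t, i = t + 1 := ⟨i - 1, by omega⟩
  obtain ⟨l, hl⟩ := d.exists_letter (t := t) (by omega)
  have hl2 : l.2 = true := h.2.2.2 t l rfl hl
  have hb1 := isBd_left hl
  have hb2 := isBd_right hl
  rw [hl2] at hb1 hb2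
  obtain ⟨f, g, hf, hg, hfg, -⟩ := exists_exact (k := k) hb2 hb1 (show t < d.len by omega)
    (Or.inl ⟨rfl, rfl, rfl, rfl⟩)
  exact Shadow.prop_of_exact R hR f g hf hg hfg h1 (hleft t rfl)

end Modules

end Lift

/-! ### Torsion classes and biclosed sets -/

section Torsion

variable {k : Type u} [Field k] [Fintype V] {Q : BoundQuiver V E}

open Shadow

theorem mem_stringsOf_iff (hQ : Q.Thin) {T : ObjectProperty (ModuleCat.{u} (Q.double.Alg k))}
    {x : Q.Str} : x ∈ Q.stringsOf k T ↔ ∃ d : Q.Lift, d.str = x ∧ T (d.mod k) := by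
  constructor
  · rintro ⟨p, d, rfl, hd, hT⟩
    obtain ⟨e, rfl, he, -⟩ := isStr_iff.1 hd
    exact ⟨e, he, hT⟩
  · rintro ⟨d, rfl, hT⟩
    obtain ⟨p, hp⟩ := hQ.exists_label d
    exact ⟨p, d.1, hp.str_eq.symm, hp, hT⟩

/-- A torsion class contains `M(d)` if and only if all substrings on top of `d` underlie strings
in the torsion class: with a string module over the word underlying `d`, the torsion class contains
a submodule of `M(d)` that is the string module of a substring at the bottom of `d`, and the
remaining parts are treated by induction on the length. -/
theorem mem_torsion_iff (hQ : Q.Thin) {T : ObjectProperty (ModuleCat.{u} (Q.double.Alg k))}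
    (hT : IsTorsionClass T) (d : Q.Lift) : T (d.mod k) ↔ d.Good true (Q.stringsOf k T) := by
  constructor
  · intro h i j hij
    obtain ⟨f, hf, -⟩ := Lift.exists_proj (k := k) hij (hij.1.trans hij.2.1)
    exact (mem_stringsOf_iff hQ).2 ⟨_, d.str_seg i j _, hT.of_surjective f hf h⟩
  · generalize hn : d.len = n
    induction n using Nat.strong_induction_on generalizing d with
    | _ n ih =>
      intro h
      obtain ⟨e, he, hTe⟩ := (mem_stringsOf_iff hQ).1 h.str_mem
      obtain ⟨e', he', hdown⟩ := Lift.exists_down_eq he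
      obtain ⟨ε⟩ := Lift.exists_equiv (k := k) (Lift.eq_or_symm he')
      have hTe' : T (e'.mod k) := hT.congr ε hTe
      obtain ⟨i, j, hi, hi', h1, h2, hs⟩ := Lift.exists_common hdown
      obtain ⟨f, hf, -⟩ := Lift.exists_proj (k := k) h1 hi
      have hmid := hT.of_surjective f hf hTe'
      rw [hs] at hmid
      have hij := h2.1
      have hj : j ≤ d.len := h2.2.1
      refine Lift.mem_of_sub hT.extensions h2 hi' hmid ?_ ?_
      · rintro t rfl
        obtain ⟨l, hl⟩ := d.exists_letter (t := t) (by omega)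
        have hb := isBd_left hl
        rw [h2.2.2.2 t l rfl hl] at hb
        exact ih _ (by rw [← hn, Lift.len_seg d (Nat.zero_le _) (by omega)]; omega) _ rfl
          (h.seg hb _)
      · intro hj'
        obtain ⟨l, hl⟩ := d.exists_letter (t := j) (by omega)
        have hb := isBd_right hl
        rw [h2.2.2.1 l hl] at hb
        exact ih _ (by rw [← hn, Lift.len_seg d hj' le_rfl]; omega) _ rfl (h.seg hb _)

theorem isClosedStr_stringsOf (hQ : Q.Thin)
    {T : ObjectProperty (ModuleCat.{u} (Q.double.Alg k))} (hT : IsTorsionClass T) :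
    IsClosedStr (Q.stringsOf k T) := by
  intro u v x hx hu hv
  obtain ⟨c, t, ht, rfl, rfl, rfl⟩ := hx.exists_seg
  have key : ∀ {c : Q.StringWord}, c.toStr ∈ Q.stringsOf k T →
      ∃ d : Q.Lift, d.down = c ∧ T (d.mod k) := by
    intro c hc
    obtain ⟨d, hd, hTd⟩ := (mem_stringsOf_iff hQ).1 hc
    obtain ⟨d', hd', hdown⟩ := Lift.exists_down_eq hd
    obtain ⟨ε⟩ := Lift.exists_equiv (k := k) (Lift.eq_or_symm hd')
    exact ⟨d', hdown, hT.congr ε hTd⟩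
  obtain ⟨d, hd, hTd⟩ := key hu
  obtain ⟨e, he, hTe⟩ := key hv
  obtain ⟨f, h0, hf, rfl, rfl⟩ := Lift.exists_glue ht hd he
  refine (mem_stringsOf_iff hQ).2 ⟨f, by rw [Lift.str, hf], ?_⟩
  obtain ⟨l, hl⟩ := f.exists_letter (t := t) (by omega)
  have hb1 := isBd_left hl
  have hb2 := isBd_right hl
  rcases hl2 : l.2 with _ | _
  · rw [hl2] at hb1 hb2
    obtain ⟨p, q, hp, hq, hpq, -⟩ := exists_exact (k := k) hb1 hb2 (show t < f.len by omega)
      (Or.inr ⟨rfl, rfl, rfl, rfl⟩)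
    exact hT.of_exact p q hp hq hpq hTd hTe
  · rw [hl2] at hb1 hb2
    obtain ⟨p, q, hp, hq, hpq, -⟩ := exists_exact (k := k) hb2 hb1 (show t < f.len by omega)
      (Or.inl ⟨rfl, rfl, rfl, rfl⟩)
    exact hT.of_exact p q hp hq hpq hTe hTd

theorem isClosedStr_compl_stringsOf (hQ : Q.Thin)
    {T : ObjectProperty (ModuleCat.{u} (Q.double.Alg k))} (hT : IsTorsionClass T) :
    IsClosedStr (Q.stringsOf k T)ᶜ := by
  intro u v x hx hu hv hmem
  obtain ⟨d, rfl, hTd⟩ := (mem_stringsOf_iff hQ).1 hmem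
  have hg := (mem_torsion_iff hQ hT d).1 hTd
  obtain ⟨t, ht, h⟩ := Lift.isConcat_str_iff.1 hx
  obtain ⟨l, hl⟩ := d.exists_letter ht
  have hb := hg.break_mem hl
  have h' : d.strSeg 0 t ∈ Q.stringsOf k T ∨ d.strSeg (t + 1) d.len ∈ Q.stringsOf k T := by
    rcases hl2 : l.2 with _ | _
    · exact Or.inr (hb.2 hl2)
    · exact Or.inl (hb.1 hl2)
  rcases h with ⟨rfl, rfl⟩ | ⟨rfl, rfl⟩
  · exact h'.elim hu hv
  · exact h'.elim hv hu

/-- The biclosed set of the strings of a torsion class. -/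
def bicOf (hQ : Q.Thin) {T : ObjectProperty (ModuleCat.{u} (Q.double.Alg k))}
    (hT : IsTorsionClass T) : Q.Bic :=
  ⟨Q.stringsOf k T, isClosedStr_stringsOf hQ hT, isClosedStr_compl_stringsOf hQ hT⟩

variable (k) in
/-- The torsion class of the modules without nonzero maps to the string modules of the words
whose substrings at the bottom all lie outside of `B`. -/
def torOf (B : Set Q.Str) : ObjectProperty (ModuleCat.{u} (Q.double.Alg k)) :=
  perp fun Y => ∃ e : Q.Lift, e.Good false Bᶜ ∧ Y = e.mod k

theorem isTorsionClass_torOf (B : Set Q.Str) : IsTorsionClass (torOf k B) := isTorsionClass_perp _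

theorem torOf_mono {B C : Set Q.Str} (h : B ⊆ C) : torOf k B ≤ torOf k C := by
  rintro X ⟨hfin, hX⟩
  refine ⟨hfin, ?_⟩
  rintro _ ⟨e, he, rfl⟩
  exact hX _ ⟨e, he.mono (Set.compl_subset_compl.2 h), rfl⟩

theorem Lift.Good.mem_torOf {B : Set Q.Str} {d : Q.Lift} (h : d.Good true B) :
    torOf k B (d.mod k) := by
  refine ⟨inferInstance, ?_⟩
  rintro _ ⟨e, he, rfl⟩ f
  exact h.hom_eq_zero he f

theorem stringsOf_torOf (hQ : Q.Thin) {B : Set Q.Str} (hB : IsClosedStr B)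
    (hB' : IsClosedStr Bᶜ) : Q.stringsOf k (torOf k B) = B := by
  ext x
  rw [mem_stringsOf_iff hQ]
  constructor
  · rintro ⟨d, rfl, hd⟩
    by_contra hx
    obtain ⟨e, he, hg⟩ := Lift.exists_good (B := Bᶜ) (by rwa [compl_compl]) false hx
    obtain ⟨i, j, hi, hi', h1, h2, hs⟩ := Lift.exists_common he.symm
    obtain ⟨f, hf, -⟩ := Lift.exists_hom_of_common (k := k) h1 h2 hs
    exact hf (hd.2 _ ⟨e, hg, rfl⟩ f)
  · intro hx
    obtain ⟨c, rfl⟩ := StringWord.exists_toStr x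
    obtain ⟨d, rfl, hg⟩ := Lift.exists_good hB' true hx
    exact ⟨d, rfl, hg.mem_torOf⟩

theorem stringsOf_mono {T T' : ObjectProperty (ModuleCat.{u} (Q.double.Alg k))} (h : T ≤ T') :
    Q.stringsOf k T ⊆ Q.stringsOf k T' := by
  rintro x ⟨p, d, hx, hd, hT⟩
  exact ⟨p, d, hx, hd, h _ hT⟩

theorem mem_torOf_iff (hQ : Q.Thin) (B : Q.Bic) (d : Q.Lift) :
    torOf k B.1 (d.mod k) ↔ d.Good true B.1 := by
  rw [mem_torsion_iff hQ (isTorsionClass_torOf B.1), stringsOf_torOf hQ B.2.1 B.2.2]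

/-! ### Torsion shadows -/

variable (k Q) in
/-- The string modules generating the subcategory `shadowCat`. -/
def liftModules : ObjectProperty (ModuleCat.{u} (Q.double.Alg k)) := fun X => ∃ d : Q.Lift, X = d.mod k

theorem shadowCat_eq : Q.shadowCat k = add (liftModules k Q) := by
  have : (fun X : ModuleCat.{u} (Q.double.Alg k) => ∃ c : Q.double.StringWord,
      Q.IsString (specialize c.1) ∧ X = stringModule k Q.double c) = liftModules k Q := by
    funext X
    refine propext ⟨?_, ?_⟩
    · rintro ⟨c, hc, rfl⟩
      exact ⟨⟨c, hc⟩, rfl⟩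
    · rintro ⟨d, rfl⟩
      exact ⟨d.1, d.2, rfl⟩
  rw [shadowCat, this]

theorem hasLocalEnd_liftModules (hQ : Q.Thin) : HasLocalEnd (liftModules k Q) := by
  rintro _ ⟨d, rfl⟩ f
  by_cases hf : f = 0
  · right
    subst hf
    have : (fun x : d.mod k => x - (0 : d.mod k →ₗ[Q.double.Alg k] d.mod k) x) = id := by
      funext x
      simp
    rw [this]
    exact Function.bijective_id
  · exact Or.inl (d.endo_bijective hQ f hf)

theorem Lift.mem_shadowCat (d : Q.Lift) : Q.shadowCat k (d.mod k) := by
  rw [shadowCat_eq]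
  exact le_add _ _ ⟨d, rfl⟩

/-- Objects of `shadowCat` in a subcategory closed under direct summands are direct sums of string
modules in this subcategory. -/
theorem mem_add_of_mem_shadowCat (hQ : Q.Thin)
    {R : ObjectProperty (ModuleCat.{u} (Q.double.Alg k))}
    (hR : ∀ ⦃X Y : ModuleCat.{u} (Q.double.Alg k)⦄ (i : X →ₗ[Q.double.Alg k] Y)
      (r : Y →ₗ[Q.double.Alg k] X), (∀ x, r (i x) = x) → R Y → R X)
    {X : ModuleCat.{u} (Q.double.Alg k)} (hX : Q.shadowCat k X) (hRX : R X) :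
    add (liftModules k Q ⊓ R) X := by
  rw [shadowCat_eq] at hX
  exact ((dir_of_add (hasLocalEnd_liftModules hQ) hX).inf hR hRX).mem_add

theorem stringsOf_inf_shadowCat (hQ : Q.Thin)
    (T : ObjectProperty (ModuleCat.{u} (Q.double.Alg k))) :
    Q.stringsOf k (T ⊓ Q.shadowCat k) = Q.stringsOf k T := by
  ext x
  rw [mem_stringsOf_iff hQ, mem_stringsOf_iff hQ]
  exact exists_congr fun d => and_congr_right fun _ => and_iff_left d.mem_shadowCat

theorem inf_shadowCat_le_iff (hQ : Q.Thin)
    {T T' : ObjectProperty (ModuleCat.{u} (Q.double.Alg k))} (hT : IsTorsionClass T)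
    (hT' : IsTorsionClass T') :
    Q.stringsOf k T ⊆ Q.stringsOf k T' ↔ T ⊓ Q.shadowCat k ≤ T' ⊓ Q.shadowCat k := by
  constructor
  · rintro h X ⟨hX, hM⟩
    refine ⟨hT'.add_le ?_ _ (mem_add_of_mem_shadowCat hQ hT.of_retract hM hX), hM⟩
    rintro _ ⟨⟨d, rfl⟩, hd⟩
    exact (mem_torsion_iff hQ hT' d).2 (((mem_torsion_iff hQ hT d).1 hd).mono h)
  · intro h
    have := stringsOf_mono (Q := Q) h
    rwa [stringsOf_inf_shadowCat hQ, stringsOf_inf_shadowCat hQ] at this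

end Torsion

/-! ### Edges down from a biclosed set -/

section Down

variable {Q : BoundQuiver V E}

theorem IsDown.inv {B : Set Q.Str} {d : Q.Lift} (h : IsDown B d) : IsDown B d.inv :=
  ⟨by rw [d.str_inv]; exact h.isRem, h.good.inv⟩

theorem IsDown.of_eq {B : Set Q.Str} {d e : Q.Lift} (h : d = e ∨ d = e.inv) (he : IsDown B e) :
    IsDown B d := by
  rcases h with rfl | rfl
  · exact he
  · exact he.inv

theorem exists_mem_labelsDown_iff (hQ : Q.Thin) (B : Q.Bic) (d : Q.Lift) :
    (∃ p ∈ labelsDown B, IsStr p d.1) ↔ IsDown B.1 d := by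
  constructor
  · rintro ⟨p, ⟨B', hp⟩, hd⟩
    exact (hp.isDown hd).1
  · intro h
    obtain ⟨p, hp, hl⟩ := h.exists_hasLabel hQ
    exact ⟨p, ⟨_, hl⟩, hp⟩

/-- A bottom of the label of an edge down from `B` whose string lies in `B` is the whole label. -/
theorem IsDown.bot_eq_whole {B : Set Q.Str} (hB : IsClosedStr B) {e : Q.Lift} (he : IsDown B e)
    {i j : ℕ} (h : IsBd false e.1 i j) (hmem : e.strSeg i j ∈ B) : i = 0 ∧ j = e.len := by
  have h3 : e.strSeg i j = e.str := by
    by_contra hne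
    exact he.good_false hB i j h ⟨hmem, hne⟩
  have h5 := congrArg Str.length h3
  rw [Lift.length_str, Lift.length_strSeg e i h.2.1] at h5
  have hj : j ≤ e.len := h.2.1
  have := h.1
  omega

/-- Common substrings of two labels of edges down from `B`, at the top of the first one and at
the bottom of the second one, exist only if the two labels agree. -/
theorem IsDown.eq_of_common {B : Set Q.Str} (hB : IsClosedStr B) {d e : Q.Lift}
    (hd : IsDown B d) (he : IsDown B e) {i j i' j' : ℕ} {hi : i ≤ d.len} {hi' : i' ≤ e.len}
    (h : IsBd true d.1 i j) (h' : IsBd false e.1 i' j') (hs : d.seg i j hi = e.seg i' j' hi') :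
    d = e := by
  have h2 := Lift.strSeg_eq_of_seg_eq hs
  have h3 := he.bot_eq_whole hB h' (h2 ▸ hd.good i j h)
  refine Lift.eq_of_length hs (hd.eq_whole h ?_) h3
  rw [h2, h3.1, h3.2, Lift.strSeg_whole]
  exact he.isRem

/-! ### Words between a biclosed set and the meet of its lower covers -/

/-- `m` is the meet of the biclosed sets covered by `B`, expressed by the strings that can be
removed from `B`. -/
structure IsCore (B m : Q.Bic) : Prop where
  le : ∀ x, IsRem B.1 x → m.1 ⊆ B.1 \ {x}
  good : ∀ d : Q.Lift, (∀ x, IsRem B.1 x → d.Good true (B.1 \ {x})) → d.Good true m.1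

/-- The tops of `d` lie in `B`, and the bottoms of `d` lie outside of `m`. -/
structure IsMid (B m : Set Q.Str) (d : Q.Lift) : Prop where
  top : d.Good true B
  bot : d.Good false mᶜ

theorem IsMid.inv {B m : Set Q.Str} {d : Q.Lift} (h : IsMid B m d) : IsMid B m d.inv :=
  ⟨h.top.inv, h.bot.inv⟩

theorem IsMid.of_eq {B m : Set Q.Str} {d e : Q.Lift} (h : d = e ∨ d = e.inv) (he : IsMid B m e) :
    IsMid B m d := by
  rcases h with rfl | rfl
  · exact he
  · exact he.inv

theorem IsCore.isMid {B m : Q.Bic} (hm : IsCore B m) {d : Q.Lift} (hd : IsDown B.1 d) :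
    IsMid B.1 m.1 d :=
  ⟨hd.good, (hd.good_false B.2.1).mono (Set.compl_subset_compl.2 (hm.le _ hd.isRem))⟩

/-- A word with some bottom in `m` has a bottom all of whose tops lie in `m`. -/
theorem Lift.exists_sub_good {m : Q.Bic} {d : Q.Lift} (h : ¬ d.Good false m.1ᶜ) :
    ∃ i j, ∃ hi : i ≤ d.len, IsBd false d.1 i j ∧ (d.seg i j hi).Good true m.1 := by
  unfold Lift.Good at h
  push Not at h
  obtain ⟨i, j, hij, hmem⟩ := h
  have hi : i ≤ d.len := hij.1.trans hij.2.1
  rw [Set.notMem_compl_iff, ← d.str_seg i j hi] at hmem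
  obtain ⟨e, he, hg⟩ := Lift.exists_good m.2.2 true hmem
  obtain ⟨p, q, hp, hp', h1, h2, hs⟩ := Lift.exists_common he
  have hq : i + q ≤ j := by
    have h3 : q ≤ (d.seg i j hi).len := h2.2.1
    rw [d.len_seg hi hij.2.1] at h3
    have := hij.1
    omega
  have h3 := hij.trans h2
  have h4 := d.seg_seg hi hp' h2.1 hq hij.2.1
  refine ⟨i + p, i + q, h3.1.trans h3.2.1, h3, ?_⟩
  rw [← h4, ← hs]
  exact hg.seg h1 hp

/-- If the label of an edge down from `B` occurs at the bottom of a word between `m` and `B`, then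
the part of the word to the left of it also lies between `m` and `B`. -/
theorem IsMid.left {B m : Q.Bic} (hm : IsCore B m) {d : Q.Lift} (hd : IsMid B.1 m.1 d) {t j : ℕ}
    (h : IsBd false d.1 (t + 1) j) (ht : t + 1 ≤ d.len) (he : IsDown B.1 (d.seg (t + 1) j ht)) :
    IsMid B.1 m.1 (d.seg 0 t (Nat.zero_le _)) := by
  have hj : j ≤ d.len := h.2.1
  have htj := h.1
  obtain ⟨l, hl⟩ := d.exists_letter (t := t) (by omega)
  have hl2 : l.2 = true := h.2.2.2 t l rfl hl
  have hb := isBd_left hl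
  rw [hl2] at hb
  refine ⟨hd.top.seg hb _, ?_⟩
  by_contra hcon
  obtain ⟨a, b, ha, hab, hg⟩ := Lift.exists_sub_good hcon
  have hab' := hab.1
  have hb' : b ≤ t := by
    have : b ≤ (d.seg 0 t (Nat.zero_le _)).len := hab.2.1
    rwa [d.len_seg (Nat.zero_le _) (by omega), Nat.sub_zero] at this
  have hseg : (d.seg 0 t (Nat.zero_le _)).seg a b ha = d.seg a b (by omega) := by
    rw [d.seg_seg (Nat.zero_le _) ha hab' (by omega) (by omega)]
    simp only [Nat.zero_add]
  rw [hseg] at hg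
  have hleft : ∀ s l, s + 1 = a → d.1.1.letters[s]? = some l → l.2 = true := by
    intro s l hs hl
    refine hab.2.2.2 s l hs ?_
    rw [show (d.seg 0 t (Nat.zero_le _)).1.1.letters[s]? = _ from seg_letters_getElem? d.1 0 t s,
      if_pos (by omega), Nat.zero_add]
    exact hl
  -- The bottom `[a, b]` reaches the right end of the left part.
  have hbt : b = t := by
    by_contra hne
    have hlt : b < t := by omega
    have hbd : IsBd false d.1 a b := by
      refine ⟨hab', by change b ≤ d.len; omega, fun l hl => hab.2.2.1 l ?_, hleft⟩
      rw [show (d.seg 0 t (Nat.zero_le _)).1.1.letters[b]? = _ from seg_letters_getElem? d.1 0 t b,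
        if_pos (by omega), Nat.zero_add]
      exact hl
    have h1 := hg.str_mem
    rw [d.str_seg] at h1
    exact hd.bot a b hbd h1
  subst hbt
  have hbd : IsBd false d.1 a j := ⟨by omega, hj, h.2.2.1, hleft⟩
  refine hd.bot a j hbd ?_
  -- All tops of `[a, j]` lie in all sets covered by `B`.
  rw [← d.str_seg a j (by omega)]
  refine (hm.good (d.seg a j (by omega)) fun x hx p q hpq => ?_).str_mem
  have hq : q ≤ j - a := by
    have : q ≤ (d.seg a j (by omega)).len := hpq.2.1
    rwa [d.len_seg (by omega) hj] at this
  have hpq' := hpq.1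
  rw [d.strSeg_seg (by omega) hpq' (by omega) hj]
  have hlet : ∀ s, a + s < j → (d.seg a j (by omega)).1.1.letters[s]? = d.1.1.letters[a + s]? := by
    intro s hs
    rw [show (d.seg a j (by omega)).1.1.letters[s]? = _ from seg_letters_getElem? d.1 a j s,
      if_pos hs]
  have hpl : ∀ s l, s + 1 = p → d.1.1.letters[a + s]? = some l → l.2 = false := by
    intro s l hs hl
    exact hpq.2.2.2 s l hs ((hlet s (by omega)).trans hl)
  have hqr : a + q < j → ∀ l, d.1.1.letters[a + q]? = some l → l.2 = true := by
    intro hlt l hl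
    exact hpq.2.2.1 l ((hlet q hlt).trans hl)
  -- Tops of `[a, b]` and of `[b + 1, j]` that are cut out by `[p, q]`.
  have hY : ∀ q', p ≤ q' → a + q' ≤ b → (a + q' = b ∨ q' = q) →
      d.strSeg (a + p) (a + q') ∈ m.1 := by
    intro q' hpq' hq' hor
    have hbd : IsBd true (d.seg a b (by omega)).1 p q' := by
      refine ⟨hpq', ?_, fun l hl => ?_, fun s l hs hl => ?_⟩
      · change q' ≤ (d.seg a b (by omega)).len
        rw [d.len_seg (by omega) (by omega)]
        omega
      · rw [show (d.seg a b (by omega)).1.1.letters[q']? = _ from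
          seg_letters_getElem? d.1 a b q'] at hl
        split_ifs at hl with hlt
        rcases hor with h0 | rfl
        · omega
        · exact hqr (by omega) l hl
      · rw [show (d.seg a b (by omega)).1.1.letters[s]? = _ from
          seg_letters_getElem? d.1 a b s] at hl
        split_ifs at hl with hlt
        exact hpl s l hs hl
    have := hg p q' hbd
    rwa [d.strSeg_seg (by omega) hpq' (by omega) (by omega)] at this
  have hE : ∀ p', p' ≤ q → b + 1 ≤ a + p' → (a + p' = b + 1 ∨ p' = p) →
      d.strSeg (a + p') (a + q) ∈ B.1 ∧ (IsRem B.1 (d.strSeg (a + p') (a + q)) →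
        a + p' = b + 1 ∧ a + q = j) := by
    intro p' hp'q hp' hor
    obtain ⟨r, hr⟩ : ∃ r, a + p' = b + 1 + r := ⟨a + p' - (b + 1), by omega⟩
    obtain ⟨s, hs⟩ : ∃ s, a + q = b + 1 + s := ⟨a + q - (b + 1), by omega⟩
    have hlen := d.len_seg ht hj
    have hbd : IsBd true (d.seg (b + 1) j ht).1 r s := by
      refine ⟨by omega, ?_, fun l hl => ?_, fun s' l hs' hl => ?_⟩
      · change s ≤ (d.seg (b + 1) j ht).len
        omega
      · rw [show (d.seg (b + 1) j ht).1.1.letters[s]? = _ from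
          seg_letters_getElem? d.1 (b + 1) j s] at hl
        split_ifs at hl with hlt
        rw [← hs] at hl
        exact hqr (by omega) l hl
      · rw [show (d.seg (b + 1) j ht).1.1.letters[s']? = _ from
          seg_letters_getElem? d.1 (b + 1) j s'] at hl
        split_ifs at hl with hlt
        obtain rfl : p' = p := by omega
        refine hpl (p' - 1) l (by omega) ?_
        rw [show a + (p' - 1) = b + 1 + s' by omega]
        exact hl
    have hstr : (d.seg (b + 1) j ht).strSeg r s = d.strSeg (a + p') (a + q) := by
      rw [d.strSeg_seg ht (by omega) (by omega) hj, hr, hs]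
    rw [← hstr]
    refine ⟨he.good r s hbd, fun hrem => ?_⟩
    have := he.eq_whole hbd hrem
    omega
  have hmB := hm.le x hx
  have hBx : IsClosedStr (B.1 \ {x}) := hx.isClosed B.2.1
  rcases Nat.lt_or_ge b (a + q) with hbq | hbq
  · rcases Nat.lt_or_ge b (a + p) with hbp | hbp
    · -- `[p, q]` is a top of `[b + 1, j]`, and it does not start at `b + 1`.
      obtain ⟨h1, h2⟩ := hE p hpq' hbp (Or.inr rfl)
      refine ⟨h1, ?_⟩
      rintro (rfl : _ = x)
      have h3 := (h2 hx).1
      have h4 := hpl (p - 1) l (by omega) (by rw [show a + (p - 1) = b by omega]; exact hl)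
      exact Bool.noConfusion (hl2.symm.trans h4)
    · obtain ⟨h1, h2⟩ := hE (b + 1 - a) (by omega) (by omega) (Or.inl (by omega))
      have h3 := hY (b - a) (by omega) (by omega) (Or.inl (by omega))
      rw [show a + (b - a) = b by omega] at h3
      rw [show a + (b + 1 - a) = b + 1 by omega] at h1 h2
      have hc := d.isConcat_strSeg hbp hbq (by omega)
      have h4 := hmB h3
      by_cases hxe : d.strSeg (b + 1) (a + q) = x
      · -- `[p, q]` is obtained by concatenation from a string in `m` and a removable string.
        refine ⟨B.2.1 _ _ _ hc h4.1 h1, ?_⟩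
        rintro (h5 : _ = x)
        rw [h5, ← hxe] at hc
        exact hc.right_ne rfl
      · exact hBx _ _ _ hc h4 ⟨h1, hxe⟩
  · exact hmB (hY q hpq' hbq (Or.inr rfl))

/-- The part to the right of a substring is the part to the left of it in the inverse word. -/
theorem IsBd.exists_inv {b : Bool} {d : Q.Lift} {i j : ℕ} (h : IsBd b d.1 i j) (hi : i ≤ d.len)
    (hj : j + 1 ≤ d.len) : ∃ t j', ∃ ht : t + 1 ≤ d.inv.len, IsBd b d.inv.1 (t + 1) j' ∧
      d.inv.seg (t + 1) j' ht = (d.seg i j hi).inv ∧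
      d.inv.seg 0 t (Nat.zero_le _) = (d.seg (j + 1) d.len hj).inv ∧
      d.inv.seg (t + 1) d.inv.len ht = (d.seg 0 j (Nat.zero_le _)).inv := by
  obtain ⟨t, ht⟩ : ∃ t, d.len - j = t + 1 := ⟨d.len - j - 1, by omega⟩
  have hlen : d.inv.len = d.len := d.len_inv
  have hij := h.1
  refine ⟨t, d.len - i, by omega, ht ▸ h.inv, ?_, ?_, ?_⟩
  · rw [d.seg_inv (by omega) (by omega)]
    congr 2 <;> omega
  · rw [d.seg_inv (by omega) (by omega)]
    congr 2
    omega
  · rw [d.seg_inv (by omega) (by omega)]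
    congr 2 <;> omega

end Down

/-! ### Filtrations by the labels of edges down from a biclosed set -/

section Filtration

variable {k : Type u} [Field k] [Fintype V] {Q : BoundQuiver V E}

open Shadow

variable (k) in
/-- The string modules of the labels of the edges down from `B`. -/
def downModules (B : Set Q.Str) : ObjectProperty (ModuleCat.{u} (Q.double.Alg k)) := fun X =>
  ∃ e : Q.Lift, IsDown B e ∧ X = e.mod k

theorem labelModules_eq (P : Set Q.Label) : Q.labelModules k P =
    fun X => ∃ d : Q.Lift, (∃ p ∈ P, IsStr p d.1) ∧ X = d.mod k := by
  funext X
  refine propext ⟨?_, ?_⟩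
  · rintro ⟨p, hp, c, hc, rfl⟩
    obtain ⟨e, rfl, -⟩ := isStr_iff.1 hc
    exact ⟨e, ⟨p, hp, hc⟩, rfl⟩
  · rintro ⟨d, ⟨p, hp, hd⟩, rfl⟩
    exact ⟨p, hp, d.1, hd, rfl⟩

theorem labelModules_labelsDown (hQ : Q.Thin) (B : Q.Bic) :
    Q.labelModules k (labelsDown B) = downModules k B.1 := by
  rw [labelModules_eq]
  funext X
  exact propext (exists_congr fun d => and_congr_left fun _ => exists_mem_labelsDown_iff hQ B d)

theorem finite_downModules (B : Set Q.Str) :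
    ∀ X : ModuleCat.{u} (Q.double.Alg k), downModules k B X → Module.Finite (Q.double.Alg k) X := by
  rintro _ ⟨e, -, rfl⟩
  infer_instance

theorem downModules_le_torOf (B : Set Q.Str) : downModules k B ≤ torOf k B := by
  rintro _ ⟨e, he, rfl⟩
  exact he.good.mem_torOf

/-- The torsion class generated by the labels of the edges down from `B` has `B` as its set of
strings: otherwise, some edge down from `B` would remove a string outside of this set. -/
theorem stringsOf_torsionClosure_downModules (hQ : Q.Thin) (B : Q.Bic) :
    Q.stringsOf k (torsionClosure (downModules k B.1)) = B.1 := by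
  have hT := isTorsionClass_torsionClosure (finite_downModules (k := k) B.1)
  have hle : Q.stringsOf k (torsionClosure (downModules k B.1)) ⊆ B.1 := by
    have := stringsOf_mono (Q := Q) (T := torsionClosure (downModules k B.1)) (T' := torOf k B.1)
      fun X hX => hX _ (isTorsionClass_torOf B.1) (downModules_le_torOf B.1)
    rwa [stringsOf_torOf hQ B.2.1 B.2.2] at this
  refine Set.Subset.antisymm hle fun y hy => ?_
  by_contra hcon
  obtain ⟨x, hx, hrem⟩ := exists_isRem hQ B.2.1 B.2.2 (isClosedStr_stringsOf hQ hT)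
    (isClosedStr_compl_stringsOf hQ hT) hle ⟨y, hy, hcon⟩
  obtain ⟨c, rfl⟩ := StringWord.exists_toStr x
  obtain ⟨d, rfl, hg⟩ := Lift.exists_good B.2.2 true hrem.mem
  exact hx ((mem_stringsOf_iff hQ).2 ⟨d, rfl, le_torsionClosure _ _ ⟨d, ⟨hrem, hg⟩, rfl⟩⟩)

theorem isSemibrick_downModules (hQ : Q.Thin) {B : Set Q.Str} (hB : IsClosedStr B) :
    IsSemibrick (downModules k B) := by
  rintro _ _ ⟨d, hd, rfl⟩ ⟨e, he, rfl⟩ f hf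
  obtain ⟨e', he', i, j, i', j', hi, hi', h, h', hs⟩ := Lift.exists_common_of_ne_zero hf
  refine Lift.bijective_of_eq hQ ?_ f hf
  rw [hd.eq_of_common hB (he.of_eq he') h h' hs]
  exact he'

/-- The meet of the biclosed sets covered by `B` consists of the strings of a torsion class, the
intersection of the torsion classes attached to the covered sets. -/
theorem Bic.exists_isGLB (hQ : Q.Thin) (k : Type u) [Field k] (B : Q.Bic) :
    ∃ m : Q.Bic, IsGLB {B' : Q.Bic | B' ⋖ B} m ∧
      ∀ d : Q.Lift, (∀ B' : Q.Bic, B' ⋖ B → d.Good true B'.1) → d.Good true m.1 := by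
  let F : ObjectProperty (ModuleCat.{u} (Q.double.Alg k)) := fun Y =>
    ∃ B' : Q.Bic, B' ⋖ B ∧ ∃ e : Q.Lift, e.Good false B'.1ᶜ ∧ Y = e.mod k
  have hF : ∀ X, perp F X ↔ Module.Finite (Q.double.Alg k) X ∧
      ∀ B' : Q.Bic, B' ⋖ B → torOf k B'.1 X := by
    intro X
    constructor
    · rintro ⟨hfin, hX⟩
      refine ⟨hfin, fun B' hB' => ⟨hfin, ?_⟩⟩
      rintro _ ⟨e, he, rfl⟩
      exact hX _ ⟨B', hB', e, he, rfl⟩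
    · rintro ⟨hfin, hX⟩
      refine ⟨hfin, ?_⟩
      rintro _ ⟨B', hB', e, he, rfl⟩
      exact (hX B' hB').2 _ ⟨e, he, rfl⟩
  have hT : IsTorsionClass (perp F) := isTorsionClass_perp F
  refine ⟨bicOf hQ hT, ⟨?_, ?_⟩, ?_⟩
  · intro B' hB'
    have := stringsOf_mono (Q := Q) (T := perp F) (T' := torOf k B'.1)
      fun X hX => ((hF X).1 hX).2 B' hB'
    rwa [stringsOf_torOf hQ B'.2.1 B'.2.2] at this
  · intro C hC
    have := stringsOf_mono (Q := Q) (T := torOf k C.1) (T' := perp F)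
      fun X hX => (hF X).2 ⟨hX.1, fun B' hB' => torOf_mono (hC hB') X hX⟩
    rwa [stringsOf_torOf hQ C.2.1 C.2.2] at this
  · intro d hd
    exact (mem_torsion_iff hQ hT d).1 ((hF _).2 ⟨inferInstance, fun B' hB' => (hd B' hB').mem_torOf⟩)

theorem Bic.exists_isCore (hQ : Q.Thin) (k : Type u) [Field k] (B : Q.Bic) :
    ∃ m : Q.Bic, IsGLB {B' : Q.Bic | B' ⋖ B} m ∧ IsCore B m := by
  obtain ⟨m, hm, hg⟩ := Bic.exists_isGLB hQ k B
  refine ⟨m, hm, fun x hx => hm.1 (B.erase_covBy hQ hx), fun d hd => hg d fun B' hB' => ?_⟩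
  obtain ⟨x, hx, rfl⟩ := Bic.exists_of_covBy hQ hB'
  exact hd x hx

/-- The words between `m` and `B` are exactly the ones whose modules have a filtration by the
labels of the edges down from `B`. -/
theorem filt_iff_isMid (hQ : Q.Thin) {B m : Q.Bic} (hm : IsCore B m) (d : Q.Lift) :
    Filt (downModules k B.1) (d.mod k) ↔ IsMid B.1 m.1 d := by
  constructor
  · intro h
    have hle : ∀ X, Filt (downModules k B.1) X → torOf k B.1 X := by
      intro X hX
      induction hX with
      | zero X h => exact (isTorsionClass_torOf B.1).of_subsingleton h
      | ext X Y Z f g hf hg hfg hX hZ ih =>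
        exact (isTorsionClass_torOf B.1).of_exact f g hf hg hfg (downModules_le_torOf B.1 X hX) ih
    refine ⟨(mem_torOf_iff hQ B d).1 (hle _ h), ?_⟩
    by_contra hcon
    obtain ⟨i, j, hi, hij, hg⟩ := Lift.exists_sub_good hcon
    have hzero : ∀ X, Filt (downModules k B.1) X →
        ∀ f : (d.seg i j hi).mod k →ₗ[Q.double.Alg k] X, f = 0 := by
      intro X hX
      induction hX with
      | zero X h =>
        intro f
        exact LinearMap.ext fun x => Subsingleton.elim _ _
      | ext X Y Z f g hf hg' hfg hX hZ ih =>
        intro φ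
        obtain ⟨φ', hφ'⟩ := exists_lift_of_exact hf hfg φ
          fun x => DFunLike.congr_fun (ih (g ∘ₗ φ)) x
        obtain ⟨e, he, rfl⟩ := hX
        have h0 : φ' = 0 := hg.hom_eq_zero (hm.isMid he).bot φ'
        ext x
        rw [← hφ' x, h0]
        exact map_zero f
    obtain ⟨f, hf, -⟩ := Lift.exists_incl (k := k) hij hi
    refine (d.seg i j hi).id_ne_zero (k := k) (LinearMap.ext fun x => hf ?_)
    rw [hzero _ h f]
    rfl
  · generalize hn : d.len = n
    induction n using Nat.strong_induction_on generalizing d with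
    | _ n ih =>
      intro h
      have hT := isTorsionClass_torsionClosure (finite_downModules (k := k) B.1)
      have hd : torsionClosure (downModules k B.1) (d.mod k) := by
        rw [mem_torsion_iff hQ hT, stringsOf_torsionClosure_downModules hQ B]
        exact h.top
      obtain ⟨_, ⟨e, he, rfl⟩, f, hf⟩ := exists_ne_zero_of_torsionClosure
        (finite_downModules (k := k) B.1) hd d.nontrivial_mod
      obtain ⟨d', hd', i, j, i', j', hi, hi', h1, h2, hs⟩ := Lift.exists_common_of_ne_zero hf
      have hmid : IsMid B.1 m.1 d' := h.of_eq hd'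
      have hlen : d'.len = n := by
        rcases hd' with rfl | rfl
        · exact hn
        · rw [Lift.len_inv, hn]
      obtain ⟨ε⟩ := Lift.exists_equiv (k := k) hd'
      -- The common substring is all of `e`: a proper top of `e` would have all its tops in `m`.
      have hwhole : i = 0 ∧ j = e.len := by
        by_contra hne
        have hg : (e.seg i j hi).Good true m.1 := by
          refine hm.good _ fun x hx p q hpq => ?_
          have hq : q ≤ (e.seg i j hi).len := hpq.2.1
          rw [e.len_seg hi h1.2.1] at hq
          have hij := h1.1
          have hj : j ≤ e.len := h1.2.1
          have hpq' := hpq.1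
          rw [e.strSeg_seg hi hpq' (by omega) hj]
          have hbd := h1.trans hpq
          refine ⟨he.good _ _ hbd, ?_⟩
          rintro (rfl : _ = x)
          have := he.eq_whole hbd hx
          omega
        have h3 := hg.str_mem
        rw [e.str_seg, Lift.strSeg_eq_of_seg_eq hs] at h3
        exact hmid.bot i' j' h2 h3
      obtain ⟨rfl, rfl⟩ := hwhole
      rw [Lift.seg_whole] at hs
      subst hs
      refine Filt.congr ε (Lift.mem_of_sub (isWide_filt (isSemibrick_downModules hQ B.2.1)
        (finite_downModules B.1)).extensions h2 hi' (Filt.of_mem ⟨_, he, rfl⟩) ?_ ?_)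
      · rintro t rfl
        have hj' : j' ≤ d'.len := h2.2.1
        have := h2.1
        exact ih _ (by rw [← hlen, d'.len_seg (Nat.zero_le _) (by omega)]; omega) _ rfl
          (hmid.left hm h2 hi' he)
      · intro hj'
        have hi2 := h2.1
        obtain ⟨t, i₁, ht, hbd, h3, h4, -⟩ := h2.exists_inv hi' hj'
        have h5 := hmid.inv.left hm hbd ht (by rw [h3]; exact he.inv)
        rw [h4] at h5
        have h7 := h5.inv
        rw [Lift.inv_inv] at h7
        exact ih _ (by rw [← hlen, d'.len_seg hj' le_rfl]; omega) _ rfl h7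

end Filtration

/-! ### The shard intersection order -/

section Shards

variable {k : Type u} [Field k] [Fintype V] {Q : BoundQuiver V E}

open Shadow

/-- The labels in `ψ(B)` are the words between `m` and `B`. Given such a word `d`, consider the
torsion class generated by `M(d)` and the torsion class of `m`, and let `C'` be its set of strings;
the strings of the modules in this class without nonzero maps to `M(d)` form a smaller biclosed
set `C`. An edge down from `C'` to a set containing `C` has to be labelled by `d`. -/
theorem exists_mem_shardSet_iff (hQ : Q.Thin) (k : Type u) [Field k] {B m : Q.Bic}
    (hglb : IsGLB {B' : Q.Bic | B' ⋖ B} m) (d : Q.Lift) :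
    (∃ p ∈ shardSet B, IsStr p d.1) ↔ IsMid B.1 m.1 d := by
  constructor
  · rintro ⟨p, ⟨m', C, C', hm', hmC, hCB, hp⟩, hd⟩
    obtain rfl := hglb.unique hm'
    obtain ⟨hdown, hC⟩ := hp.isDown hd
    have hmC' : m.1 ⊆ C'.1 \ {d.str} := hC ▸ hmC
    exact ⟨hdown.good.mono hCB, (hdown.good_false C'.2.1).mono (Set.compl_subset_compl.2 hmC')⟩
  · intro h
    let P : ObjectProperty (ModuleCat.{u} (Q.double.Alg k)) := fun X =>
      torOf k m.1 X ∨ X = d.mod k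
    have hPfin : ∀ X, P X → Module.Finite (Q.double.Alg k) X := by
      rintro X (hX | rfl)
      · exact hX.1
      · infer_instance
    have hT' := isTorsionClass_torsionClosure hPfin
    let T : ObjectProperty (ModuleCat.{u} (Q.double.Alg k)) :=
      torsionClosure P ⊓ perp fun Y => Y = d.mod k
    have hT : IsTorsionClass T := hT'.inf (isTorsionClass_perp _)
    let C := bicOf hQ hT
    let C' := bicOf hQ hT'
    have hdC' : d.Good true C'.1 :=
      (mem_torsion_iff hQ hT' d).1 (le_torsionClosure P _ (Or.inr rfl))
    have hmC : m.1 ⊆ C.1 := by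
      rw [← stringsOf_torOf (k := k) hQ m.2.1 m.2.2]
      refine stringsOf_mono fun X hX => ⟨le_torsionClosure P _ (Or.inl hX), hX.1, ?_⟩
      rintro _ rfl
      exact hX.2 _ ⟨d, h.bot, rfl⟩
    have hmB : m.1 ⊆ B.1 := by
      rcases Set.eq_empty_or_nonempty {B' : Q.Bic | B' ⋖ B} with h0 | ⟨B', hB'⟩
      · obtain ⟨p, hp⟩ := hQ.exists_label d
        -- Without lower covers, `B` would be empty.
        have hempty : IsClosedStr (∅ : Set Q.Str) := fun _ _ _ _ hu => hu.elim
        obtain ⟨x, -, hx⟩ := exists_isRem hQ B.2.1 B.2.2 hempty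
          (fun _ _ _ _ _ _ hx => hx) (Set.empty_subset _) ⟨d.str, h.top.str_mem, id⟩
        have : B.erase hQ hx ∈ {B' : Q.Bic | B' ⋖ B} := B.erase_covBy hQ hx
        rw [h0] at this
        exact this.elim
      · exact (hglb.1 hB').trans hB'.lt.le
    have hC'B : C'.1 ⊆ B.1 := by
      rw [← stringsOf_torOf (k := k) hQ B.2.1 B.2.2]
      refine stringsOf_mono fun X hX => hX _ (isTorsionClass_torOf B.1) ?_
      rintro X (hX | rfl)
      · exact torOf_mono hmB X hX
      · exact h.top.mem_torOf
    have hCC' : C.1 ⊆ C'.1 := stringsOf_mono fun X hX => hX.1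
    have hdC : d.str ∉ C.1 := by
      intro hmem
      obtain ⟨e, he, hTe⟩ := (mem_stringsOf_iff hQ).1 hmem
      obtain ⟨e', he', hdown⟩ := Lift.exists_down_eq (c := d.down) he
      obtain ⟨ε⟩ := Lift.exists_equiv (k := k) (Lift.eq_or_symm he')
      obtain ⟨i, j, hi, hi', h1, h2, hs⟩ := Lift.exists_common hdown
      obtain ⟨f, hf, -⟩ := Lift.exists_hom_of_common (k := k) h1 h2 hs
      exact hf ((hT.congr ε hTe).2.2 _ rfl f)
    obtain ⟨x, hxC, hx⟩ := exists_isRem hQ C'.2.1 C'.2.2 C.2.1 C.2.2 hCC'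
      ⟨d.str, hdC'.str_mem, hdC⟩
    have hmx : m.1 ⊆ (C'.erase hQ hx).1 :=
      fun y hy => ⟨hCC' (hmC hy), fun hyx => hxC (Set.mem_singleton_iff.1 hyx ▸ hmC hy)⟩
    -- Some top of `d` has underlying string `x`, as `M(d)` generates `C'` over `C`.
    have hnot : ¬ d.Good true (C'.erase hQ hx).1 := by
      intro hg
      have hle : C'.1 ⊆ (C'.erase hQ hx).1 := by
        have := stringsOf_mono (Q := Q) (T := torsionClosure P) (T' := torOf k (C'.erase hQ hx).1)
          fun X hX => hX _ (isTorsionClass_torOf _) (by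
            rintro X (hX | rfl)
            · exact torOf_mono hmx X hX
            · exact hg.mem_torOf)
        rwa [stringsOf_torOf hQ (C'.erase hQ hx).2.1 (C'.erase hQ hx).2.2] at this
      exact (hle hx.mem).2 rfl
    unfold Lift.Good at hnot
    push Not at hnot
    obtain ⟨i, j, hij, hmem⟩ := hnot
    have hxij : d.strSeg i j = x := by
      by_contra hne
      exact hmem ⟨hdC' i j hij, hne⟩
    have hi : i ≤ d.len := hij.1.trans hij.2.1
    obtain ⟨p, hp, hp'⟩ := Lift.exists_proj (k := k) hij hi
    have hTw : torsionClosure P ((d.seg i j hi).mod k) :=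
      hT'.of_surjective p hp (le_torsionClosure P _ (Or.inr rfl))
    obtain ⟨f, hf⟩ : ∃ f : (d.seg i j hi).mod k →ₗ[Q.double.Alg k] d.mod k, f ≠ 0 := by
      by_contra hcon
      push Not at hcon
      refine hxC ((mem_stringsOf_iff hQ).2 ⟨d.seg i j hi, by rw [d.str_seg, hxij], hTw,
        inferInstance, ?_⟩)
      rintro _ rfl f
      exact hcon f
    have hb := d.endo_bijective hQ (f ∘ₗ p) (by
      intro h0
      refine hf (LinearMap.ext fun y => ?_)
      obtain ⟨y, rfl⟩ := hp y
      exact DFunLike.congr_fun h0 y)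
    obtain ⟨rfl, rfl⟩ := hp' (Function.Injective.of_comp (f := f) hb.1)
    rw [d.strSeg_whole] at hxij
    subst hxij
    obtain ⟨q, hq, hl⟩ := IsDown.exists_hasLabel hQ (B := C') ⟨hx, hdC'⟩
    exact ⟨q, ⟨m, _, C', hglb, hmx, hC'B, hl⟩, hq⟩

theorem labelsDown_subset_shardSet (hQ : Q.Thin) (k : Type u) [Field k] (B : Q.Bic) :
    labelsDown B ⊆ shardSet B := by
  rintro p ⟨B', hp⟩
  obtain ⟨m, hm, -⟩ := Bic.exists_isCore hQ k B
  exact ⟨m, B', B, hm, hm.1 hp.1, le_rfl, hp⟩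

theorem labelModules_mono {P P' : Set Q.Label} (h : P ⊆ P') :
    Q.labelModules k P ≤ Q.labelModules k P' := by
  rintro X ⟨p, hp, hX⟩
  exact ⟨p, h hp, hX⟩

/-- The additive closure of the modules of `ψ(B)` is the shadow of the wide subcategory of the
modules filtered by the labels of the edges down from `B`. -/
theorem add_labelModules_shardSet (hQ : Q.Thin) (B : Q.Bic) :
    add (Q.labelModules k (shardSet B)) = Filt (downModules k B.1) ⊓ Q.shadowCat k := by
  obtain ⟨m, hglb, hm⟩ := Bic.exists_isCore hQ k B
  have hW := isWide_filt (isSemibrick_downModules (k := k) hQ B.2.1) (finite_downModules B.1)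
  have heq : Q.labelModules k (shardSet B) = liftModules k Q ⊓ Filt (downModules k B.1) := by
    rw [labelModules_eq]
    funext X
    refine propext ⟨?_, ?_⟩
    · rintro ⟨d, hd, rfl⟩
      exact ⟨⟨d, rfl⟩, (filt_iff_isMid hQ hm d).2 ((exists_mem_shardSet_iff hQ k hglb d).1 hd)⟩
    · rintro ⟨⟨d, rfl⟩, hd⟩
      exact ⟨d, (exists_mem_shardSet_iff hQ k hglb d).2 ((filt_iff_isMid hQ hm d).1 hd), rfl⟩
  rw [heq]
  refine le_antisymm ?_ ?_
  · intro X hX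
    refine ⟨hW.add_le (fun Y hY => hY.2) _ hX, ?_⟩
    rw [shadowCat_eq]
    exact add_mono (fun Y hY => hY.1) _ hX
  · intro X hX
    exact mem_add_of_mem_shadowCat hQ (fun _ _ => hW.of_retract) hX.2 hX.1

theorem stringsOf_torsionClosure_shardSet (hQ : Q.Thin) (B : Q.Bic) :
    Q.stringsOf k (torsionClosure (Q.labelModules k (shardSet B))) = B.1 := by
  obtain ⟨m, hglb, hm⟩ := Bic.exists_isCore hQ k B
  refine Set.Subset.antisymm ?_ ?_
  · have := stringsOf_mono (Q := Q) (T := torsionClosure (Q.labelModules k (shardSet B)))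
      (T' := torOf k B.1) fun X hX => hX _ (isTorsionClass_torOf B.1) (by
        rw [labelModules_eq]
        rintro _ ⟨d, hd, rfl⟩
        exact ((exists_mem_shardSet_iff hQ k hglb d).1 hd).top.mem_torOf)
    rwa [stringsOf_torOf hQ B.2.1 B.2.2] at this
  · rw [← stringsOf_torsionClosure_downModules (k := k) hQ B, ← labelModules_labelsDown hQ]
    exact stringsOf_mono fun X hX T hT h =>
      hX T hT ((labelModules_mono (labelsDown_subset_shardSet hQ k B)).trans h)

theorem shardSet_injective (hQ : Q.Thin) (k : Type u) [Field k] :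
    Function.Injective (shardSet (Q := Q)) := by
  intro B B' h
  have h1 := stringsOf_torsionClosure_shardSet (k := k) hQ B
  rw [h, stringsOf_torsionClosure_shardSet hQ B'] at h1
  exact Subtype.ext h1.symm

theorem subset_of_add_le (hQ : Q.Thin) {P P' : Set Q.Label}
    (h : add (Q.labelModules k P) ≤ add (Q.labelModules k P')) : P ⊆ P' := by
  intro p hp
  obtain ⟨e, he⟩ := exists_isStr_of_label p
  have hmem : Dir (Q.labelModules k P') (e.mod k) := by
    refine dir_of_add ?_ (h _ (le_add _ _ ⟨p, hp, e.1, he, rfl⟩))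
    rw [labelModules_eq]
    rintro _ ⟨d, -, rfl⟩
    exact hasLocalEnd_liftModules hQ _ ⟨d, rfl⟩
  generalize hX : e.mod k = X at hmem
  rw [labelModules_eq] at hmem
  cases hmem with
  | zero _ h0 =>
    subst hX
    exact (not_subsingleton_iff_nontrivial.2 e.nontrivial_mod h0).elim
  | cons _ A X' ε hA _ =>
    subst hX
    obtain ⟨d, ⟨p', hp', hd⟩, rfl⟩ := hA
    -- `M(d)` is a direct summand of the brick `M(e)`.
    let i : d.mod k →ₗ[Q.double.Alg k] e.mod k := ε.symm.toLinearMap ∘ₗ LinearMap.inl _ _ _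
    let r : e.mod k →ₗ[Q.double.Alg k] d.mod k := LinearMap.fst _ _ _ ∘ₗ ε.toLinearMap
    have hri : ∀ x, r (i x) = x := fun x => by simp [i, r]
    have hb := e.endo_bijective hQ (i ∘ₗ r) (by
      intro h0
      refine d.id_ne_zero (k := k) (LinearMap.ext fun x => ?_)
      have h1 : i (r (i x)) = 0 := DFunLike.congr_fun h0 (i x)
      rw [hri] at h1
      calc x = r (i x) := (hri x).symm
        _ = 0 := by rw [h1, map_zero])
    have hi : Function.Bijective i :=
      ⟨Function.LeftInverse.injective hri, Function.Surjective.of_comp (g := r) hb.2⟩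
    have hde := Lift.eq_or_eq_inv_of_equiv hQ (LinearEquiv.ofBijective i hi)
    have hp'e : IsStr p' e.1 := by
      rcases hde with rfl | rfl
      · exact hd
      · exact hd.inv
    rwa [he.label_unique hp'e]

end Shards

/-! ### Wide shadows -/

section Wide

variable {k : Type u} [Field k] [Fintype V] {Q : BoundQuiver V E}

open Shadow

variable {W : ObjectProperty (ModuleCat.{u} (Q.double.Alg k))}

theorem mod_inv_iff (hW : IsWide W) (d : Q.Lift) : W (d.inv.mod k) ↔ W (d.mod k) := by
  obtain ⟨ε⟩ := d.exists_equiv_inv (k := k)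
  exact ⟨hW.congr ε.symm, hW.congr ε⟩

/-- The part to the left of a substring `[t + 1, j]` at the bottom of `d` is a direct summand of
the cokernel of the inclusion of this substring: `[0, j]` is at the bottom of `d`. -/
theorem IsWide.left_of_sub (hW : IsWide W) {d : Q.Lift} {t j : ℕ}
    (h : IsBd false d.1 (t + 1) j) (ht : t + 1 ≤ d.len) (hd : W (d.mod k))
    (hmid : W ((d.seg (t + 1) j ht).mod k)) : W ((d.seg 0 t (Nat.zero_le _)).mod k) := by
  have hj : j ≤ d.1.len := h.2.1
  have htj := h.1
  obtain ⟨l, hl⟩ := d.exists_letter (t := t) (by omega)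
  have hl2 : l.2 = true := h.2.2.2 t l rfl hl
  have hbd : IsBd false d.1 0 j := ⟨Nat.zero_le _, hj, h.2.2.1, fun _ _ h0 => by omega⟩
  have hlp := isBd_left hl
  rw [hl2] at hlp
  have hlen := d.1.len_seg 0 j hj
  have hl' : (d.1.seg 0 j).1.letters[t]? = some l := by
    rw [seg_letters_getElem?, if_pos (by omega), Nat.zero_add]
    exact hl
  have hb1 := isBd_left hl'
  have hb2 := isBd_right hl'
  rw [hl2] at hb1 hb2
  have key := exists_exact (k := k) hb2 hb1 (by omega) (Or.inl ⟨rfl, rfl, rfl, rfl⟩)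
  have e1 : (d.1.seg 0 j).seg (t + 1) (d.1.seg 0 j).len = d.1.seg (t + 1) j := by
    rw [hlen, d.1.seg_seg (by omega) (by omega) hj]
    simp
  have e2 : (d.1.seg 0 j).seg 0 t = d.1.seg 0 t := by
    rw [d.1.seg_seg (by omega) (by omega) hj]
    simp
  rw [e1, e2] at key
  obtain ⟨a, q, -, hq, haq, -, hq'⟩ := key
  obtain ⟨b, -, -, hb⟩ := exists_incl_injective (k := k) hbd
  obtain ⟨p, -, -, hp⟩ := exists_proj_surjective (k := k) hlp
  have hpb : ∀ x, p (b x) = q x := by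
    refine fun x => coord_ext fun s _ => ?_
    rw [hp, hq', hb]
    by_cases hs : 0 + s ≤ t
    · rw [if_pos hs, if_pos hs, if_pos (by omega), Nat.sub_zero]
    · rw [if_neg hs, if_neg hs]
  exact hW.of_quotient_step a b p q hq haq hpb hmid hd

/-- The part to the left of a substring `[t + 1, j]` on top of `d` is a direct summand of the
kernel of the projection to this substring: `[0, j]` is on top of `d`. -/
theorem IsWide.left_of_quotient (hW : IsWide W) {d : Q.Lift} {t j : ℕ}
    (h : IsBd true d.1 (t + 1) j) (ht : t + 1 ≤ d.len) (hd : W (d.mod k))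
    (hmid : W ((d.seg (t + 1) j ht).mod k)) : W ((d.seg 0 t (Nat.zero_le _)).mod k) := by
  have hj : j ≤ d.1.len := h.2.1
  have htj := h.1
  obtain ⟨l, hl⟩ := d.exists_letter (t := t) (by omega)
  have hl2 : l.2 = false := h.2.2.2 t l rfl hl
  have hbd : IsBd true d.1 0 j := ⟨Nat.zero_le _, hj, h.2.2.1, fun _ _ h0 => by omega⟩
  have hlp := isBd_left hl
  rw [hl2] at hlp
  have hlen := d.1.len_seg 0 j hj
  have hl' : (d.1.seg 0 j).1.letters[t]? = some l := by
    rw [seg_letters_getElem?, if_pos (by omega), Nat.zero_add]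
    exact hl
  have hb1 := isBd_left hl'
  have hb2 := isBd_right hl'
  rw [hl2] at hb1 hb2
  have key := exists_exact (k := k) hb1 hb2 (by omega) (Or.inr ⟨rfl, rfl, rfl, rfl⟩)
  have e1 : (d.1.seg 0 j).seg (t + 1) (d.1.seg 0 j).len = d.1.seg (t + 1) j := by
    rw [hlen, d.1.seg_seg (by omega) (by omega) hj]
    simp
  have e2 : (d.1.seg 0 j).seg 0 t = d.1.seg 0 t := by
    rw [d.1.seg_seg (by omega) (by omega) hj]
    simp
  rw [e1, e2] at key
  obtain ⟨q, a, hq, -, hqa, hq', -⟩ := key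
  obtain ⟨b, -, -, hb⟩ := exists_proj_surjective (k := k) hbd
  obtain ⟨p, -, -, hp⟩ := exists_incl_injective (k := k) hlp
  have hbp : ∀ x, b (p x) = q x := by
    refine fun x => coord_ext fun s hs => ?_
    rw [hlen] at hs
    rw [hb, hq', hp, if_pos (by omega), Nat.zero_add]
  exact hW.of_sub_step a b p q hq hqa hbp hmid hd

theorem IsWide.right_of_sub (hW : IsWide W) {d : Q.Lift} {i j : ℕ}
    (h : IsBd false d.1 i j) (hi : i ≤ d.len) (hj : j + 1 ≤ d.len) (hd : W (d.mod k))
    (hmid : W ((d.seg i j hi).mod k)) : W ((d.seg (j + 1) d.len hj).mod k) := by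
  obtain ⟨t, j', ht, hbd, h1, h2, -⟩ := h.exists_inv hi hj
  have := IsWide.left_of_sub hW hbd ht ((mod_inv_iff hW d).2 hd)
    (by rw [h1]; exact (mod_inv_iff hW _).2 hmid)
  rw [h2] at this
  exact (mod_inv_iff hW _).1 this

theorem IsWide.right_of_quotient (hW : IsWide W) {d : Q.Lift} {i j : ℕ}
    (h : IsBd true d.1 i j) (hi : i ≤ d.len) (hj : j + 1 ≤ d.len) (hd : W (d.mod k))
    (hmid : W ((d.seg i j hi).mod k)) : W ((d.seg (j + 1) d.len hj).mod k) := by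
  obtain ⟨t, j', ht, hbd, h1, h2, -⟩ := h.exists_inv hi hj
  have := IsWide.left_of_quotient hW hbd ht ((mod_inv_iff hW d).2 hd)
    (by rw [h1]; exact (mod_inv_iff hW _).2 hmid)
  rw [h2] at this
  exact (mod_inv_iff hW _).1 this

/-- If a removable string sits on top of a word `d` in `W`, then the part of `d` to the left of it
lies in the torsion class generated by `W`, so it can be cut off without leaving `W`. -/
theorem IsWide.cut_left (hQ : Q.Thin) (hW : IsWide W)
    {P : ObjectProperty (ModuleCat.{u} (Q.double.Alg k))} (hP : P ≤ W) {d : Q.Lift} {t j : ℕ}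
    (h : IsBd true d.1 (t + 1) j) (ht : t + 1 ≤ d.len) (hd : W (d.mod k))
    (hdT : torsionClosure P (d.mod k))
    (hrem : IsRem (Q.stringsOf k (torsionClosure P)) (d.strSeg (t + 1) j)) :
    W ((d.seg (t + 1) d.len ht).mod k) := by
  have hT := isTorsionClass_torsionClosure fun X hX => hW.finite X (hP X hX)
  have hg := (mem_torsion_iff hQ hT d).1 hdT
  have hj : j ≤ d.len := h.2.1
  have htj := h.1
  obtain ⟨l, hl⟩ := d.exists_letter (t := t) (by omega)
  have hl2 : l.2 = false := h.2.2.2 t l rfl hl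
  have hb1 := isBd_left hl
  have hb2 := isBd_right hl
  rw [hl2] at hb1 hb2
  have hleft : torsionClosure P ((d.seg 0 t (Nat.zero_le _)).mod k) := by
    rw [mem_torsion_iff hQ hT]
    intro p q hpq
    have hq : q ≤ t := by
      have : q ≤ (d.seg 0 t (Nat.zero_le _)).len := hpq.2.1
      rwa [d.len_seg (Nat.zero_le _) (by omega), Nat.sub_zero] at this
    have hpq' := hpq.1
    rw [d.strSeg_seg (Nat.zero_le _) hpq' (by omega) (by omega)]
    simp only [Nat.zero_add]
    have hpl : ∀ s l, s + 1 = p → d.1.1.letters[s]? = some l → l.2 = false := by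
      intro s l hs hl
      refine hpq.2.2.2 s l hs ?_
      rw [show (d.seg 0 t (Nat.zero_le _)).1.1.letters[s]? = _ from seg_letters_getElem? d.1 0 t s,
        if_pos (by omega), Nat.zero_add]
      exact hl
    rcases hq.lt_or_eq with hlt | rfl
    · refine hg p q ⟨hpq', by change q ≤ d.len; omega, fun l hl => hpq.2.2.1 l ?_, hpl⟩
      rw [show (d.seg 0 t (Nat.zero_le _)).1.1.letters[q]? = _ from seg_letters_getElem? d.1 0 t q,
        if_pos (by omega), Nat.zero_add]
      exact hl
    · exact hrem.ext _ _ (d.isConcat_strSeg hpq' (by omega) hj)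
        (hg p j ⟨by omega, hj, h.2.2.1, hpl⟩)
  obtain ⟨f, g, hf, hgs, hfg, -⟩ := exists_exact (k := k) hb1 hb2 (show t < d.len by omega)
    (Or.inr ⟨rfl, rfl, rfl, rfl⟩)
  refine hW.of_torsion_ker (P := P) hP (X := d.mod k) g hgs hd ?_
  refine hT.of_surjective (Y := ModuleCat.of _ (LinearMap.ker g))
    (f.codRestrict (LinearMap.ker g) fun x => hfg.apply_apply_eq_zero x) ?_ hleft
  rintro ⟨y, hy⟩
  obtain ⟨x, rfl⟩ := (hfg y).1 hy
  exact ⟨x, rfl⟩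

/-- If a removable string sits on top of a word in `W`, then its module lies in `W`. -/
theorem IsWide.mem_of_top (hQ : Q.Thin) (hW : IsWide W)
    {P : ObjectProperty (ModuleCat.{u} (Q.double.Alg k))} (hP : P ≤ W) {d : Q.Lift} {i j : ℕ}
    (h : IsBd true d.1 i j) (hi : i ≤ d.len) (hd : W (d.mod k))
    (hdT : torsionClosure P (d.mod k))
    (hrem : IsRem (Q.stringsOf k (torsionClosure P)) (d.strSeg i j)) :
    W ((d.seg i j hi).mod k) := by
  have hT := isTorsionClass_torsionClosure fun X hX => hW.finite X (hP X hX)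
  have hij := h.1
  have hj : j ≤ d.len := h.2.1
  -- The part to the right of `[i, j]` is cut off first.
  obtain ⟨h1, h2⟩ : W ((d.seg 0 j (Nat.zero_le _)).mod k) ∧
      torsionClosure P ((d.seg 0 j (Nat.zero_le _)).mod k) := by
    rcases hj.lt_or_eq with hlt | rfl
    · obtain ⟨t, j', ht, hbd, h1, -, h3⟩ := h.exists_inv hi hlt
      obtain ⟨ε⟩ := d.exists_equiv_inv (k := k)
      have h4 := IsWide.cut_left hQ hW hP hbd ht (hW.congr ε hd) (hT.congr ε hdT) (by
        rw [← d.inv.str_seg _ _ ht, h1, Lift.str_inv, d.str_seg]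
        exact hrem)
      rw [h3, mod_inv_iff hW] at h4
      have hbd' : IsBd true d.1 0 j := ⟨Nat.zero_le _, hj, h.2.2.1, fun _ _ h0 => by omega⟩
      obtain ⟨f, hf, -⟩ := Lift.exists_proj (k := k) hbd' (Nat.zero_le _)
      exact ⟨h4, hT.of_surjective f hf hdT⟩
    · rw [Lift.seg_whole]
      exact ⟨hd, hdT⟩
  rcases Nat.eq_zero_or_pos i with rfl | hi0
  · exact h1
  obtain ⟨t, rfl⟩ : ∃ t, i = t + 1 := ⟨i - 1, by omega⟩
  have hlen := d.len_seg (Nat.zero_le _) hj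
  have hbd : IsBd true (d.seg 0 j (Nat.zero_le _)).1 (t + 1) j := by
    refine ⟨hij, by change j ≤ (d.seg 0 j (Nat.zero_le _)).len; omega, fun l hl => ?_,
      fun s l hs hl => ?_⟩
    · rw [show (d.seg 0 j (Nat.zero_le _)).1.1.letters[j]? = _ from
        seg_letters_getElem? d.1 0 j j, if_neg (by omega)] at hl
      exact (Option.some_ne_none l hl.symm).elim
    · rw [show (d.seg 0 j (Nat.zero_le _)).1.1.letters[s]? = _ from
        seg_letters_getElem? d.1 0 j s, if_pos (by omega), Nat.zero_add] at hl
      exact h.2.2.2 s l hs hl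
  have h3 := IsWide.cut_left hQ hW hP hbd (by omega) h1 h2 (by
    rw [d.strSeg_seg (Nat.zero_le _) (by omega) (by omega) hj]
    simpa only [Nat.zero_add] using hrem)
  have h4 : (d.seg 0 j (Nat.zero_le _)).seg (t + 1) (d.seg 0 j (Nat.zero_le _)).len (by omega) =
      d.seg (t + 1) j hi := by
    rw [d.seg_seg (Nat.zero_le _) (by omega) (by omega) (by omega) hj]
    simp only [Nat.zero_add, hlen, Nat.sub_zero]
  rwa [h4] at h3

/-- With `B` the set of strings of the torsion class generated by the string modules in a wide
subcategory `W`, the labels of the edges down from `B` lie in `W`. -/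
theorem IsWide.mem_of_isDown (hQ : Q.Thin) (hW : IsWide W) {e : Q.Lift}
    (he : IsDown (Q.stringsOf k (torsionClosure (liftModules k Q ⊓ W))) e) : W (e.mod k) := by
  have hP : liftModules k Q ⊓ W ≤ W := fun _ hX => hX.2
  have hT := isTorsionClass_torsionClosure fun X hX => hW.finite X (hP X hX)
  obtain ⟨_, ⟨⟨d, rfl⟩, hd⟩, f, hf⟩ := exists_ne_zero_of_torsionClosure
    (fun X hX => hW.finite X (hP X hX)) ((mem_torsion_iff hQ hT e).2 he.good) e.nontrivial_mod
  obtain ⟨e', he', i, j, i', j', hi, hi', h, h', hs⟩ := Lift.exists_common_of_ne_zero hf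
  have hdT := le_torsionClosure (liftModules k Q ⊓ W) _ ⟨⟨d, rfl⟩, hd⟩
  have hmem := (mem_torsion_iff hQ hT d).1 hdT i j h
  have hdown := he.of_eq he'
  rw [Lift.strSeg_eq_of_seg_eq hs] at hmem
  have hwhole := hdown.bot_eq_whole (isClosedStr_stringsOf hQ hT) h' hmem
  have hse : d.seg i j hi = e' := by
    obtain ⟨rfl, rfl⟩ := hwhole
    rw [hs, Lift.seg_whole]
  have h1 := IsWide.mem_of_top hQ hW hP h hi hd hdT (by
    rw [← d.str_seg i j hi, hse]
    exact hdown.isRem)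
  rw [hse] at h1
  obtain ⟨ε⟩ := Lift.exists_equiv (k := k) he'
  exact hW.congr ε h1

/-- The string modules in a wide subcategory `W` are filtered by the labels of the edges down from
the biclosed set attached to the torsion class that they generate. Indeed, some such label maps to the given word, its image is
all of the label, and the rest of the word lies in the wide subcategory again. -/
theorem IsWide.filt (hQ : Q.Thin) (hW : IsWide W) (d : Q.Lift) (hd : W (d.mod k)) :
    Filt (downModules k (Q.stringsOf k (torsionClosure (liftModules k Q ⊓ W)))) (d.mod k) := by
  have hP : liftModules k Q ⊓ W ≤ W := fun _ hX => hX.2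
  have hT := isTorsionClass_torsionClosure fun X hX => hW.finite X (hP X hX)
  have hB := isClosedStr_stringsOf hQ hT
  set B : Q.Bic := bicOf hQ hT with hBdef
  change Filt (downModules k B.1) (d.mod k)
  generalize hn : d.len = n
  induction n using Nat.strong_induction_on generalizing d with
  | _ n ih =>
    have hT' := isTorsionClass_torsionClosure (finite_downModules (k := k) B.1)
    have hmemB : ∀ e : Q.Lift, W (e.mod k) → e.Good true B.1 := fun e he =>
      (mem_torsion_iff hQ hT e).1 (le_torsionClosure _ _ ⟨⟨e, rfl⟩, he⟩)
    have hdT : torsionClosure (downModules k B.1) (d.mod k) := by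
      rw [mem_torsion_iff hQ hT', stringsOf_torsionClosure_downModules hQ B]
      exact hmemB d hd
    obtain ⟨_, ⟨e, he, rfl⟩, f, hf⟩ := exists_ne_zero_of_torsionClosure
      (finite_downModules (k := k) B.1) hdT d.nontrivial_mod
    obtain ⟨d', hd', i, j, i', j', hi, hi', h1, h2, hs⟩ := Lift.exists_common_of_ne_zero hf
    have heW : W (e.mod k) := IsWide.mem_of_isDown hQ hW he
    obtain ⟨ε⟩ := Lift.exists_equiv (k := k) hd'
    have hd'W : W (d'.mod k) := hW.congr ε.symm hd
    have hlen : d'.len = n := by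
      rcases hd' with rfl | rfl
      · exact hn
      · rw [Lift.len_inv, hn]
    have hz : W ((e.seg i j hi).mod k) := by
      obtain ⟨p, hp, -⟩ := Lift.exists_proj (k := k) h1 hi
      have key : ∃ q : (e.seg i j hi).mod k →ₗ[Q.double.Alg k] d'.mod k,
          Function.Injective q := by
        rw [hs]
        obtain ⟨q, hq, -⟩ := Lift.exists_incl (k := k) h2 hi'
        exact ⟨q, hq⟩
      obtain ⟨q, hq⟩ := key
      exact hW.range p q hp hq heW hd'W
    have hij := h1.1
    have hj : j ≤ e.len := h1.2.1
    -- The parts of `e` outside of the image would lie in `W`, hence in `B`.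
    have hi0 : i = 0 := by
      rcases Nat.eq_zero_or_pos i with h0 | h0
      · exact h0
      obtain ⟨t, rfl⟩ : ∃ t, i = t + 1 := ⟨i - 1, by omega⟩
      obtain ⟨l, hl⟩ := e.exists_letter (t := t) (by omega)
      have hb := isBd_left hl
      rw [h1.2.2.2 t l rfl hl] at hb
      have h3 := (hmemB _ (IsWide.left_of_quotient hW h1 hi heW hz)).str_mem
      rw [e.str_seg] at h3
      have := he.bot_eq_whole hB hb h3
      omega
    have hj0 : j = e.len := by
      rcases hj.lt_or_eq with h0 | h0
      · obtain ⟨l, hl⟩ := e.exists_letter (t := j) h0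
        have hb := isBd_right hl
        rw [h1.2.2.1 l hl] at hb
        have h3 := (hmemB _ (IsWide.right_of_quotient hW h1 hi h0 heW hz)).str_mem
        rw [e.str_seg] at h3
        have := he.bot_eq_whole hB hb h3
        omega
      · exact h0
    subst hi0
    subst hj0
    rw [Lift.seg_whole] at hs
    subst hs
    have hi'j' := h2.1
    have hj' : j' ≤ d'.len := h2.2.1
    refine Filt.congr ε (Lift.mem_of_sub (isWide_filt (isSemibrick_downModules hQ hB)
      (finite_downModules B.1)).extensions h2 hi' (Filt.of_mem ⟨_, he, rfl⟩) ?_ ?_)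
    · rintro t rfl
      exact ih _ (by rw [← hlen, d'.len_seg (Nat.zero_le _) (by omega)]; omega) _
        (IsWide.left_of_sub hW h2 hi' hd'W heW) rfl
    · intro hjlt
      exact ih _ (by rw [← hlen, d'.len_seg hjlt le_rfl]; omega) _
        (IsWide.right_of_sub hW h2 hi' hjlt hd'W heW) rfl

/-- Every wide shadow is the shadow of the modules filtered by the labels of the edges down from
some biclosed set. -/
theorem IsWide.exists_bic (hQ : Q.Thin) (hW : IsWide W) :
    ∃ B : Q.Bic, W ⊓ Q.shadowCat k = Filt (downModules k B.1) ⊓ Q.shadowCat k := by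
  have hT := isTorsionClass_torsionClosure (P := liftModules k Q ⊓ W)
    fun X hX => hW.finite X hX.2
  refine ⟨bicOf hQ hT, le_antisymm ?_ ?_⟩
  · rintro X ⟨hX, hM⟩
    have hF := isWide_filt (isSemibrick_downModules (k := k) hQ (bicOf hQ hT).2.1)
      (finite_downModules _)
    refine ⟨hF.add_le ?_ _ (mem_add_of_mem_shadowCat hQ (fun _ _ => hW.of_retract) hM hX), hM⟩
    rintro _ ⟨⟨d, rfl⟩, hd⟩
    exact IsWide.filt hQ hW d hd
  · have key : ∀ X, Filt (downModules k (bicOf hQ hT).1) X → W X := by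
      intro X hX
      induction hX with
      | zero X h => exact hW.of_subsingleton h
      | ext X Y Z f g hf hg hfg hX hZ ih =>
        obtain ⟨e, he, rfl⟩ := hX
        exact hW.of_exact f g hf hg hfg (IsWide.mem_of_isDown hQ hW he) ih
    rintro X ⟨hX, hM⟩
    exact ⟨key X hX, hM⟩

end Wide

end BoundQuiver

theorem mainTheorem2 {k : Type u} [Field k] {V : Type v} {E : Type w} [Fintype V] [Finite E]
    (Q : BoundQuiver V E) (hgentle : Q.IsGentle k) (hbrick : Q.IsBrickAlgebra k) :
    ∃ (Φ : Shadow.torshad (Q.shadowCat k) ≃ Shadow.widshad (Q.shadowCat k))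
      (β : Shadow.torshad (Q.shadowCat k) ≃o Q.Bic)
      (ψ : Q.Bic ≃ Q.ShardOrder)
      (ϑ : Q.ShardOrder ≃o Shadow.widshad (Q.shadowCat k)),
      (∀ T, (β T).1 = Q.stringsOf k T.1) ∧
      (∀ B, (β.symm B).1 = Q.shadowOf k B) ∧
      (∀ B, (ψ B).1 = BoundQuiver.shardSet B) ∧
      (∀ P, (ϑ P).1 = Shadow.add (Q.labelModules k P.1)) ∧
      (∀ T, Φ T = ϑ (ψ (β T))) := by
  have hQ : Q.Thin := fun c i j hi hj h => hbrick.thin c hi hj h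
  have hT : ∀ T : Shadow.torshad (Q.shadowCat k),
      ∃ T₀, Shadow.IsTorsionClass T₀ ∧ T.1 = T₀ ⊓ Q.shadowCat k ∧
        Q.stringsOf k T.1 = Q.stringsOf k T₀ := by
    rintro ⟨_, T₀, hT₀, rfl⟩
    exact ⟨T₀, hT₀, rfl, BoundQuiver.stringsOf_inf_shadowCat hQ T₀⟩
  have hβ : ∀ T : Shadow.torshad (Q.shadowCat k),
      BoundQuiver.IsClosedStr (Q.stringsOf k T.1) ∧
        BoundQuiver.IsClosedStr (Q.stringsOf k T.1)ᶜ := by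
    intro T
    obtain ⟨T₀, hT₀, -, h⟩ := hT T
    rw [h]
    exact ⟨BoundQuiver.isClosedStr_stringsOf hQ hT₀,
      BoundQuiver.isClosedStr_compl_stringsOf hQ hT₀⟩
  have hle : ∀ T T' : Shadow.torshad (Q.shadowCat k),
      Q.stringsOf k T.1 ⊆ Q.stringsOf k T'.1 ↔ T.1 ≤ T'.1 := by
    intro T T'
    obtain ⟨T₀, hT₀, h, h'⟩ := hT T
    obtain ⟨T₁, hT₁, h₁, h₁'⟩ := hT T'
    rw [h', h₁', h, h₁]
    exact BoundQuiver.inf_shadowCat_le_iff hQ hT₀ hT₁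
  have hS : ∀ B : Q.Bic, Shadow.IsTorsionClass
      (Shadow.torsionClosure (Q.labelModules k (BoundQuiver.labelsDown B))) := by
    intro B
    rw [BoundQuiver.labelModules_labelsDown hQ]
    exact Shadow.isTorsionClass_torsionClosure (BoundQuiver.finite_downModules B.1)
  have hSB : ∀ B : Q.Bic, Q.stringsOf k (Q.shadowOf k B) = B.1 := by
    intro B
    rw [BoundQuiver.shadowOf, BoundQuiver.stringsOf_inf_shadowCat hQ,
      BoundQuiver.labelModules_labelsDown hQ,
      BoundQuiver.stringsOf_torsionClosure_downModules hQ]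
  let g : Q.Bic → Shadow.torshad (Q.shadowCat k) := fun B => ⟨Q.shadowOf k B, _, hS B, rfl⟩
  let β : Shadow.torshad (Q.shadowCat k) ≃o Q.Bic :=
    { toFun := fun T => ⟨Q.stringsOf k T.1, hβ T⟩
      invFun := g
      left_inv := fun T => Subtype.ext (le_antisymm
        ((hle (g ⟨Q.stringsOf k T.1, hβ T⟩) T).1 (hSB ⟨Q.stringsOf k T.1, hβ T⟩).le)
        ((hle T (g ⟨Q.stringsOf k T.1, hβ T⟩)).1 (hSB ⟨Q.stringsOf k T.1, hβ T⟩).ge))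
      right_inv := fun B => Subtype.ext (hSB B)
      map_rel_iff' := fun {T T'} => hle T T' }
  let ψ : Q.Bic ≃ Q.ShardOrder := Equiv.ofBijective
    (fun B => ⟨BoundQuiver.shardSet B, B, rfl⟩)
    ⟨fun B B' h => BoundQuiver.shardSet_injective hQ k (congrArg Subtype.val h),
      fun P => by
        obtain ⟨P, B, rfl⟩ := P
        exact ⟨B, rfl⟩⟩
  have hW : ∀ B : Q.Bic, Shadow.IsWide (Shadow.Filt (BoundQuiver.downModules k B.1)) := fun B =>
    Shadow.isWide_filt (BoundQuiver.isSemibrick_downModules hQ B.2.1)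
      (BoundQuiver.finite_downModules B.1)
  have hP : ∀ P : Q.ShardOrder, Shadow.add (Q.labelModules k P.1) ∈
      Shadow.widshad (Q.shadowCat k) := by
    rintro ⟨_, B, rfl⟩
    exact ⟨_, hW B, BoundQuiver.add_labelModules_shardSet hQ B⟩
  let θ : Q.ShardOrder ↪o Shadow.widshad (Q.shadowCat k) := OrderEmbedding.ofMapLEIff
    (fun P => ⟨Shadow.add (Q.labelModules k P.1), hP P⟩) fun P P' =>
      ⟨fun h => BoundQuiver.subset_of_add_le hQ h,
        fun h => Shadow.add_mono (BoundQuiver.labelModules_mono h)⟩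
  let ϑ : Q.ShardOrder ≃o Shadow.widshad (Q.shadowCat k) := RelIso.ofSurjective θ (by
    rintro ⟨_, W, hWide, rfl⟩
    obtain ⟨B, hB⟩ := BoundQuiver.IsWide.exists_bic hQ hWide
    exact ⟨⟨BoundQuiver.shardSet B, B, rfl⟩,
      Subtype.ext ((BoundQuiver.add_labelModules_shardSet hQ B).trans hB.symm)⟩)
  exact ⟨β.toEquiv.trans (ψ.trans ϑ.toEquiv), β, ψ, ϑ, fun _ => rfl, fun _ => rfl, fun _ => rfl,
    fun _ => rfl, fun _ => rfl⟩
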